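/- Let $A$ be a principal ideal domain with fraction field $K$ and let $p\in A$ be prime, with residue field $k_p=A/(p)$. Let $f\in A[x]$ be monic of degree $d$, irreducible, and separable over $K$; put $L=K[x]/(f)=K(\theta)$ and let $B$ be the integral closure of $A$ in $L$. The index $D=D_f\in A$ (defined up to a unit) is a generator of the index ideal $[B:A[\theta]]$, that is, the determinant of a matrix expressing $1,\theta,\dots,\theta^{d-1}$ in an $A$-basis of $B$. (1) Whether $p\mid D_f$ depends only on $f \bmod p^2$: if $f$ and $g$ are two such polynomials and $f\equiv g \pmod{p^2}$, then $p\mid D_f$ if and only if $p\mid D_g$. (2) Whether $p\mid D_f$ can be checked with $\widetilde{O}(d)$ operations in $k_p$, in the following sense. Fix any set $\mathcal A\subset A$ of representatives of $k_p$. The input consists of the first two base-$p$ digits of the coefficients of $1,x,\dots,x^{d-1}$ in $f$ (elements of $k_p$, represented in $\mathcal A$). The algorithm is a computation tree depending only on $d$, whose operations are: the constants $0,1$; addition, subtraction, multiplication and inversion in $k_p$; and, for two elements of $\mathcal A$, the second base-$p$ digit (the carry) of their sum, difference or product formed in $A$. Each operation and each zero test costs one. The cost in the worst case is at most $C\,d\,(1+\lfloor\log_2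 d\rfloor)^{\kappa}$ for all $d\ge 1$, with absolute constants $C,\kappa$. (a) There is such a family of trees that decides $p\mid D_f$ for all $A,p,\mathcal A,f$ as above for which $\mathrm{char}(k_p)=0$, or $\mathrm{char}(k_p)>d$, or $k_p$ is a prime field (for instance whenever $A=\mathbb Z$). (b) If the extraction of an $\ell$-th root in $k_p$, where $\ell$ is the characteristic exponent of $k_p$, is allowed as a further operation of unit cost, there is such a family of trees that decides $p\mid D_f$ for all $A,p,\mathcal A,f$ as above for which $k_p$ is perfect. -/

import Mathlib

open Polynomial

universe u

namespace IndexTest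

/-! ### The index of a defining polynomial -/

section Index

variable {A : Type u} [CommRing A] [IsDomain A]

/-- `f` is monic, irreducible, and separable over the fraction field of `A`. -/
structure IsDefining (f : A[X]) : Prop where
  monic : f.Monic
  irreducible : Irreducible f
  separable : (f.map (algebraMap A (FractionRing A))).Separable

/-- The extension `L = K[x] / (f)` of `K = Frac A`. -/
abbrev RootAlgebra (f : A[X]) : Type u :=
  AdjoinRoot (f.map (algebraMap A (FractionRing A)))

/-- The class `θ` of `x` in `L`. -/
noncomputable abbrev theta (f : A[X]) : RootAlgebra f :=
  AdjoinRoot.root (f.map (algebraMap A (FractionRing A)))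

/-- `D` is an index of `f` (it is determined up to a unit): if `B` is the integral closure of `A`
in `L`, `D` is associated to the determinant of a matrix that expresses
`1, θ, …, θ ^ (d - 1)` in an `A`-basis of `B`; so `D` generates the index ideal `[B : A[θ]]`. -/
def IsIndex (f : A[X]) (D : A) : Prop :=
  ∃ (b : Module.Basis (Fin f.natDegree) A (integralClosure A (RootAlgebra f)))
    (M : Matrix (Fin f.natDegree) (Fin f.natDegree) A),
    (∀ j : Fin f.natDegree, theta f ^ (j : ℕ) = ∑ i, M i j • (b i : RootAlgebra f)) ∧ Associated D M.det

/-- Over a principal ideal domain every defining polynomial has an index. -/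
theorem exists_isIndex [IsPrincipalIdealRing A] {f : A[X]} (hf : IsDefining f) :
    ∃ D, IsIndex f D := by
  have hirr : Irreducible (f.map (algebraMap A (FractionRing A))) :=
    (hf.monic.irreducible_iff_irreducible_map_fraction_map).1 hf.irreducible
  have : Fact (Irreducible (f.map (algebraMap A (FractionRing A)))) := ⟨hirr⟩
  have hmon : (f.map (algebraMap A (FractionRing A))).Monic := hf.monic.map _
  have hfin : FiniteDimensional (FractionRing A) (RootAlgebra f) := hmon.finite_adjoinRoot
  have hsep : Algebra.IsSeparable (FractionRing A) (RootAlgebra f) := by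
    have h1 : IsSeparable (FractionRing A) (theta f) := by
      rw [IsSeparable, AdjoinRoot.minpoly_root hirr.ne_zero, hmon.leadingCoeff]
      simpa using hf.separable
    have h2 := (IntermediateField.isSeparable_adjoin_simple_iff_isSeparable
      (FractionRing A) (RootAlgebra f)).2 h1
    rw [IntermediateField.adjoin_root_eq_top] at h2
    exact Algebra.IsSeparable.of_algHom (FractionRing A) _
      (IntermediateField.topEquiv (F := FractionRing A) (E := RootAlgebra f)).symm.toAlgHom
  have htf : Module.IsTorsionFree A (RootAlgebra f) :=
    Module.IsTorsionFree.trans_faithfulSMul A (FractionRing A) (RootAlgebra f)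
  have hfree : Module.Free A (integralClosure A (RootAlgebra f)) :=
    IsIntegralClosure.module_free A (FractionRing A) (RootAlgebra f) _
  have hmf : Module.Finite A (integralClosure A (RootAlgebra f)) :=
    IsIntegralClosure.finite A (FractionRing A) (RootAlgebra f) _
  have hrank : Module.finrank A (integralClosure A (RootAlgebra f)) = f.natDegree := by
    rw [IsIntegralClosure.rank A (FractionRing A) (RootAlgebra f),
      (AdjoinRoot.powerBasis hirr.ne_zero).finrank, AdjoinRoot.powerBasis_dim,
      hf.monic.natDegree_map]
  let b := Module.finBasisOfFinrankEq A (integralClosure A (RootAlgebra f)) hrank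
  have hint : IsIntegral A (theta f) := by
    refine ⟨f, hf.monic, ?_⟩
    have h := AdjoinRoot.eval₂_root (f.map (algebraMap A (FractionRing A)))
    rw [eval₂_map] at h
    exact h
  let x : integralClosure A (RootAlgebra f) := ⟨theta f, hint⟩
  refine ⟨_, b, Matrix.of fun i j => b.repr (x ^ (j : ℕ)) i, fun j => ?_, Associated.refl _⟩
  have key : ∀ y : integralClosure A (RootAlgebra f),
      (y : RootAlgebra f) = ∑ i, b.repr y i • (b i : RootAlgebra f) := fun y => by
    have h := congrArg (integralClosure A (RootAlgebra f)).val (b.sum_repr y)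
    rw [map_sum] at h
    exact h.symm
  exact key (x ^ (j : ℕ))

end Index

/-! ### Residue field, representatives and digits -/

section Digits

variable {A : Type u} [CommRing A]

/-- The residue field `k_p = A / (p)`. -/
abbrev Residue (p : A) : Type u := A ⧸ Ideal.span {p}

/-- The residue class in `k_p` of an element of `A`: its lowest digit in base `p`. -/
abbrev residue (p a : A) : Residue p := Ideal.Quotient.mk (Ideal.span {p}) a

/-- `s` picks one representative in `A` of each residue class modulo `p`. -/
def IsRepresentatives (p : A) (s : Residue p → A) : Prop := ∀ a, residue p (s a) = a

open Classical in
/-- The second digit of `a` in base `p`: if `a = s (a mod p) + p * e`, it is `e mod p`. -/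
noncomputable def secondDigit (p : A) (s : Residue p → A) (a : A) : Residue p :=
  if h : ∃ e, a = s (residue p a) + p * e then residue p h.choose else 0

open Classical in
/-- The `ℓ`-th root of `a`, where `ℓ` is the characteristic exponent of `k_p` (so the root is `a`
itself in characteristic zero), and `0` if there is none. -/
noncomputable def charRoot (p : A) (a : Residue p) : Residue p :=
  if h : ∃ b : Residue p, b ^ ringExpChar (Residue p) = a then h.choose else 0

end Digits

/-! ### Computation trees over the residue field -/

/-- The operations of unit cost. Those with `carry` in their name return the second digit of the
sum, difference or product, formed in `A`, of the representatives of two residue classes. -/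
inductive Instr
  | zero | one | add | sub | mul | inv | carryAdd | carrySub | carryMul | root

/-- Computation trees: `leaf` answers; `step o k i j t` puts the value of the operation `o` on the
cells `i`, `j` into cell `k` and goes on with `t`; `test i t₀ t₁` goes on with `t₀` if cell `i`
holds zero and with `t₁` otherwise. -/
inductive CompTree
  | leaf (answer : Bool)
  | step (o : Instr) (k i j : ℕ) (t : CompTree)
  | test (i : ℕ) (t₀ t₁ : CompTree)

namespace CompTree

/-- The largest number of operations and zero tests on a path from the root to a leaf. -/
def cost : CompTree → ℕ
  | leaf _ => 0
  | step _ _ _ _ t => t.cost + 1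
  | test _ t₀ t₁ => max t₀.cost t₁.cost + 1

/-- The tree uses no operation `Instr.root`. -/
def RootFree : CompTree → Prop
  | leaf _ => True
  | step o _ _ _ t => o ≠ Instr.root ∧ t.RootFree
  | test _ t₀ t₁ => t₀.RootFree ∧ t₁.RootFree

end CompTree

section Eval

variable {A : Type u} [CommRing A]

/-- The value of an operation. (`Ring.inverse` is the inverse of a unit and `0` at `0`. The unary
operations use their first argument only.) -/
noncomputable def Instr.value (p : A) (s : Residue p → A) :
    Instr → Residue p → Residue p → Residue p
  | .zero, _, _ => 0
  | .one, _, _ => 1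
  | .add, a, b => a + b
  | .sub, a, b => a - b
  | .mul, a, b => a * b
  | .inv, a, _ => Ring.inverse a
  | .carryAdd, a, b => secondDigit p s (s a + s b)
  | .carrySub, a, b => secondDigit p s (s a - s b)
  | .carryMul, a, b => secondDigit p s (s a * s b)
  | .root, a, _ => charRoot p a

open Classical in
/-- The answer of a computation tree on a given content of the memory. -/
noncomputable def CompTree.run (p : A) (s : Residue p → A) :
    CompTree → (ℕ → Residue p) → Bool
  | .leaf answer, _ => answer
  | .step o k i j t, m => t.run p s (Function.update m k (o.value p s (m i) (m j)))
  | .test i t₀ t₁, m => if m i = 0 then t₀.run p s m else t₁.run p s m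

/-- The input for `f` of degree `d`: the lowest digits of the coefficients of `1, x, …, x ^ (d-1)`,
then their second digits; all other cells hold zero. -/
noncomputable def input (p : A) (s : Residue p → A) (f : A[X]) : ℕ → Residue p := fun i =>
  if i < f.natDegree then residue p (f.coeff i)
  else if i < 2 * f.natDegree then secondDigit p s (f.coeff (i - f.natDegree))
  else 0

end Eval

/-- `c d = O(d * (log d) ^ κ)` for some `κ`: softly linear growth. -/
def SoftlyLinear (c : ℕ → ℕ) : Prop :=
  ∃ C κ : ℕ, ∀ d : ℕ, 1 ≤ d → c d ≤ C * d * (Nat.log 2 d + 1) ^ κ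

/-- On every defining polynomial `f` of degree `d`, the tree answers whether `p` divides the
index of `f`. -/
def CompTree.DecidesIndex {A : Type u} [CommRing A] [IsDomain A] (t : CompTree) (p : A)
    (s : Residue p → A) (d : ℕ) : Prop :=
  ∀ f : A[X], IsDefining f → f.natDegree = d → ∀ D : A, IsIndex f D →
    (t.run p s (input p s f) = true ↔ p ∣ D)

end IndexTest

/-! Criterion. `p` divides the index iff `f` lies in `(p, φ)²` for some `φ` that is irreducible
modulo `p` (`isSingular_iff_dvd_index`). If `f = p²a + pφb + φ²c`, then `φ(θ)c(θ)/p` is integral and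
not in `A[θ]`. Conversely, if `A[θ]` is not maximal at `p`, some integral `β' ∉ A[θ]` satisfies `(p,
φ)β' ⊆ A[θ]`, and comparing `φ·(pβ')` with `p·(φβ')` puts `f` into `(p, φ)²`. Since `p²` is in this
ideal, only `f mod p²` matters, which is part (1).

Algorithm. Write `f = gh + pr`. At a common irreducible factor `φ` of `g` and `h` modulo `p`,
singularity means `φ ∣ r` modulo `p` (`singularAt_iff_dvd`), so the gcd of `g`, `h`, `r` handles all
such `φ` without factoring. It remains to find factorizations for which every possible `φ` is a
common factor. Let `f ≡ X^a F` with `F(0) ≠ 0`. The place `X` is read off the lowest coefficients. A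
repeated factor of `F` with nonzero derivative and with multiplicity nonzero in `k_p` divides both
`gcd(F, F')` and its cofactor (`dvd_of_sq_dvd`). This suffices if the characteristic is `0` or
exceeds `d`. Otherwise it is some `ℓ ≤ d`, and the remaining `φ` satisfy `φ^ℓ ∣ F`. Over a perfect
field `F = ∑ X^i G_i^ℓ`; let `Y` be the gcd of the `G_i`, so that `φ ∣ Y` and `Y^ℓ ∣ F`. Then such
`φ` divide both `H = gcd(F, Y)` and `F / H` (`dvd_quotient`). In a prime field the `ℓ`-th root is
the identity, so no root operation is needed.

Cost. All instances of degree `d` are treated at once: a value is an element of the product of all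
residue fields, and a zero test splits the set of instances. Hence the tree depends on `d` only.
Products use Schönhage's method with radix 2 and 3, valid over every commutative ring
(`exists_mulCost`); applied to the product of the rings `A`, it is carried to the first two digits
by `Comp.simulate`. Gcds use division steps from the low-order end, organized by divide and conquer
(`Decides.jump`, `Decides.gcd`). -/

namespace IndexTest

/-! ### Divisibility of the index by `p` as membership in the square of a maximal ideal. -/

section Criterion

variable {A : Type u} [CommRing A]

/-- `f` lies in the square of a maximal ideal `(p, φ)` of `A[x]`. -/
def IsSingular (p : A) (f : A[X]) : Prop :=
  ∃ φ a b c : A[X], Irreducible (φ.map (Ideal.Quotient.mk (Ideal.span {p}))) ∧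
    f = C p ^ 2 * a + C p * φ * b + φ ^ 2 * c

theorem map_mk_eq_zero_iff {p : A} {f : A[X]} :
    f.map (Ideal.Quotient.mk (Ideal.span {p})) = 0 ↔ C p ∣ f := by
  rw [C_dvd_iff_dvd_coeff, Polynomial.ext_iff]
  simp [Ideal.Quotient.eq_zero_iff_mem, Ideal.mem_span_singleton]

theorem map_mk_eq_iff {p : A} {f g : A[X]} :
    f.map (Ideal.Quotient.mk (Ideal.span {p})) = g.map (Ideal.Quotient.mk (Ideal.span {p})) ↔
      C p ∣ f - g := by
  rw [← map_mk_eq_zero_iff, Polynomial.map_sub, sub_eq_zero]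

theorem map_mk_surjective (p : A) :
    Function.Surjective fun f : A[X] => f.map (Ideal.Quotient.mk (Ideal.span {p})) :=
  Polynomial.map_surjective _ Ideal.Quotient.mk_surjective

theorem IsSingular.congr {p : A} {f g : A[X]}
    (h : f.map (Ideal.Quotient.mk (Ideal.span {p ^ 2})) =
      g.map (Ideal.Quotient.mk (Ideal.span {p ^ 2}))) (hf : IsSingular p f) : IsSingular p g := by
  obtain ⟨φ, a, b, c, hφ, e⟩ := hf
  obtain ⟨q, hq⟩ := map_mk_eq_iff.1 h
  refine ⟨φ, a - q, b, c, hφ, ?_⟩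
  rw [C_pow] at hq
  linear_combination e - hq

variable [IsDomain A]

theorem aeval_theta_eq_zero_iff {f : A[X]} (hf : f.Monic) {q : A[X]} :
    aeval (theta f) q = 0 ↔ f ∣ q := by
  rw [← Polynomial.map_dvd_map (algebraMap A (FractionRing A)) (IsFractionRing.injective _ _) hf,
    ← AdjoinRoot.mk_eq_zero, ← AdjoinRoot.aeval_eq, aeval_map_algebraMap]

/-- The index is divisible by `p` iff some element of `A[θ]` that is not divisible by `p` in `A[θ]`
becomes so in the integral closure. -/
theorem IsIndex.dvd_iff {f : A[X]} {p D : A} [(Ideal.span {p}).IsMaximal]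
    (hD : IsIndex f D) :
    p ∣ D ↔ ∃ h : A[X], h.degree < f.natDegree ∧ ¬ C p ∣ h ∧
      ∃ β : RootAlgebra f, IsIntegral A β ∧ aeval (theta f) h = p • β := by
  obtain ⟨b, M, hM, hDM⟩ := hD
  let _ : Field (Residue p) := Ideal.Quotient.field _
  have key : ∀ v : Fin f.natDegree → A,
      aeval (theta f) (∑ j, C (v j) * X ^ (j : ℕ)) = ∑ i, (M.mulVec v) i • (b i : RootAlgebra f) := by
    intro v
    simp only [map_sum, map_mul, aeval_C, map_pow, aeval_X, hM, Matrix.mulVec, dotProduct,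
      Finset.sum_smul, Finset.mul_sum]
    rw [Finset.sum_comm]
    refine Finset.sum_congr rfl fun i _ => Finset.sum_congr rfl fun j _ => ?_
    rw [← Algebra.smul_def, smul_smul, mul_comm]
  have hdet : p ∣ D ↔ (M.map (residue p)).det = 0 := by
    rw [hDM.dvd_iff_dvd_right]
    have := RingHom.map_det (Ideal.Quotient.mk (Ideal.span {p})) M
    change _ = (M.map (residue p)).det at this
    rw [← this, Ideal.Quotient.eq_zero_iff_mem, Ideal.mem_span_singleton]
  -- A kernel vector of `M` modulo `p` is the coefficient vector of a polynomial in `θ` that is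
  -- divisible by `p` in the integral closure.
  rw [hdet, ← Matrix.exists_mulVec_eq_zero_iff]
  have hres : ∀ v : Fin f.natDegree → A, (M.map (residue p)).mulVec (fun j => residue p (v j)) =
      fun i => residue p (M.mulVec v i) := by
    intro v; ext i
    simp [Matrix.mulVec, dotProduct]
  have hz : ∀ a : A, residue p a = 0 ↔ p ∣ a := fun a => by
    rw [Ideal.Quotient.eq_zero_iff_mem, Ideal.mem_span_singleton]
  constructor
  · rintro ⟨w, hw, hMw⟩
    choose v hv using fun j => Ideal.Quotient.mk_surjective (w j)
    obtain rfl : (fun j => residue p (v j)) = w := funext hv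
    rw [hres] at hMw
    have hc : ∀ i, p ∣ M.mulVec v i := fun i => (hz _).1 (congrFun hMw i)
    choose c hc using hc
    refine ⟨∑ j, C (v j) * X ^ (j : ℕ), degree_sum_fin_lt v, ?_, ∑ i, c i • (b i : RootAlgebra f),
      ?_, ?_⟩
    · intro hdv
      apply hw
      ext j
      rw [C_dvd_iff_dvd_coeff] at hdv
      have := hdv j
      rw [finsetSum_coeff] at this
      simp only [coeff_C_mul, coeff_X_pow, Fin.val_inj, mul_ite, mul_one, mul_zero,
        Finset.sum_ite_eq, Finset.mem_univ, if_true] at this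
      exact (hz _).2 this
    · exact IsIntegral.sum _ fun i _ => (b i).2.smul _
    · rw [key, Finset.smul_sum]
      exact Finset.sum_congr rfl fun i _ => by rw [hc, smul_smul]
  · rintro ⟨h, hdeg, hnd, β, hβ, e⟩
    have hh : h = ∑ j : Fin f.natDegree, C (h.coeff j) * X ^ (j : ℕ) := by
      rw [Fin.sum_univ_eq_sum_range fun j => C (h.coeff j) * X ^ j]
      exact h.as_sum_range_C_mul_X_pow' ((Polynomial.degree_lt_iff_coeff_zero _ _).1 hdeg |> fun H => by
        by_contra hlt
        push Not at hlt
        have h0 : h ≠ 0 := fun h0 => hnd (h0 ▸ dvd_zero _)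
        exact h0 (leadingCoeff_eq_zero.1 (H _ hlt)))
    refine ⟨fun j => residue p (h.coeff j), ?_, ?_⟩
    · intro h0
      apply hnd
      rw [C_dvd_iff_dvd_coeff]
      intro i
      by_cases hi : i < f.natDegree
      · exact (hz _).1 (congrFun h0 ⟨i, hi⟩)
      · rw [(Polynomial.degree_lt_iff_coeff_zero _ _).1 hdeg i (not_lt.1 hi)]
        exact dvd_zero _
    · rw [hres fun j => h.coeff j]
      ext i
      refine (hz _).2 ⟨b.repr ⟨β, hβ⟩ i, ?_⟩
      have h1 : ∑ i, (M.mulVec fun j : Fin f.natDegree => h.coeff j) i • b i = p • ⟨β, hβ⟩ := by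
        apply Subtype.ext
        rw [hh, key] at e
        simpa using e
      have h2 := congrArg (fun x => b.repr x i) h1
      simpa [Finsupp.single_apply] using h2

theorem IsDefining.fact_irreducible {f : A[X]} (hf : IsDefining f) [IsIntegrallyClosed A] :
    Fact (Irreducible (f.map (algebraMap A (FractionRing A)))) :=
  ⟨(hf.monic.irreducible_iff_irreducible_map_fraction_map).1 hf.irreducible⟩

theorem isIntegral_theta {f : A[X]} (hf : f.Monic) : IsIntegral A (theta f) :=
  ⟨f, hf, by rw [← aeval_def, aeval_theta_eq_zero_iff hf]⟩

theorem smul_rootAlgebra_injective {f : A[X]} {p : A} (hp : p ≠ 0)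
    [Fact (Irreducible (f.map (algebraMap A (FractionRing A))))] {x y : RootAlgebra f}
    (h : p • x = p • y) : x = y := by
  have : Module.IsTorsionFree A (RootAlgebra f) :=
    Module.IsTorsionFree.trans_faithfulSMul A (FractionRing A) (RootAlgebra f)
  exact smul_right_injective _ hp h

theorem aeval_theta_modByMonic {f : A[X]} (hf : f.Monic) (q : A[X]) :
    aeval (theta f) (q %ₘ f) = aeval (theta f) q := by
  rw [← sub_eq_zero, ← map_sub, aeval_theta_eq_zero_iff hf]
  exact ⟨-(q /ₘ f), by linear_combination Polynomial.modByMonic_add_div q f⟩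

/-- The element `β = φ(θ)c(θ)/p` maps the ideal `(p, φ(θ))` of `A[θ]` into itself: `pβ = φc` and `φβ
= φ²c/p = -(pa + φb)`. This ideal is a finitely generated nonzero module, so `β` is integral. -/
theorem IsSingular.exists_integral {f : A[X]} [IsNoetherianRing A] [IsIntegrallyClosed A]
    (hf : IsDefining f) {p : A}
    (hp : Prime p) [(Ideal.span {p}).IsMaximal] (hs : IsSingular p f) :
    ∃ h : A[X], h.degree < f.natDegree ∧ ¬ C p ∣ h ∧
      ∃ β : RootAlgebra f, IsIntegral A β ∧ aeval (theta f) h = p • β := by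
  obtain ⟨φ, a, b, c, hφ, e⟩ := hs
  let _ : Field (Residue p) := Ideal.Quotient.field _
  have := hf.fact_irreducible
  have hinj : Function.Injective (algebraMap A (RootAlgebra f)) := by
    rw [IsScalarTower.algebraMap_eq A (FractionRing A) (RootAlgebra f)]
    exact (algebraMap (FractionRing A) (RootAlgebra f)).injective.comp
      (IsFractionRing.injective A (FractionRing A))
  have hp0 : algebraMap A (RootAlgebra f) p ≠ 0 := by
    rw [Ne, ← map_zero (algebraMap A (RootAlgebra f)), hinj.eq_iff]; exact hp.ne_zero
  set θ := theta f with hθ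
  have hfθ : aeval θ f = 0 := (aeval_theta_eq_zero_iff hf.monic).2 dvd_rfl
  set π := algebraMap A (RootAlgebra f) p with hπ
  refine ⟨(φ * c) %ₘ f, ?_, ?_, π⁻¹ * aeval θ (φ * c), ?_, ?_⟩
  · rw [← degree_eq_natDegree hf.monic.ne_zero]
    exact degree_modByMonic_lt _ hf.monic
  -- If `p` divided the remainder, then `φc ≡ fw ≡ φ²cw` modulo `p` for the quotient `w`, and `φ`
  -- would be a unit.
  · rw [← map_mk_eq_zero_iff]
    intro h0
    have h1 := congrArg (Polynomial.map (Ideal.Quotient.mk (Ideal.span {p})))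
      (Polynomial.modByMonic_add_div (φ * c) f)
    have h2 := congrArg (Polynomial.map (Ideal.Quotient.mk (Ideal.span {p}))) e
    have hpp : Ideal.Quotient.mk (Ideal.span {p}) p = 0 := by
      rw [Ideal.Quotient.eq_zero_iff_mem]; exact Ideal.mem_span_singleton_self p
    rw [Polynomial.map_add, h0, zero_add] at h1
    simp only [Polynomial.map_mul, Polynomial.map_add, Polynomial.map_pow, map_C, hpp, map_zero]
      at h1 h2
    have hm : f.map (Ideal.Quotient.mk (Ideal.span {p})) ≠ 0 := (hf.monic.map _).ne_zero
    set F := f.map (Ideal.Quotient.mk (Ideal.span {p}))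
    set Φ := φ.map (Ideal.Quotient.mk (Ideal.span {p}))
    set c' := c.map (Ideal.Quotient.mk (Ideal.span {p}))
    set w := (φ * c /ₘ f).map (Ideal.Quotient.mk (Ideal.span {p}))
    have h3 : Φ * c' ≠ 0 := fun h => hm (by rw [h2]; linear_combination Φ * h)
    have h4 : Φ * w = 1 := mul_left_cancel₀ h3 (by linear_combination h1 - w * h2)
    exact hφ.not_isUnit (IsUnit.of_mul_eq_one _ h4)
  · let N : Submodule A (RootAlgebra f) :=
      ((Ideal.span {C p, φ}).restrictScalars A).map (aeval θ).toLinearMap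
    have hN : ∀ x, x ∈ N ↔ ∃ u w : A[X], x = π * aeval θ u + aeval θ φ * aeval θ w := by
      intro x
      simp only [N, Submodule.mem_map, Submodule.restrictScalars_mem, Ideal.mem_span_pair]
      constructor
      · rintro ⟨_, ⟨u, w, rfl⟩, rfl⟩
        exact ⟨u, w, by simp [hπ, mul_comm]⟩
      · rintro ⟨u, w, rfl⟩
        exact ⟨_, ⟨u, w, rfl⟩, by simp [hπ, mul_comm]⟩
    refine isIntegral_of_smul_mem_submodule N ?_ ?_ _ ?_
    · intro h
      have : π ∈ N := (hN _).2 ⟨1, 0, by simp⟩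
      rw [h, Submodule.mem_bot] at this
      exact hp0 this
    · have hfg := (isIntegral_theta hf.monic).fg_adjoin_singleton
      have := isNoetherian_of_fg_of_noetherian _ hfg
      refine Submodule.FG.of_le (T := Subalgebra.toSubmodule (Algebra.adjoin A {theta f})) hfg ?_
      rintro _ ⟨q, -, rfl⟩
      exact aeval_mem_adjoin_singleton _ _
    · intro x hx
      obtain ⟨u, w, rfl⟩ := (hN x).1 hx
      refine (hN _).2 ⟨-(a * w), c * u - b * w, ?_⟩
      have h2 := congrArg (aeval θ) e
      simp only [hfθ, map_mul, map_add, map_pow, aeval_C, ← hπ] at h2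
      simp only [map_mul, map_sub, map_neg, smul_eq_mul]
      field_simp
      linear_combination -(aeval θ w) * h2
  · rw [aeval_theta_modByMonic hf.monic, Algebra.smul_def, mul_inv_cancel_left₀ hp0]

theorem eq_of_map_dvd {p : A} {φ v : A[X]}
    (h : φ.map (Ideal.Quotient.mk (Ideal.span {p})) ∣ v.map (Ideal.Quotient.mk (Ideal.span {p}))) :
    ∃ a b, v = C p * a + φ * b := by
  obtain ⟨b', hb⟩ := h
  obtain ⟨b, rfl⟩ := map_mk_surjective p b'
  obtain ⟨a, ha⟩ : C p ∣ v - φ * b := map_mk_eq_iff.1 (by simpa using hb)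
  exact ⟨a, b, by linear_combination ha⟩

/-- Every coefficient of `P.scaleRoots u` except the leading one is a multiple of `u`, so under `χ`
the value at `v` becomes a power of `χ v`. -/
theorem eq_zero_of_eval_scaleRoots {S R : Type*} [CommRing S] [CommRing R] [IsDomain R]
    (χ : S →+* R) {P : S[X]} (hP : P.Monic) {u v : S} (hu : χ u = 0)
    (h : χ ((P.scaleRoots u).eval v) = 0) : χ v = 0 := by
  rw [← eval₂_hom, ← eval_map, map_scaleRoots _ _ _ (by
    rw [hP.leadingCoeff, map_one]; exact one_ne_zero), hu, scaleRoots_zero,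
    (hP.map χ).leadingCoeff, one_smul, eval_pow, eval_X] at h
  exact eq_zero_of_pow_eq_zero h

/-- If `u β` is a polynomial in `θ` for an integral `β` and a `u` divisible by `φ` modulo `p`,
then so is this polynomial. -/
theorem dvd_of_integral {f : A[X]} (hf : f.Monic) {p : A} {φ u v : A[X]}
    (hφ : Prime (φ.map (Ideal.Quotient.mk (Ideal.span {p}))))
    (hφf : φ.map (Ideal.Quotient.mk (Ideal.span {p})) ∣ f.map (Ideal.Quotient.mk (Ideal.span {p})))
    (hu : φ.map (Ideal.Quotient.mk (Ideal.span {p})) ∣ u.map (Ideal.Quotient.mk (Ideal.span {p})))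
    {β : RootAlgebra f} (hβ : IsIntegral A β) (h : aeval (theta f) u * β = aeval (theta f) v) :
    φ.map (Ideal.Quotient.mk (Ideal.span {p})) ∣ v.map (Ideal.Quotient.mk (Ideal.span {p})) := by
  obtain ⟨P, hP, hPβ⟩ := hβ
  set Φ := φ.map (Ideal.Quotient.mk (Ideal.span {p}))
  have h1 : eval₂ (aeval (theta f)).toRingHom β (P.map C) = 0 := by
    rw [eval₂_map, ← hPβ]
    congr 1
    ext a
    simp
  -- Clearing `u` from the integral equation of `β` gives a monic equation for `v(θ) = u(θ)β`, which
  -- holds modulo `f` in `A[x]` and can be reduced modulo `(p, φ)`.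
  have h2 := scaleRoots_eval₂_eq_zero (aeval (theta f)).toRingHom (s := u) h1
  have h3 : aeval (theta f) (((P.map C).scaleRoots u).eval v) = 0 := by
    rw [← h2]
    change _ = eval₂ _ (aeval (theta f) u * β) _
    rw [h]
    exact (eval₂_hom (aeval (theta f)).toRingHom v).symm
  rw [aeval_theta_eq_zero_iff hf] at h3
  let χ : A[X] →+* (Residue p)[X] ⧸ Ideal.span {Φ} :=
    (Ideal.Quotient.mk _).comp (Polynomial.mapRingHom (Ideal.Quotient.mk (Ideal.span {p})))
  have hχ : ∀ t, χ t = 0 ↔ Φ ∣ t.map (Ideal.Quotient.mk (Ideal.span {p})) := by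
    intro t
    simp only [χ, RingHom.comp_apply, coe_mapRingHom, Ideal.Quotient.eq_zero_iff_mem,
      Ideal.mem_span_singleton]
  have : IsDomain ((Residue p)[X] ⧸ Ideal.span {Φ}) := by
    rw [Ideal.Quotient.isDomain_iff_prime, Ideal.span_singleton_prime hφ.ne_zero]
    exact hφ
  rw [← hχ]
  exact eq_zero_of_eval_scaleRoots (R := (Residue p)[X] ⧸ Ideal.span {Φ}) χ (hP.map C) ((hχ u).2 hu)
    ((hχ _).2 (hφf.trans (Polynomial.map_dvd _ h3)))

/-- The polynomials carrying `β` into `A[θ]` form a proper ideal `J` that contains `p` and `f`. A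
generator of `J` modulo `p` factors as `φτ` with `φ` irreducible, and `β' = τ(θ)β` is outside `A[θ]`
although `p` and `φ` carry it into `A[θ]`. -/
theorem IsSingular.of_integral {f : A[X]} (hf : IsDefining f) [IsIntegrallyClosed A] {p : A}
    (hp : Prime p) [(Ideal.span {p}).IsMaximal]
    (h : ∃ h : A[X], h.degree < f.natDegree ∧ ¬ C p ∣ h ∧
      ∃ β : RootAlgebra f, IsIntegral A β ∧ aeval (theta f) h = p • β) : IsSingular p f := by
  obtain ⟨h, hdeg, hnd, β, hβ, e⟩ := h
  let _ : Field (Residue p) := Ideal.Quotient.field _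
  have := hf.fact_irreducible
  set m := Ideal.Quotient.mk (Ideal.span {p}) with hm
  have hpp : m p = 0 := by
    rw [Ideal.Quotient.eq_zero_iff_mem]; exact Ideal.mem_span_singleton_self p
  have hnot : ∀ (x : RootAlgebra f) (g : A[X]), g.degree < f.natDegree → ¬ C p ∣ g →
      aeval (theta f) g = p • x → ∀ q : A[X], aeval (theta f) q ≠ x := by
    rintro x g hg hpg hgx q rfl
    have h1 : f ∣ g - C p * q := by
      rw [← aeval_theta_eq_zero_iff hf.monic, map_sub, hgx, map_mul, aeval_C, Algebra.smul_def,
        sub_self]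
    have h2 : f.map m ∣ g.map m := by
      have := Polynomial.map_dvd m h1
      simpa [hpp] using this
    apply hpg
    rw [← map_mk_eq_zero_iff]
    refine eq_zero_of_dvd_of_degree_lt h2 ?_
    rw [hf.monic.degree_map, degree_eq_natDegree hf.monic.ne_zero]
    exact degree_map_le.trans_lt hg
  -- the ideal of all polynomials that carry `β` into `A[θ]`
  let J : Ideal A[X] :=
    { carrier := {t | ∃ q : A[X], aeval (theta f) t * β = aeval (theta f) q}
      add_mem' := by
        rintro s t ⟨q, hq⟩ ⟨q', hq'⟩
        exact ⟨q + q', by simp [add_mul, hq, hq']⟩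
      zero_mem' := ⟨0, by simp⟩
      smul_mem' := by
        rintro s t ⟨q, hq⟩
        exact ⟨s * q, by simp [mul_assoc, hq]⟩ }
  have hJp : ∀ a, C p * a ∈ J := fun a => J.mul_mem_right a ⟨h, by simp [e, Algebra.smul_def]⟩
  have hJf : f ∈ J := ⟨0, by simp [(aeval_theta_eq_zero_iff hf.monic).2 dvd_rfl]⟩
  let J' := J.map (mapRingHom m)
  have hJ' : ∀ t, t.map m ∈ J' ↔ t ∈ J := by
    intro t
    constructor
    · intro ht
      obtain ⟨x, hx, hxt⟩ := (Ideal.mem_map_iff_of_surjective (mapRingHom m)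
        (map_mk_surjective p)).1 ht
      obtain ⟨y, hy⟩ := map_mk_eq_iff.1 hxt
      have : t = x - C p * y := by linear_combination -hy
      rw [this]
      exact J.sub_mem hx (hJp y)
    · intro ht
      exact Ideal.mem_map_of_mem (mapRingHom m) ht
  obtain ⟨q', hq'⟩ := (IsPrincipalIdealRing.principal J').principal
  have hmem : ∀ t, t ∈ J ↔ q' ∣ t.map m := by
    intro t
    rw [← hJ', hq']
    exact Ideal.mem_span_singleton
  have hq0 : q' ≠ 0 := by
    rintro rfl
    exact (hf.monic.map m).ne_zero (zero_dvd_iff.1 ((hmem f).1 hJf))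
  have hqu : ¬ IsUnit q' := by
    intro hu
    obtain ⟨q, hq⟩ := (hmem 1).2 (by simpa using hu.dvd)
    exact hnot β h hdeg hnd e q (by simpa using hq.symm)
  obtain ⟨φ', hφ', τ', rfl⟩ := WfDvdMonoid.exists_irreducible_factor hqu hq0
  obtain ⟨φ, rfl⟩ := map_mk_surjective p φ'
  obtain ⟨τ, rfl⟩ := map_mk_surjective p τ'
  simp only [← hm] at *
  have hφf : φ.map m ∣ f.map m := (dvd_mul_right _ _).trans ((hmem f).1 hJf)
  have hτ : τ ∉ J := by
    rw [hmem]
    rintro ⟨s, hs⟩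
    have : φ.map m * s = 1 := mul_left_cancel₀ (right_ne_zero_of_mul hq0)
      (by rw [mul_one]; conv_rhs => rw [hs]
          ring)
    exact hφ'.not_isUnit (IsUnit.of_mul_eq_one _ this)
  set β' := aeval (theta f) τ * β with hβ'
  have hβi : IsIntegral A β' :=
    (IsIntegral.of_mem_of_fg _ (isIntegral_theta hf.monic).fg_adjoin_singleton _
      (aeval_mem_adjoin_singleton _ _)).mul hβ
  have hβA : ∀ q : A[X], aeval (theta f) q ≠ β' := fun q hq => hτ ⟨q, hq.symm⟩
  obtain ⟨g₀, hg₀⟩ := hJp τ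
  obtain ⟨g', hg'⟩ : φ * τ ∈ J := (hmem _).2 (by simp)
  rw [map_mul, mul_assoc, ← hβ'] at hg₀ hg'
  set g := g₀ %ₘ f with hg
  rw [← aeval_theta_modByMonic hf.monic g₀, ← hg] at hg₀
  have hgd : g.degree < f.degree := degree_modByMonic_lt _ hf.monic
  have hgp : ¬ C p ∣ g := by
    rintro ⟨y, hy⟩
    apply hβA y
    apply smul_rootAlgebra_injective (p := p) hp.ne_zero
    rw [Algebra.smul_def, Algebra.smul_def, ← aeval_C (theta f), hg₀, hy, map_mul]
  obtain ⟨a₂, b₂, hgm⟩ := eq_of_map_dvd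
    (dvd_of_integral hf.monic (p := p) hφ'.prime hφf (by simp [map_C]) hβi hg₀)
  obtain ⟨a, b, hgm'⟩ := eq_of_map_dvd
    (dvd_of_integral hf.monic (p := p) hφ'.prime hφf dvd_rfl hβi hg')
  obtain ⟨w, hw⟩ : f ∣ φ * g - C p * g' := by
    rw [← aeval_theta_eq_zero_iff hf.monic, map_sub, map_mul, map_mul, ← hg₀, ← hg']
    ring
  -- Otherwise `g ≡ f w₂` modulo `p`; since `deg g < deg f` this forces `p ∣ g`, that is, `β' ∈
  -- A[θ]`.
  have hw' : ¬ φ.map m ∣ w.map m := by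
    rintro ⟨w₂, hw₂⟩
    have h1 := congrArg (Polynomial.map m) hw
    simp only [Polynomial.map_mul, Polynomial.map_sub, map_C, hpp, map_zero, zero_mul, sub_zero,
      hw₂] at h1
    have h2 : g.map m = f.map m * w₂ := mul_left_cancel₀ hφ'.ne_zero (by rw [h1]; ring)
    apply hgp
    rw [← map_mk_eq_zero_iff]
    refine eq_zero_of_dvd_of_degree_lt ⟨w₂, h2⟩ ?_
    rw [hf.monic.degree_map]
    exact degree_map_le.trans_lt hgd
  -- `fw = φg - pg'` lies in `(p, φ)²` because `g` and `g'` lie in `(p, φ)`. As `w` is invertible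
  -- modulo `(p, φ)` and `f ∈ (p, φ)`, also `f ∈ (p, φ)²`.
  obtain ⟨s', t', hst⟩ := (hφ'.coprime_iff_not_dvd.2 hw').symm
  obtain ⟨s, rfl⟩ := map_mk_surjective p s'
  obtain ⟨t, rfl⟩ := map_mk_surjective p t'
  obtain ⟨z, hz⟩ : C p ∣ s * w + t * φ - 1 := map_mk_eq_iff.1 (by simpa using hst)
  obtain ⟨f₂, f₁, hff⟩ := eq_of_map_dvd hφf
  refine ⟨φ, -(s * a) - z * f₂, s * a₂ - s * b + t * f₂ - z * f₁, s * b₂ + t * f₁, hφ', ?_⟩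
  have hw2 : f * w = φ * (C p * a₂ + φ * b₂) - C p * (C p * a + φ * b) := by
    rw [← hgm, ← hgm', hw]
  linear_combination -f * hz + s * hw2 + (t * φ - C p * z) * hff

theorem isSingular_iff_dvd_index {f : A[X]} (hf : IsDefining f) [IsPrincipalIdealRing A] {p D : A}
    (hp : Prime p) (hD : IsIndex f D) : p ∣ D ↔ IsSingular p f := by
  have : (Ideal.span {p}).IsMaximal :=
    PrincipalIdealRing.isMaximal_of_irreducible hp.irreducible
  rw [hD.dvd_iff]
  exact ⟨IsSingular.of_integral hf hp, IsSingular.exists_integral hf hp⟩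

end Criterion

/-! ### Straight line computations, modelled by the growing set of known values. -/

section StraightLine

variable {V : Type*}

/-- With at most `c` of the operations `ops` one gets from the values in `S` to those in `T`. -/
inductive Comp (ops : Set (V → V → V)) (T : Set V) : ℕ → Set V → Prop
  | done {c : ℕ} {S : Set V} (h : T ⊆ S) : Comp ops T c S
  | step {c : ℕ} {S : Set V} {o : V → V → V} {x y : V} (ho : o ∈ ops) (hx : x ∈ S) (hy : y ∈ S)
      (h : Comp ops T c (insert (o x y) S)) : Comp ops T (c + 1) S

namespace Comp

variable {ops : Set (V → V → V)} {S S' T T' : Set V} {c c' : ℕ}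

theorem mono (h : Comp ops T c S) (hS : S ⊆ S') (hc : c ≤ c') (hT : T' ⊆ T) :
    Comp ops T' c' S' := by
  induction h generalizing S' c' with
  | done h => exact .done (hT.trans (h.trans hS))
  | step ho hx hy _ ih =>
    obtain ⟨c', rfl⟩ := Nat.exists_eq_add_of_le' (Nat.one_le_of_lt hc)
    exact .step ho (hS hx) (hS hy) (ih (Set.insert_subset_insert hS) (by omega))

theorem keep (h : Comp ops T c S) : Comp ops (S ∪ T) c S := by
  induction h with
  | done h => exact .done (Set.union_subset subset_rfl h)
  | step ho hx hy _ ih =>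
    exact .step ho hx hy (ih.mono subset_rfl le_rfl
      (Set.union_subset_union_left _ (Set.subset_insert _ _)))

theorem bind (h : Comp ops T c S) (h' : ∀ S', S ⊆ S' → T ⊆ S' → Comp ops T' c' S') :
    Comp ops T' (c + c') S := by
  suffices H : Comp ops T' c' (S ∪ T) → Comp ops T' (c + c') S from
    H (h' _ Set.subset_union_left Set.subset_union_right)
  clear h'
  induction h with
  | done h =>
    intro H
    rw [Set.union_eq_self_of_subset_right h] at H
    exact H.mono subset_rfl (Nat.le_add_left _ _) subset_rfl
  | step ho hx hy _ ih =>
    intro H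
    rw [Nat.add_right_comm]
    exact .step ho hx hy (ih (H.mono (Set.union_subset_union_left _ (Set.subset_insert _ _))
      le_rfl subset_rfl))

theorem union (h : Comp ops T c S) (h' : Comp ops T' c' S) : Comp ops (T ∪ T') (c + c') S :=
  h.bind fun _ hS hT => ((h'.mono hS le_rfl subset_rfl).keep).mono subset_rfl le_rfl
    (Set.union_subset_union_left _ hT)

theorem biUnion {ι : Type*} (s : Finset ι) {T : ι → Set V} (h : ∀ i ∈ s, Comp ops (T i) c S) :
    Comp ops (⋃ i ∈ s, T i) (s.card * c) S := by
  classical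
  induction s using Finset.induction_on with
  | empty => exact .done (by simp)
  | insert i s hi ih =>
    rw [Finset.card_insert_of_notMem hi, Finset.set_biUnion_insert, add_mul, one_mul, add_comm]
    exact (h i (Finset.mem_insert_self _ _)).union
      (ih fun j hj => h j (Finset.mem_insert_of_mem hj))

/-- Values indexed by a finite set, each at the cost `c`. -/
theorem forall_mem {ι : Type*} (s : Finset ι) {v : ι → V} (h : ∀ i ∈ s, Comp ops {v i} c S)
    (hT : ∀ x ∈ T, ∃ i ∈ s, x = v i) : Comp ops T (s.card * c) S :=
  (biUnion s h).mono subset_rfl le_rfl fun x hx => by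
    obtain ⟨i, hi, rfl⟩ := hT x hx
    simp only [Set.mem_iUnion, Set.mem_singleton_iff]
    exact ⟨i, hi, rfl⟩

theorem ops_mono {ops' : Set (V → V → V)} (h : Comp ops T c S) (ho : ops ⊆ ops') :
    Comp ops' T c S := by
  induction h with
  | done h => exact .done h
  | step h hx hy _ ih => exact .step (ho h) hx hy ih

theorem op {o : V → V → V} (ho : o ∈ ops) {x y : V} (hx : x ∈ S) (hy : y ∈ S) :
    Comp ops {o x y} 1 S :=
  .step ho hx hy (.done (by simp))

end Comp

variable (V) in
/-- The operations of a ring. -/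
def ringOps [CommRing V] : Set (V → V → V) :=
  {fun x y => x + y, fun x y => x - y, fun x y => x * y, fun _ _ => 0, fun _ _ => 1}

section Ring

variable [CommRing V] {ops : Set (V → V → V)} {S : Set V} {x y : V}

theorem Comp.add (ho : ringOps V ⊆ ops) (hx : x ∈ S) (hy : y ∈ S) : Comp ops {x + y} 1 S :=
  .op (o := fun x y => x + y) (ho (by simp [ringOps])) hx hy

theorem Comp.sub (ho : ringOps V ⊆ ops) (hx : x ∈ S) (hy : y ∈ S) : Comp ops {x - y} 1 S :=
  .op (o := fun x y => x - y) (ho (by simp [ringOps])) hx hy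

theorem Comp.mul (ho : ringOps V ⊆ ops) (hx : x ∈ S) (hy : y ∈ S) : Comp ops {x * y} 1 S :=
  .op (o := fun x y => x * y) (ho (by simp [ringOps])) hx hy

theorem Comp.zero (ho : ringOps V ⊆ ops) (hx : x ∈ S) : Comp ops {0} 1 S :=
  .op (o := fun _ _ => (0 : V)) (ho (by simp [ringOps])) hx hx

theorem Comp.one (ho : ringOps V ⊆ ops) (hx : x ∈ S) : Comp ops {1} 1 S :=
  .op (o := fun _ _ => (1 : V)) (ho (by simp [ringOps])) hx hx

theorem Comp.sum_succ (ho : ringOps V ⊆ ops) (n : ℕ) {v : ℕ → V} (hv : ∀ i ≤ n, v i ∈ S) :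
    Comp ops {∑ i ∈ Finset.range (n + 1), v i} n S := by
  induction n with
  | zero => exact .done (by simpa using hv 0 le_rfl)
  | succ n ih =>
    refine (ih fun i hi => hv i (by omega)).bind fun S' hS hT => ?_
    rw [Finset.sum_range_succ]
    exact .add ho (by simpa using hT) (hS (hv _ le_rfl))

theorem Comp.sum (ho : ringOps V ⊆ ops) {n : ℕ} (hn : 0 < n) {v : ℕ → V}
    (hv : ∀ i < n, v i ∈ S) : Comp ops {∑ i ∈ Finset.range n, v i} n S := by
  obtain ⟨m, rfl⟩ := Nat.exists_eq_add_of_le' hn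
  exact (Comp.sum_succ ho m fun i hi => hv i (by omega)).mono subset_rfl (by omega) subset_rfl

/-- Natural multiples, by doubling. -/
theorem Comp.natCast (ho : ringOps V ⊆ ops) (hx : x ∈ S) (n : ℕ) :
    Comp ops {(n : V)} (2 * Nat.log 2 n + 2) S := by
  have h1 : Comp ops {(1 : V), 0} 2 S := by
    have := (Comp.one ho hx).union (Comp.zero ho hx)
    rwa [Set.singleton_union] at this
  rw [add_comm]
  refine h1.bind fun S hS hT => ?_
  clear h1 hx hS
  have h1 : (1 : V) ∈ S := hT (by simp)
  have h0 : (0 : V) ∈ S := hT (by simp)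
  clear hT
  induction n using Nat.strong_induction_on with
  | _ n ih =>
    rcases lt_or_ge n 2 with hn | hn
    · interval_cases n
      · exact .done (by simpa)
      · exact .done (by simpa)
    · have hlog : Nat.log 2 n = Nat.log 2 (n / 2) + 1 := Nat.log_of_one_lt_of_le one_lt_two hn
      rw [hlog, mul_add, mul_one]
      refine (ih (n / 2) (by omega)).bind fun S₁ hS₁ hT₁ => ?_
      have hm : ((n / 2 : ℕ) : V) ∈ S₁ := by simpa using hT₁
      refine (Comp.add ho hm hm).bind (c := 1) (c' := 1) fun S₂ hS₂ hT₂ => ?_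
      have hm' : ((n / 2 : ℕ) : V) + ((n / 2 : ℕ) : V) ∈ S₂ := by simpa using hT₂
      rcases Nat.even_or_odd' n with ⟨m, rfl | rfl⟩
      · refine .done ?_
        rw [show 2 * m / 2 = m by omega] at hm'
        rw [Set.singleton_subset_iff]
        convert hm' using 1
        push_cast; ring
      · rw [show (2 * m + 1) / 2 = m by omega] at hm'
        have := Comp.add ho hm' (hS₂ (hS₁ h1))
        convert this using 2
        push_cast; ring

end Ring

end StraightLine

/-! ### The fast Fourier transform over the group ring of `ℤ/M`. -/

section Fourier

variable {V : Type*} [CommRing V] {M : ℕ}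

/-- The root of unity with exponent `z` in the group ring of `ℤ/M`. -/
noncomputable def rot (V : Type*) [CommRing V] {M : ℕ} (z : ZMod M) : AddMonoidAlgebra V (ZMod M) :=
  AddMonoidAlgebra.single z 1

theorem rot_add (a b : ZMod M) : rot V (a + b) = rot V a * rot V b := by
  simp [rot, AddMonoidAlgebra.single_mul_single]

@[simp] theorem rot_zero : rot V (0 : ZMod M) = 1 := rfl

theorem rot_nsmul (n : ℕ) (z : ZMod M) : rot V (n • z) = rot V z ^ n := by
  induction n with
  | zero => simp
  | succ n ih => rw [succ_nsmul, rot_add, ih, pow_succ]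

/-- Multiplication by a root of unity only permutes coefficients and is free, so the transforms cost
additions alone. -/
theorem coeff_rot_mul (z w : ZMod M) (q : AddMonoidAlgebra V (ZMod M)) :
    (rot V z * q).coeff w = q.coeff (w - z) := by
  rw [rot, AddMonoidAlgebra.coeff_single_mul_eq_mul_coeff (w - z), one_mul]
  intro m _
  rw [eq_sub_iff_add_eq, add_comm]

/-- The Fourier transform of length `n` with respect to the root of unity with exponent `z`. -/
noncomputable def dft (n : ℕ) (z : ZMod M) (a : ℕ → AddMonoidAlgebra V (ZMod M)) (j : ℕ) :
    AddMonoidAlgebra V (ZMod M) :=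
  ∑ i ∈ Finset.range n, rot V ((i * j) • z) * a i

theorem dft_mod {n : ℕ} {z : ZMod M} (hz : n • z = 0) (a : ℕ → AddMonoidAlgebra V (ZMod M))
    (j : ℕ) : dft n z a (j % n) = dft n z a j := by
  refine Finset.sum_congr rfl fun i _ => ?_
  congr 2
  conv_rhs => rw [← Nat.mod_add_div j n]
  rw [mul_add, add_nsmul, show i * (n * (j / n)) = (i * (j / n)) * n by ring, mul_nsmul' _ _ n, hz]
  simp

theorem sum_range_mul {N : Type*} [AddCommMonoid N] (f : ℕ → N) (n r : ℕ) :
    ∑ i ∈ Finset.range (n * r), f i =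
      ∑ y ∈ Finset.range n, ∑ x ∈ Finset.range r, f (y * r + x) := by
  induction n with
  | zero => simp
  | succ n ih => rw [add_mul, one_mul, Finset.sum_range_add, ih, Finset.sum_range_succ]

/-- The Cooley–Tukey step: the indices are split by their residue modulo `r`. -/
theorem dft_mul (r n : ℕ) (z : ZMod M) (a : ℕ → AddMonoidAlgebra V (ZMod M)) (j : ℕ) :
    dft (n * r) z a j =
      ∑ i ∈ Finset.range r, rot V ((i * j) • z) * dft n (r • z) (fun l => a (l * r + i)) j := by
  simp only [dft, Finset.mul_sum]
  rw [Finset.sum_comm]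
  rw [sum_range_mul]
  refine Finset.sum_congr rfl fun y _ => Finset.sum_congr rfl fun x _ => ?_
  rw [← mul_assoc, ← rot_add, ← mul_nsmul', ← add_nsmul]
  congr 3
  ring

/-- The fast Fourier transform. -/
theorem Comp.fft {S : Set V} [NeZero M] {r : ℕ} (hr : 0 < r) (k : ℕ) (z : ZMod M)
    (hz : r ^ k • z = 0) (a : ℕ → AddMonoidAlgebra V (ZMod M))
    (ha : ∀ i < r ^ k, ∀ w, (a i).coeff w ∈ S) :
    Comp (ringOps V) {v | ∃ j w, v = (dft (r ^ k) z a j).coeff w} (k * r ^ k * (r * M)) S := by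
  induction k generalizing z a with
  | zero =>
    refine .done ?_
    rintro _ ⟨j, w, rfl⟩
    simpa [dft] using ha 0 (by simp) w
  | succ k ih =>
    have h1 : Comp (ringOps V) (⋃ i ∈ Finset.range r,
        {v | ∃ j w, v = (dft (r ^ k) (r • z) (fun l => a (l * r + i)) j).coeff w})
        ((Finset.range r).card * (k * r ^ k * (r * M))) S := by
      refine .biUnion _ fun i hi => ih (r • z) ?_ _ fun l hl w => ha _ ?_ w
      · rw [← mul_nsmul', mul_comm, ← pow_succ', hz]
      · rw [Finset.mem_range] at hi
        calc l * r + i < l * r + r := by omega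
          _ = (l + 1) * r := by ring
          _ ≤ r ^ k * r := Nat.mul_le_mul_right _ hl
          _ = r ^ (k + 1) := (pow_succ _ _).symm
    -- Each of the `r ^ (k + 1) * M` new coefficients is a sum of `r` known ones.
    refine (h1.bind (c' := r ^ (k + 1) * M * r) fun S' hS hT => ?_).mono subset_rfl ?_ subset_rfl
    · have h2 := Comp.forall_mem (ops := ringOps V) (S := S') (c := r)
        (T := {v | ∃ j w, v = (dft (r ^ (k + 1)) z a j).coeff w})
        (Finset.range (r ^ (k + 1)) ×ˢ (Finset.univ : Finset (ZMod M)))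
        (v := fun jw => (dft (r ^ (k + 1)) z a jw.1).coeff jw.2) ?_ ?_
      · simpa [ZMod.card] using h2
      · rintro ⟨j, w⟩ -
        have : (dft (r ^ (k + 1)) z a j).coeff w = ∑ i ∈ Finset.range r,
            (dft (r ^ k) (r • z) (fun l => a (l * r + i)) j).coeff (w - (i * j) • z) := by
          rw [pow_succ, dft_mul]
          simp only [AddMonoidAlgebra.coeff_sum, Finsupp.finsetSum_apply, coeff_rot_mul]
        simp only [this]
        refine .sum subset_rfl hr fun i hi => hT ?_
        simp only [Set.mem_iUnion, Finset.mem_range]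
        exact ⟨i, hi, j, _, rfl⟩
      · rintro _ ⟨j, w, rfl⟩
        refine ⟨(j % r ^ (k + 1), w), ?_, ?_⟩
        · simpa using Nat.mod_lt _ (pow_pos hr _)
        · simp only [dft_mod hz]
    · rw [Finset.card_range]
      apply le_of_eq
      ring

end Fourier

/-! ### Splitting polynomials into blocks and recombining them. -/

section Truncation

variable {V : Type*} [CommRing V]

/-- The polynomial with the coefficients `c 0, …, c (N - 1)`. -/
noncomputable def polyOf (N : ℕ) (c : ℕ → V) : V[X] := ∑ i ∈ Finset.range N, monomial i (c i)

theorem coeff_polyOf (N : ℕ) (c : ℕ → V) (i : ℕ) :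
    (polyOf N c).coeff i = if i < N then c i else 0 := by
  simp [polyOf, finsetSum_coeff, coeff_monomial]

theorem natDegree_polyOf_lt {N : ℕ} (hN : 0 < N) (c : ℕ → V) : (polyOf N c).natDegree < N := by
  refine lt_of_le_of_lt (natDegree_le_iff_coeff_eq_zero.2 fun i hi => ?_) (Nat.sub_one_lt_of_lt hN)
  rw [coeff_polyOf, if_neg (by omega)]

theorem polyOf_coeff {N : ℕ} {f : V[X]} (hf : f.natDegree < N) : polyOf N f.coeff = f := by
  ext i
  rw [coeff_polyOf]
  split_ifs with h
  · rfl
  · rw [coeff_eq_zero_of_natDegree_lt (by omega)]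

theorem natDegree_mul_lt {f g : V[X]} {m n : ℕ} (hf : f.natDegree < m) (hg : g.natDegree < n) :
    (f * g).natDegree < m + n - 1 := by
  have := natDegree_mul_le (p := f) (q := g)
  omega

/-- Splitting a polynomial into blocks of length `m`. -/
theorem exists_blocks {m : ℕ} (hm : 0 < m) {f : V[X]} (hf : f.natDegree < m * m) :
    ∃ P : V[X][X], P.natDegree < m ∧ (∀ i, (P.coeff i).natDegree < m) ∧
      (∀ i l, ∃ q, (P.coeff i).coeff l = f.coeff q) ∧ P.eval (X ^ m) = f := by
  refine ⟨polyOf m fun i => polyOf m fun l => f.coeff (i * m + l), natDegree_polyOf_lt hm _,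
    fun i => ?_, fun i l => ?_, ?_⟩
  · rw [coeff_polyOf]
    split_ifs
    · exact natDegree_polyOf_lt hm _
    · simpa
  · have h0 : ∃ q, 0 = f.coeff q := ⟨m * m, (coeff_eq_zero_of_natDegree_lt hf).symm⟩
    rw [coeff_polyOf]
    split_ifs
    · rw [coeff_polyOf]
      split_ifs
      · exact ⟨_, rfl⟩
      · exact h0
    · simpa using h0
  · conv_rhs => rw [← polyOf_coeff hf, polyOf, sum_range_mul]
    rw [polyOf, eval_finsetSum]
    refine Finset.sum_congr rfl fun i _ => ?_
    rw [eval_monomial, polyOf, Finset.sum_mul]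
    refine Finset.sum_congr rfl fun l _ => ?_
    rw [← pow_mul, monomial_mul_X_pow]
    congr 1
    ring_nf

/-- Blocks of length below `2 * m` placed at distance `m` overlap only with their neighbours, so
recombination costs one addition per coefficient. -/
theorem coeff_eval_X_pow {m : ℕ} {P : V[X][X]} (hP : ∀ i, (P.coeff i).natDegree < 2 * m)
    (s l : ℕ) (hl : l < m) :
    (P.eval (X ^ m)).coeff (s * m + l) =
      (P.coeff s).coeff l + if s = 0 then 0 else (P.coeff (s - 1)).coeff (l + m) := by
  rw [eval_eq_sum_range' (show P.natDegree < P.natDegree + s + 1 by omega), finsetSum_coeff]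
  simp only [← pow_mul, coeff_mul_X_pow']
  have h1 : ∀ i, s < i → ¬ m * i ≤ s * m + l := by
    intro i hi
    have : m * (s + 1) ≤ m * i := Nat.mul_le_mul_left _ hi
    rw [mul_add] at this
    rw [mul_comm s m]
    omega
  rcases s with _ | s
  · rw [Finset.sum_eq_single 0]
    · simp
    · intro i _ hi
      rw [if_neg (h1 i (by omega))]
    · simp
  · have h2 : ∀ i, i < s → (if m * i ≤ (s + 1) * m + l then
        (P.coeff i).coeff ((s + 1) * m + l - m * i) else 0) = 0 := by
      intro i hi
      split_ifs with h
      · refine coeff_eq_zero_of_natDegree_lt ((hP i).trans_le ?_)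
        have : m * (i + 1) ≤ m * s := Nat.mul_le_mul_left _ hi
        rw [mul_add] at this
        rw [mul_comm (s + 1) m, mul_add]
        omega
      · rfl
    rw [Finset.sum_eq_add (s + 1) s (by omega)]
    · rw [if_pos (by rw [mul_comm]; omega), if_pos (by rw [mul_comm]; nlinarith), if_neg (by omega)]
      congr 2
      · rw [mul_comm]; omega
      · rw [mul_comm m s, add_mul]; omega
    · intro i _ hi
      rcases lt_trichotomy i s with h | h | h
      · exact h2 i h
      · omega
      · rw [if_neg (h1 i (by omega))]
    · intro h
      simp at h
    · intro h
      simp at h; omega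

end Truncation

/-! ### Inverting the transform although the root of unity is not a principal one. -/

section Inversion

variable {V : Type*} [CommRing V] {M : ℕ}

/-- Multiplication by `t` permutes the residues modulo `r`. -/
theorem sum_rot_mul_coprime {r t : ℕ} (ht : Nat.Coprime r t) {y : ZMod M} (hy : r • y = 0) :
    ∑ x ∈ Finset.range r, rot V ((x * t) • y) = ∑ x ∈ Finset.range r, rot V (x • y) := by
  rcases Nat.eq_zero_or_pos r with rfl | hr
  · simp
  have himg : (Finset.range r).image (fun x => x * t % r) = Finset.range r := by
    apply Finset.eq_of_subset_of_card_le
    · intro x hx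
      obtain ⟨x, -, rfl⟩ := Finset.mem_image.1 hx
      exact Finset.mem_range.2 (Nat.mod_lt _ hr)
    · rw [Finset.card_image_of_injOn]
      intro x hx x' hx' h
      have : x ≡ x' [MOD r] := Nat.ModEq.cancel_right_of_coprime ht h
      simp only [Finset.coe_range, Set.mem_Iio] at hx hx'
      rwa [Nat.ModEq, Nat.mod_eq_of_lt hx, Nat.mod_eq_of_lt hx'] at this
  conv_rhs => rw [← himg]
  rw [Finset.sum_image]
  · refine Finset.sum_congr rfl fun x _ => ?_
    congr 1
    conv_lhs => rw [← Nat.mod_add_div (x * t) r]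
    rw [add_nsmul, mul_nsmul, hy]
    simp
  · have := Finset.card_image_iff.1 (himg.symm ▸ rfl :
      ((Finset.range r).image (fun x => x * t % r)).card = (Finset.range r).card)
    exact this

/-- The sum over a nontrivial character of `ℤ/r^K` is a multiple of the sum over the subgroup of
order `r`. -/
theorem sum_rot_dvd {r : ℕ} (hr : r.Prime) (K t : ℕ) (z : ZMod M) (hz : r ^ (K + 1) • z = 0)
    (ht : ¬ r ^ (K + 1) ∣ t) :
    ∑ x ∈ Finset.range r, rot V (x • r ^ K • z) ∣
      ∑ j ∈ Finset.range (r ^ (K + 1)), rot V ((j * t) • z) := by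
  induction K generalizing t z with
  | zero =>
    simp only [pow_zero, one_smul, zero_add, pow_one] at *
    rw [sum_rot_mul_coprime ((Nat.Prime.coprime_iff_not_dvd hr).2 ht) hz]
  | succ K ih =>
    rw [pow_succ' r (K + 1), sum_range_mul]
    by_cases hd : r ∣ t
    · obtain ⟨t, rfl⟩ := hd
      have hz' : r ^ (K + 1) • r • z = 0 := by rw [← mul_nsmul', ← pow_succ, hz]
      have h := ih t (r • z) hz' (fun h => ht (by rw [pow_succ']; exact mul_dvd_mul_left _ h))
      rw [← mul_nsmul', ← pow_succ] at h
      refine Finset.dvd_sum fun y _ => h.trans (dvd_of_eq (Finset.sum_congr rfl fun x _ => ?_))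
      congr 1
      rw [show (y * r ^ (K + 1) + x) * (r * t) = (y * t) * r ^ (K + 2) + (x * t) * r by ring,
        add_nsmul, mul_nsmul' _ (y * t), hz, smul_zero, zero_add]
      simp only [← mul_nsmul', mul_assoc]
    · rw [Finset.sum_comm]
      refine Finset.dvd_sum fun x _ => ?_
      rw [← sum_rot_mul_coprime ((Nat.Prime.coprime_iff_not_dvd hr).2 hd)
        (by rw [← mul_nsmul', ← pow_succ', hz])]
      refine Dvd.intro_left (rot V ((x * t) • z)) ?_
      rw [Finset.mul_sum]
      refine Finset.sum_congr rfl fun y _ => ?_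
      rw [← rot_add, ← mul_nsmul', ← add_nsmul]
      congr 2
      ring

/-- Inversion up to an error. The nontrivial character sums need not vanish in the group ring, but
all are multiples of the sum over `r ^ K • z`; the index `r ^ (K + 1) - s` stands for `-s`. -/
theorem dft_dft {r : ℕ} (hr : r.Prime) (K : ℕ) (z : ZMod M) (hz : r ^ (K + 1) • z = 0)
    (c : ℕ → AddMonoidAlgebra V (ZMod M)) {s : ℕ} (hs : s < r ^ (K + 1)) :
    ∃ q, dft (r ^ (K + 1)) z (fun j => dft (r ^ (K + 1)) z c j) (r ^ (K + 1) - s) =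
      (r : V) ^ (K + 1) • c s + (∑ x ∈ Finset.range r, rot V (x • r ^ K • z)) * q := by
  set n := r ^ (K + 1) with hn
  have h1 : dft n z (fun j => dft n z c j) (n - s) = ∑ i ∈ Finset.range n,
      (∑ j ∈ Finset.range n, rot V ((j * (n - s + i)) • z)) * c i := by
    simp only [dft, Finset.mul_sum, Finset.sum_mul]
    rw [Finset.sum_comm]
    refine Finset.sum_congr rfl fun i _ => Finset.sum_congr rfl fun j _ => ?_
    rw [← mul_assoc, ← rot_add, ← add_nsmul]
    congr 3
    ring
  rw [h1, ← Finset.add_sum_erase _ _ (Finset.mem_range.2 hs)]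
  have h2 : ∑ j ∈ Finset.range n, rot V ((j * (n - s + s)) • z) = algebraMap V _ ((r : V) ^ (K + 1)) := by
    rw [Nat.sub_add_cancel hs.le]
    simp only [mul_nsmul' z _ n, hz, smul_zero, rot_zero, Finset.sum_const, Finset.card_range]
    rw [nsmul_one, map_pow, map_natCast, hn, Nat.cast_pow]
  have h3 : ∑ x ∈ Finset.range r, rot V (x • r ^ K • z) ∣ ∑ i ∈ (Finset.range n).erase s,
      (∑ j ∈ Finset.range n, rot V ((j * (n - s + i)) • z)) * c i := by
    refine Finset.dvd_sum fun i hi => Dvd.dvd.mul_right (sum_rot_dvd hr K _ z hz ?_) _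
    rw [Finset.mem_erase, Finset.mem_range] at hi
    rintro ⟨w, hw⟩
    rw [← hn] at hw
    have : w = 1 := by
      rcases Nat.lt_trichotomy w 1 with h | h | h
      · interval_cases w; omega
      · exact h
      · have : n * 2 ≤ n * w := Nat.mul_le_mul_left _ h
        omega
    subst this
    omega
  obtain ⟨q, hq⟩ := h3
  exact ⟨q, by rw [h2, hq, ← Algebra.smul_def]⟩

/-- Multiplication by `rot V y` fixes the sum, so all its multiples have period `y`. This lets the
error in `dft_dft` be cancelled by a subtraction of two coefficients. -/
theorem coeff_sum_rot_mul {r : ℕ} {y : ZMod M} (hy : r • y = 0) (hr : 0 < r)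
    (q : AddMonoidAlgebra V (ZMod M)) (w : ZMod M) (i : ℕ) :
    ((∑ x ∈ Finset.range r, rot V (x • y)) * q).coeff (w + i • y) =
      ((∑ x ∈ Finset.range r, rot V (x • y)) * q).coeff w := by
  have h : rot V y * ∑ x ∈ Finset.range r, rot V (x • y) = ∑ x ∈ Finset.range r, rot V (x • y) := by
    obtain ⟨m, rfl⟩ := Nat.exists_eq_add_of_le' hr
    rw [Finset.mul_sum]
    simp only [← rot_add, ← succ_nsmul']
    rw [Finset.sum_range_succ, hy]
    conv_rhs => rw [Finset.sum_range_succ', zero_smul]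
  induction i with
  | zero => simp
  | succ i ih =>
    rw [← ih]
    conv_lhs => rw [← h, mul_assoc, coeff_rot_mul]
    congr 1
    rw [succ_nsmul]
    ring

/-- A polynomial in the class of `x` in the group ring of `ℤ/M`. -/
noncomputable def cyc (V : Type*) [CommRing V] (M : ℕ) : V[X] →ₐ[V] AddMonoidAlgebra V (ZMod M) :=
  aeval (rot V 1)

theorem coeff_cyc {K : ℕ} {f : V[X]} (hf : f.natDegree < K) (w : ZMod M) :
    (cyc V M f).coeff w = ∑ i ∈ Finset.range K, if (i : ZMod M) = w then f.coeff i else 0 := by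
  rw [cyc, aeval_eq_sum_range' hf]
  simp only [AddMonoidAlgebra.coeff_sum, Finsupp.finsetSum_apply, ← rot_nsmul,
    AddMonoidAlgebra.coeff_smul_apply]
  refine Finset.sum_congr rfl fun i _ => ?_
  classical
  rw [rot, AddMonoidAlgebra.coeff_single, Finsupp.single_apply]
  simp

theorem coeff_cyc_fold [NeZero M] {f : V[X]} (hf : f.natDegree < M + M) (w : ZMod M) :
    (cyc V M f).coeff w = f.coeff w.val + f.coeff (M + w.val) := by
  rw [coeff_cyc hf, Finset.sum_range_add]
  have h : ∀ g : ℕ → V, (∑ i ∈ Finset.range M, if (i : ZMod M) = w then g i else 0) = g w.val := by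
    intro g
    rw [Finset.sum_eq_single w.val]
    · simp
    · intro i hi hne
      rw [if_neg]
      rintro rfl
      exact hne (ZMod.val_cast_of_lt (Finset.mem_range.1 hi)).symm
    · intro h
      exact absurd (Finset.mem_range.2 (ZMod.val_lt w)) h
  rw [h]
  have := h fun i => f.coeff (M + i)
  simpa using this

theorem coeff_cyc_of_lt [NeZero M] {f : V[X]} (hf : f.natDegree < M) (w : ZMod M) :
    (cyc V M f).coeff w = f.coeff w.val := by
  rw [coeff_cyc_fold (by omega), coeff_eq_zero_of_natDegree_lt (n := M + w.val) (by omega), add_zero]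

/-- A transform is evaluation at powers of the root, and the product has degree below `n`, so
nothing wraps around. -/
theorem dft_mul_dft {m n : ℕ} (hmn : 2 * m ≤ n + 1) {P Q : V[X][X]} (hP : P.natDegree < m)
    (hQ : Q.natDegree < m) (z : ZMod M) (j : ℕ) :
    dft n z (fun i => cyc V M (P.coeff i)) j * dft n z (fun i => cyc V M (Q.coeff i)) j =
      dft n z (fun i => cyc V M ((P * Q).coeff i)) j := by
  have h : ∀ R : V[X][X], R.natDegree < n → dft n z (fun i => cyc V M (R.coeff i)) j =
      R.eval₂ (cyc V M).toRingHom (rot V (j • z)) := by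
    intro R hR
    rw [eval₂_eq_sum_range' _ hR, dft]
    refine Finset.sum_congr rfl fun i _ => ?_
    rw [← rot_nsmul, mul_nsmul', mul_comm]
    rfl
  have := natDegree_mul_lt hP hQ
  rw [h P (by omega), h Q (by omega), h _ (by omega), eval₂_mul]

end Inversion

/-! ### One recursion step of Schönhage's multiplication with radix `r`. -/

section Multiplication

/-- All coefficients of `f` (including zero) lie in `S`. -/
def Known {V : Type*} [CommRing V] (S : Set V) (f : V[X]) : Prop := ∀ i, f.coeff i ∈ S

theorem Known.mono {V : Type*} [CommRing V] {S S' : Set V} {f : V[X]} (h : Known S f)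
    (hS : S ⊆ S') : Known S' f := fun i => hS (h i)

theorem Known.zero_mem {V : Type*} [CommRing V] {S : Set V} {f : V[X]} (h : Known S f) : 0 ∈ S := by
  have := h (f.natDegree + 1)
  rwa [coeff_eq_zero_of_natDegree_lt (Nat.lt_succ_self _)] at this

theorem Known.polyOf {V : Type*} [CommRing V] {S : Set V} {N : ℕ} {c : ℕ → V} (h0 : 0 ∈ S)
    (h : ∀ i < N, c i ∈ S) : Known S (polyOf N c) := by
  intro i
  rw [coeff_polyOf]
  split_ifs with hi
  exacts [h i hi, h0]

/-- Over every commutative ring, `r ^ a` times the product of polynomials of degree less than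
`N` can be computed with `c` operations. -/
def MulCost (r N a c : ℕ) : Prop :=
  ∀ (V : Type u) [CommRing V] (S : Set V) (f g : V[X]), f.natDegree < N →
    g.natDegree < N → Known S f → Known S g →
    Comp (ringOps V) (Set.range fun i => (r : V) ^ a * (f * g).coeff i) c S

theorem MulCost.mono {r N N' a c c' : ℕ} (h : MulCost.{u} r N a c) (hN : N' ≤ N) (hc : c ≤ c') :
    MulCost.{u} r N' a c' := fun V _ S f g hf hg kf kg =>
  (h V S f g (hf.trans_le hN) (hg.trans_le hN) kf kg).mono subset_rfl hc subset_rfl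

theorem Comp.sum_mul {V : Type*} [CommRing V] {S : Set V} (n : ℕ) {v w : ℕ → V}
    (hv : ∀ i ≤ n, v i ∈ S) (hw : ∀ i ≤ n, w i ∈ S) :
    Comp (ringOps V) {∑ i ∈ Finset.range (n + 1), v i * w i} (2 * n + 1) S := by
  have h := Comp.forall_mem (T := {x | ∃ i ≤ n, x = v i * w i}) (S := S) (c := 1)
    (ops := ringOps V) (Finset.range (n + 1)) (v := fun i => v i * w i)
    (fun i hi => .mul subset_rfl (hv i (by simp at hi; omega)) (hw i (by simp at hi; omega)))
    (by rintro _ ⟨i, hi, rfl⟩; exact ⟨i, by simp; omega, rfl⟩)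
  refine (h.bind fun S' _ hT => Comp.sum_succ subset_rfl n fun i hi => hT ⟨i, hi, rfl⟩).mono
    subset_rfl ?_ subset_rfl
  simp
  omega

theorem mulCost_schoolbook (r N : ℕ) : MulCost.{u} r N 0 (8 * N ^ 2) := by
  intro V _ S f g hf hg kf kg
  have h := Comp.forall_mem (T := Set.range fun i => (r : V) ^ 0 * (f * g).coeff i) (S := S)
    (c := 4 * N) (ops := ringOps V) (Finset.range (2 * N)) (v := fun i => (f * g).coeff i) ?_ ?_
  · refine h.mono subset_rfl ?_ subset_rfl
    rw [Finset.card_range]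
    exact le_of_eq (by ring)
  · intro i hi
    rw [coeff_mul, Finset.Nat.sum_antidiagonal_eq_sum_range_succ (fun i j => f.coeff i * g.coeff j)]
    refine (Comp.sum_mul i (fun j _ => kf j) fun j _ => kg _).mono subset_rfl ?_ subset_rfl
    simp at hi; omega
  · rintro _ ⟨i, rfl⟩
    by_cases hi : i < 2 * N
    · exact ⟨i, by simpa, by simp⟩
    · have := natDegree_mul_lt hf hg
      refine ⟨2 * N - 1, by simp; omega, ?_⟩
      simp only [pow_zero, one_mul]
      rw [coeff_eq_zero_of_natDegree_lt (by omega), coeff_eq_zero_of_natDegree_lt (by omega)]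

/-- Multiplication in the group ring of `ℤ/M`. -/
theorem MulCost.cyclic {r M a c : ℕ} (h : MulCost.{u} r M a c) [NeZero M] {V : Type u}
    [CommRing V] {S : Set V} {x y : AddMonoidAlgebra V (ZMod M)} (hx : ∀ w, x.coeff w ∈ S)
    (hy : ∀ w, y.coeff w ∈ S) (h0 : 0 ∈ S) :
    Comp (ringOps V) (Set.range fun w => ((r : V) ^ a • (x * y)).coeff w) (c + M) S := by
  have hM := NeZero.pos M
  have hlift : ∀ x : AddMonoidAlgebra V (ZMod M), cyc V M (polyOf M fun i => x.coeff i) = x := by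
    intro x
    ext w
    rw [coeff_cyc_of_lt (natDegree_polyOf_lt hM _), coeff_polyOf, if_pos (ZMod.val_lt w),
      ZMod.natCast_zmod_val]
  have hdx := natDegree_polyOf_lt hM fun i => x.coeff i
  have hdy := natDegree_polyOf_lt hM fun i => y.coeff i
  refine (h V S _ _ hdx hdy (.polyOf h0 fun i _ => hx _) (.polyOf h0 fun i _ => hy _)).bind
    fun S' _ hT => ?_
  have h1 := Comp.forall_mem (T := Set.range fun w => ((r : V) ^ a • (x * y)).coeff w) (S := S')
    (c := 1) (ops := ringOps V) (Finset.univ : Finset (ZMod M))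
    (v := fun w => ((r : V) ^ a • (x * y)).coeff w) (fun w _ => ?_)
    (by rintro _ ⟨w, rfl⟩; exact ⟨w, by simp, rfl⟩)
  · simpa [ZMod.card] using h1
  · rw [← hlift x, ← hlift y, ← map_mul, AddMonoidAlgebra.coeff_smul_apply,
      coeff_cyc_fold (by have := natDegree_mul_lt hdx hdy; omega), smul_eq_mul, mul_add]
    exact .add subset_rfl (hT ⟨_, rfl⟩) (hT ⟨_, rfl⟩)

theorem dft_smul {V : Type*} [CommRing V] {M : ℕ} (n : ℕ) (z : ZMod M) (t : V)
    (b : ℕ → AddMonoidAlgebra V (ZMod M)) (j : ℕ) :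
    dft n z (fun j => t • b j) j = t • dft n z b j := by
  simp only [dft, Finset.smul_sum, mul_smul_comm]

/-- Polynomials of length `m²`, `m = r ^ k`, become `m` blocks of length `m`, viewed in the group
ring of `ℤ/M` with `M = r ^ (k + 2)`. There the class of `X ^ r` has order `n = r ^ (k + 1)`. Three
transforms and `n` recursive products suffice; the inverse transform contributes the factor `r ^ (k
+ 1)`. -/
theorem MulCost.step {r k a c : ℕ} (hr : r.Prime) (h : MulCost.{u} r (r ^ (k + 2)) a c) :
    MulCost.{u} r (r ^ (2 * k)) (a + (k + 1))
      (r ^ (k + 1) * c + (3 * (k + 1) * r + 3) * r ^ (2 * k + 3)) := by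
  intro V _ S f g hf hg kf kg
  have hr2 := hr.two_le
  have hr0 := hr.pos
  set m := r ^ k with hm
  set n := r ^ (k + 1) with hn
  set M := r ^ (k + 2) with hM
  have hm0 : 0 < m := pow_pos hr0 k
  have hnm : n = m * r := pow_succ _ _
  have hMn : M = n * r := pow_succ _ _
  have hmn : 2 * m ≤ n := by rw [hnm]; nlinarith
  have hMn' : 2 * n ≤ M := by rw [hMn]; nlinarith
  have : NeZero M := ⟨by omega⟩
  have hmm : r ^ (2 * k) = m * m := by rw [two_mul, pow_add]
  rw [hmm] at hf hg
  obtain ⟨P, hP1, hP2, hP3, hP4⟩ := exists_blocks hm0 hf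
  obtain ⟨Q, hQ1, hQ2, hQ3, hQ4⟩ := exists_blocks hm0 hg
  set z : ZMod M := (r : ZMod M) with hz
  have hnz : n • z = 0 := by
    rw [hz, nsmul_eq_mul, ← Nat.cast_mul, ← hMn, ZMod.natCast_self]
  have kP : ∀ i, ∀ w, (cyc V M (P.coeff i)).coeff w ∈ S := by
    intro i w
    rw [coeff_cyc_of_lt ((hP2 i).trans (by omega))]
    obtain ⟨q, hq⟩ := hP3 i w.val
    rw [hq]; exact kf q
  have kQ : ∀ i, ∀ w, (cyc V M (Q.coeff i)).coeff w ∈ S := by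
    intro i w
    rw [coeff_cyc_of_lt ((hQ2 i).trans (by omega))]
    obtain ⟨q, hq⟩ := hQ3 i w.val
    rw [hq]; exact kg q
  have hd : ∀ i, ((P * Q).coeff i).natDegree < 2 * m := by
    intro i
    rw [coeff_mul]
    refine lt_of_le_of_lt (natDegree_sum_le_of_forall_le (n := 2 * m - 1) _ _ fun x _ => ?_)
      (by omega)
    have := natDegree_mul_lt (hP2 x.1) (hQ2 x.2)
    omega
  have h1 := (Comp.fft hr0 (k + 1) z hnz _ fun i _ => kP i).union
    (Comp.fft hr0 (k + 1) z hnz _ fun i _ => kQ i)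
  rw [← hn] at h1
  -- the pointwise products
  refine (h1.bind (c' := n * (c + M) + ((k + 1) * n * (r * M) + (n * (2 * m) + n * m)))
    fun S₁ hS₁ hT₁ => ?_).mono subset_rfl ?_ subset_rfl
  swap
  · have e : r ^ (2 * k + 3) = n * M := by rw [hn, hM, ← pow_add]; congr 1; omega
    rw [e]
    have : n * (2 * m) + n * m ≤ 2 * (n * M) := by nlinarith
    nlinarith
  have h2 := Comp.biUnion (ops := ringOps V) (S := S₁) (c := c + M) (Finset.range n)
    (T := fun j => Set.range fun w => ((r : V) ^ a •
      (dft n z (fun i => cyc V M (P.coeff i)) j * dft n z (fun i => cyc V M (Q.coeff i)) j)).coeff w)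
    (fun j _ => h.cyclic (fun w => hT₁ (.inl ⟨j, w, rfl⟩)) (fun w => hT₁ (.inr ⟨j, w, rfl⟩))
      (hS₁ kf.zero_mem))
  rw [Finset.card_range] at h2
  simp only [dft_mul_dft (show 2 * m ≤ n + 1 by omega) hP1 hQ1] at h2
  refine h2.bind fun S₂ hS₂ hT₂ => ?_
  refine (Comp.fft hr0 (k + 1) z hnz
    (fun j => (r : V) ^ a • dft n z (fun i => cyc V M ((P * Q).coeff i)) j) fun j hj w => ?_).bind
    fun S₃ hS₃ hT₃ => ?_
  · refine hT₂ ?_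
    simp only [Set.mem_iUnion]
    exact ⟨j, Finset.mem_range.2 hj, w, rfl⟩
  rw [← hn] at hT₃
  set y : ZMod M := r ^ k • z with hy
  have hry : r • y = 0 := by rw [hy, ← mul_nsmul', ← pow_succ', ← hn, hnz]
  have hyn : ∀ i : ℕ, i • y = ((n * i : ℕ) : ZMod M) := by
    intro i
    rw [hy, hz, nsmul_eq_mul, nsmul_eq_mul, hnm, hm]; push_cast; ring
  have h3 := Comp.forall_mem (ops := ringOps V) (S := S₃) (c := 1)
    (T := {v | ∃ s l, s < n ∧ l < 2 * m ∧ v = (r : V) ^ (a + (k + 1)) * ((P * Q).coeff s).coeff l})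
    (Finset.range n ×ˢ Finset.range (2 * m))
    (v := fun x => (r : V) ^ (a + (k + 1)) * ((P * Q).coeff x.1).coeff x.2) ?_ ?_
  rotate_left
  · rintro ⟨s, l⟩ hsl
    simp only [Finset.mem_product, Finset.mem_range] at hsl
    obtain ⟨hs, hl⟩ := hsl
    obtain ⟨q, hq⟩ := dft_dft hr k z hnz (fun i => cyc V M ((P * Q).coeff i)) hs
    rw [← hn] at hq
    have hsm : dft n z (fun j => (r : V) ^ a • dft n z (fun i => cyc V M ((P * Q).coeff i)) j)
        (n - s) = (r : V) ^ a • ((r : V) ^ (k + 1) • cyc V M ((P * Q).coeff s) +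
          (∑ x ∈ Finset.range r, rot V (x • y)) * q) := by
      rw [hy, ← hq, dft_smul]
    have hc : ∀ w : ZMod M, (dft n z (fun j => (r : V) ^ a •
        dft n z (fun i => cyc V M ((P * Q).coeff i)) j) (n - s)).coeff w =
          (r : V) ^ (a + (k + 1)) * ((P * Q).coeff s).coeff w.val +
            (r : V) ^ a * ((∑ x ∈ Finset.range r, rot V (x • y)) * q).coeff w := by
      intro w
      rw [hsm, AddMonoidAlgebra.coeff_smul_apply, AddMonoidAlgebra.coeff_add, Finsupp.add_apply,
        AddMonoidAlgebra.coeff_smul_apply, coeff_cyc_of_lt ((hd s).trans_le (by omega)), smul_eq_mul,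
        smul_eq_mul, pow_add]
      ring
    have hl1 : ((l % n : ℕ) : ZMod M) + (l / n) • y = (l : ZMod M) := by
      rw [hyn, ← Nat.cast_add, Nat.mod_add_div]
    have hl2 : ((l % n : ℕ) : ZMod M) + (r - 1) • y = ((l % n + n * (r - 1) : ℕ) : ZMod M) := by
      rw [hyn, ← Nat.cast_add]
    have hv1 : ((l : ℕ) : ZMod M).val = l := ZMod.val_cast_of_lt (by omega)
    have hln : l % n < n := Nat.mod_lt _ (by omega)
    have hr1 : n * (r - 1) + n = M := by
      rw [hMn]
      obtain ⟨r', hr'⟩ := Nat.exists_eq_add_of_le' hr0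
      rw [hr', Nat.add_sub_cancel]; ring
    have hv2 : (((l % n + n * (r - 1) : ℕ) : ZMod M)).val = l % n + n * (r - 1) :=
      ZMod.val_cast_of_lt (by omega)
    -- The error has period `n`. In the last of the `r` blocks of length `n` the true block product
    -- has no coefficients, because its degree is below `2 * m ≤ n`; there the error is seen alone.
    have h4 : (r : V) ^ (a + (k + 1)) * ((P * Q).coeff s).coeff l = (dft n z (fun j => (r : V) ^ a •
        dft n z (fun i => cyc V M ((P * Q).coeff i)) j) (n - s)).coeff (l : ZMod M) -
        (dft n z (fun j => (r : V) ^ a • dft n z (fun i => cyc V M ((P * Q).coeff i)) j)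
          (n - s)).coeff ((l % n + n * (r - 1) : ℕ) : ZMod M) := by
      rw [hc, hc, hv1, hv2, ← hl1, ← hl2, coeff_sum_rot_mul hry hr0, coeff_sum_rot_mul hry hr0,
        coeff_eq_zero_of_natDegree_lt (n := l % n + n * (r - 1)) ((hd s).trans_le ?_)]
      · ring
      · omega
    simp only
    rw [h4]
    exact .sub subset_rfl (hT₃ ⟨_, _, rfl⟩) (hT₃ ⟨_, _, rfl⟩)
  · rintro _ ⟨s, l, hs, hl, rfl⟩
    exact ⟨(s, l), by simp [hs, hl], rfl⟩
  rw [Finset.card_product, Finset.card_range, Finset.card_range, mul_one] at h3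
  refine h3.bind fun S₄ hS₄ hT₄ => ?_
  have h0 : (0 : V) ∈ S₄ := hS₄ (hS₃ (hS₂ (hS₁ kf.zero_mem)))
  have h5 := Comp.forall_mem (ops := ringOps V) (S := S₄) (c := 1)
    (T := Set.range fun i => (r : V) ^ (a + (k + 1)) * (f * g).coeff i)
    (Finset.range n ×ˢ Finset.range m)
    (v := fun x => (r : V) ^ (a + (k + 1)) * (f * g).coeff (x.1 * m + x.2)) ?_ ?_
  · simpa using h5
  · rintro ⟨s, l⟩ hsl
    simp only [Finset.mem_product, Finset.mem_range] at hsl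
    obtain ⟨hs, hl⟩ := hsl
    simp only
    rw [← hP4, ← hQ4, ← eval_mul, coeff_eval_X_pow hd s l hl, mul_add, mul_ite, mul_zero]
    refine .add subset_rfl (hT₄ ⟨s, l, hs, by omega, rfl⟩) ?_
    split_ifs
    · exact h0
    · exact hT₄ ⟨s - 1, l + m, by omega, by omega, rfl⟩
  · rintro _ ⟨i, rfl⟩
    by_cases hi : i / m < n
    · refine ⟨(i / m, i % m), by simp [hi, Nat.mod_lt _ hm0], ?_⟩
      simp only [Nat.div_add_mod']
    · have h6 := natDegree_mul_lt hf hg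
      have h7 : n * m ≤ i := (Nat.le_div_iff_mul_le hm0).1 (not_lt.1 hi)
      have h8 : 2 * m * m ≤ n * m := Nat.mul_le_mul_right _ hmn
      have h9 : 0 < m * m := Nat.mul_pos hm0 hm0
      refine ⟨(n - 1, m - 1), by simp; omega, ?_⟩
      have h10 : n * m = (n - 1) * m + m := by
        obtain ⟨n', hn'⟩ := Nat.exists_eq_add_of_le' (show 1 ≤ n by omega)
        rw [hn', Nat.add_sub_cancel]; ring
      simp only
      rw [mul_assoc] at h8
      rw [coeff_eq_zero_of_natDegree_lt (by omega), coeff_eq_zero_of_natDegree_lt (by omega)]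

end Multiplication

/-! ### Softly linear multiplication over every commutative ring. -/

section FastMultiplication

/-- `MulCost.step` with `k = i + 3` passes from exponent `i + 5` to `2 * i + 6`, so `j - 5` at least
doubles when `j` is `2 * i + 5` or `2 * i + 6`. The cost per unit of length grows by at most `r ^ 4
≤ 81`, apart from the transforms; as `81 < 2 ^ 7`, the seventh power leaves room for these. The
constant covers the schoolbook cost `8 * 3 ^ 6 = 5832` per unit of length at `j = 6`. -/
theorem exists_mulCost_pow {r : ℕ} (hr : r.Prime) (hr3 : r ≤ 3) (j : ℕ) (hj : 6 ≤ j) :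
    ∃ a ≤ 5 * j, MulCost.{u} r (r ^ j) a (6000 * r ^ j * (j - 5) ^ 7) := by
  have hr2 := hr.two_le
  induction j using Nat.strong_induction_on with
  | _ j ih =>
    rcases hj.eq_or_lt with rfl | hj
    · refine ⟨0, by omega, (mulCost_schoolbook r (r ^ 6)).mono le_rfl ?_⟩
      interval_cases r <;> norm_num
    · obtain ⟨i, hi, hi1⟩ : ∃ i, 1 ≤ i ∧ (j = 2 * i + 5 ∨ j = 2 * i + 6) :=
        ⟨(j - 5) / 2, by omega, by omega⟩
      obtain ⟨a, ha, h⟩ := ih (i + 5) (by omega) (by omega)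
      refine ⟨a + (i + 3 + 1), by omega, (MulCost.step hr h).mono ?_ ?_⟩
      · exact Nat.pow_le_pow_right (by omega) (by omega)
      · have e1 : r ^ (i + 3 + 1) * (6000 * r ^ (i + 5) * (i + 5 - 5) ^ 7) =
            r ^ (2 * i + 9) * (6000 * i ^ 7) := by
          rw [Nat.add_sub_cancel]; ring
        have e2 : 2 * (i + 3) + 3 = 2 * i + 9 := by ring
        rw [e1, e2]
        have h1 : r ^ (2 * i + 9) ≤ 81 * r ^ j := by
          have : r ^ 4 ≤ 81 := by interval_cases r <;> norm_num
          calc r ^ (2 * i + 9) ≤ r ^ (4 + j) := Nat.pow_le_pow_right (by omega) (by omega)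
            _ = r ^ 4 * r ^ j := pow_add _ _ _
            _ ≤ 81 * r ^ j := Nat.mul_le_mul_right _ this
        have h2 : 128 * i ^ 7 ≤ (j - 5) ^ 7 := by
          calc 128 * i ^ 7 = (2 * i) ^ 7 := by ring
            _ ≤ (j - 5) ^ 7 := Nat.pow_le_pow_left (by omega) _
        have h3 : 3 * (i + 3 + 1) * r + 3 ≤ 48 * i ^ 7 := by
          have h4 : i ≤ i ^ 7 := Nat.le_self_pow (by norm_num) _
          have h5 : 3 * (i + 3 + 1) * r ≤ 3 * (i + 3 + 1) * 3 := Nat.mul_le_mul_left _ hr3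
          omega
        calc r ^ (2 * i + 9) * (6000 * i ^ 7) + (3 * (i + 3 + 1) * r + 3) * r ^ (2 * i + 9)
            ≤ (81 * r ^ j) * (6000 * i ^ 7) + (48 * i ^ 7) * (81 * r ^ j) := by gcongr
          _ ≤ 6000 * r ^ j * (128 * i ^ 7) := by
            have : 0 ≤ r ^ j * i ^ 7 := Nat.zero_le _
            nlinarith
          _ ≤ _ := Nat.mul_le_mul_left _ h2

/-- Division by `2` or `3` may be impossible in the ring, but `2 ^ a * u - 3 ^ b * v = 1` recovers
the product from its two multiples. The multipliers `u`, `v` are built by doubling, at a cost linear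
in `a + b`. -/
theorem MulCost.combine {N a b c c' : ℕ} (h2 : MulCost.{u} 2 N a c) (h3 : MulCost.{u} 3 N b c') :
    MulCost.{u} 1 N 0 (c + (c' + (8 * (a + b) + 4 + 6 * N))) := by
  intro V _ S f g hf hg kf kg
  refine (h2 V S f g hf hg kf kg).bind fun S₁ hS₁ hT₁ => ?_
  refine (h3 V S₁ f g hf hg (kf.mono hS₁) (kg.mono hS₁)).bind fun S₂ hS₂ hT₂ => ?_
  obtain ⟨u, v, hu, hv, huv⟩ : ∃ u v : ℕ, u ≤ 3 ^ b ∧ v ≤ 2 ^ a ∧ 2 ^ a * u = 3 ^ b * v + 1 := by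
    rcases Nat.eq_zero_or_pos b with rfl | hb
    · exact ⟨1, 2 ^ a - 1, by simp, Nat.sub_le _ _, by
        rw [pow_zero, one_mul, mul_one, Nat.sub_add_cancel Nat.one_le_two_pow]⟩
    · have hb1 : 1 < 3 ^ b := Nat.one_lt_pow (by omega) (by norm_num)
      obtain ⟨u, hu⟩ := Nat.exists_mul_mod_eq_one_of_coprime
        (show Nat.Coprime (2 ^ a) (3 ^ b) from Nat.Coprime.pow _ _ (by norm_num)) hb1
      have hlt : u % 3 ^ b < 3 ^ b := Nat.mod_lt _ (by omega)
      have h := Nat.div_add_mod (2 ^ a * (u % 3 ^ b)) (3 ^ b)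
      rw [Nat.mul_mod_mod, hu.2] at h
      refine ⟨u % 3 ^ b, 2 ^ a * (u % 3 ^ b) / 3 ^ b, hlt.le, ?_, h.symm⟩
      exact Nat.div_le_of_le_mul (by rw [mul_comm]; exact Nat.mul_le_mul_right _ hlt.le)
  have hlog3 : ∀ b, Nat.log 2 (3 ^ b) ≤ 2 * b := by
    intro b
    calc Nat.log 2 (3 ^ b) ≤ Nat.log 2 (4 ^ b) := Nat.log_mono_right (Nat.pow_le_pow_left (by norm_num) _)
      _ = Nat.log 2 (2 ^ (2 * b)) := by rw [pow_mul]; norm_num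
      _ = 2 * b := Nat.log_pow one_lt_two _
  have hlu : Nat.log 2 u ≤ 2 * b := (Nat.log_mono_right hu).trans (hlog3 b)
  have hlv : Nat.log 2 v ≤ a := (Nat.log_mono_right hv).trans (Nat.log_pow one_lt_two _).le
  have h0 := (kf.mono (hS₁.trans hS₂)).zero_mem
  refine (((Comp.natCast subset_rfl h0 u).union (Comp.natCast subset_rfl h0 v)).bind
    (c' := 6 * N) fun S₃ hS₃ hT₃ => ?_).mono subset_rfl (by omega) subset_rfl
  have h4 := Comp.forall_mem (ops := ringOps V) (S := S₃) (c := 3)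
    (T := Set.range fun i => ((1 : ℕ) : V) ^ 0 * (f * g).coeff i) (Finset.range (2 * N))
    (v := fun i => (f * g).coeff i) (fun i _ => ?_) ?_
  · refine h4.mono subset_rfl ?_ subset_rfl
    rw [Finset.card_range]; omega
  · have e : (f * g).coeff i = u * ((2 : ℕ) ^ a * (f * g).coeff i) -
        v * ((3 : ℕ) ^ b * (f * g).coeff i) := by
      have := congrArg (Nat.cast : ℕ → V) huv
      push_cast at this ⊢
      linear_combination -(f * g).coeff i * this
    rw [e]
    refine ((Comp.mul subset_rfl (hT₃ (.inl rfl)) (hS₃ (hS₂ (hT₁ ⟨i, rfl⟩)))).union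
      (Comp.mul subset_rfl (hT₃ (.inr rfl)) (hS₃ (hT₂ ⟨i, rfl⟩)))).bind (c' := 1)
        fun S₄ hS₄ hT₄ => ?_
    exact .sub subset_rfl (hT₄ (.inl rfl)) (hT₄ (.inr rfl))
  · rintro _ ⟨i, rfl⟩
    by_cases hi : i < 2 * N
    · exact ⟨i, by simpa, by simp⟩
    · have := natDegree_mul_lt hf hg
      refine ⟨2 * N - 1, by simp; omega, ?_⟩
      dsimp only
      rw [coeff_eq_zero_of_natDegree_lt (by omega), coeff_eq_zero_of_natDegree_lt (by omega),
        mul_zero]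

theorem pow_clog_le {b N : ℕ} (hb : 1 < b) (hN : 1 ≤ N) : b ^ Nat.clog b N ≤ b * N := by
  rcases hN.eq_or_lt with rfl | hN
  · simp; omega
  · have h := Nat.pow_pred_clog_lt_self hb hN
    have hpos := Nat.clog_pos hb hN
    obtain ⟨k, hk⟩ := Nat.exists_eq_add_of_le' hpos
    rw [hk] at h ⊢
    rw [pow_succ']
    exact Nat.mul_le_mul_left _ h.le

theorem clog_le_log_add_one (N : ℕ) : Nat.clog 2 N ≤ Nat.log 2 N + 1 :=
  Nat.clog_le_of_le_pow (Nat.lt_pow_succ_log_self one_lt_two N).le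

/-- A softly linear bound. -/
def soft (C κ n : ℕ) : ℕ := C * n * (Nat.log 2 n + 1) ^ κ

/-- Polynomials over any commutative ring can be multiplied in softly linear time. -/
theorem exists_mulCost : ∃ C, ∀ N, 1 ≤ N → MulCost.{u} 1 N 0 (soft C 7 N) := by
  refine ⟨6000 * 64 * 2 * 128 + 6000 * 729 * 3 * 128 + 1000, fun N hN => ?_⟩
  set l := Nat.log 2 N with hl
  have hc2 : Nat.clog 2 N ≤ l + 1 := clog_le_log_add_one N
  have hc3 : Nat.clog 3 N ≤ l + 1 := (Nat.clog_anti_left (by norm_num) (by norm_num)).trans hc2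
  obtain ⟨a, ha, h2⟩ := exists_mulCost_pow.{u} Nat.prime_two (by norm_num) (Nat.clog 2 N + 6) (by omega)
  obtain ⟨b, hb, h3⟩ := exists_mulCost_pow.{u} Nat.prime_three le_rfl (Nat.clog 3 N + 6) (by omega)
  have h2' := h2.mono (N' := N) (c' := 6000 * 64 * 2 * 128 * (N * (l + 1) ^ 7)) ?_ ?_
  have h3' := h3.mono (N' := N) (c' := 6000 * 729 * 3 * 128 * (N * (l + 1) ^ 7)) ?_ ?_
  · refine (h2'.combine h3').mono le_rfl ?_
    have h4 : l + 1 ≤ (l + 1) ^ 7 := Nat.le_self_pow (by norm_num) _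
    have h5 : (l + 1) ^ 7 ≤ N * (l + 1) ^ 7 := Nat.le_mul_of_pos_left _ hN
    have h6 : N ≤ N * (l + 1) ^ 7 := Nat.le_mul_of_pos_right _ (by positivity)
    have h7 : soft (6000 * 64 * 2 * 128 + 6000 * 729 * 3 * 128 + 1000) 7 N =
        (6000 * 64 * 2 * 128 + 6000 * 729 * 3 * 128 + 1000) * (N * (l + 1) ^ 7) := mul_assoc _ _ _
    rw [h7]
    generalize N * (l + 1) ^ 7 = Q at *
    omega
  · exact (Nat.le_pow_clog (by norm_num) N).trans (Nat.pow_le_pow_right (by norm_num) (by omega))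
  · calc 6000 * 3 ^ (Nat.clog 3 N + 6) * (Nat.clog 3 N + 6 - 5) ^ 7
        ≤ 6000 * (3 * N * 3 ^ 6) * (2 * (l + 1)) ^ 7 := by
          rw [pow_add]
          gcongr
          · exact pow_clog_le (by norm_num) hN
          · omega
      _ = _ := by ring
  · exact (Nat.le_pow_clog (by norm_num) N).trans (Nat.pow_le_pow_right (by norm_num) (by omega))
  · calc 6000 * 2 ^ (Nat.clog 2 N + 6) * (Nat.clog 2 N + 6 - 5) ^ 7
        ≤ 6000 * (2 * N * 2 ^ 6) * (2 * (l + 1)) ^ 7 := by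
          rw [pow_add]
          gcongr
          · exact pow_clog_le (by norm_num) hN
          · omega
      _ = _ := by ring

end FastMultiplication

/-! ### Computations with zero tests, for all instances at once. -/

section Branching

variable {E : Type*} {k : E → Type*} [∀ e, Zero (k e)]

/-- Values that depend on the instance `e`; with at most `c` operations from `ops` and zero tests
one decides `P` for all `e ∈ D` from the values in `S`. -/
inductive Decides (ops : Set ((∀ e, k e) → (∀ e, k e) → ∀ e, k e)) (P : E → Prop) :
    ℕ → Set E → Set (∀ e, k e) → Prop
  | yes {c : ℕ} {D : Set E} {S : Set (∀ e, k e)} (h : ∀ e ∈ D, P e) : Decides ops P c D S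
  | no {c : ℕ} {D : Set E} {S : Set (∀ e, k e)} (h : ∀ e ∈ D, ¬ P e) : Decides ops P c D S
  | step {c : ℕ} {D : Set E} {S : Set (∀ e, k e)} {o : (∀ e, k e) → (∀ e, k e) → ∀ e, k e}
      {x y : ∀ e, k e} (ho : o ∈ ops) (hx : x ∈ S) (hy : y ∈ S)
      (h : Decides ops P c D (insert (o x y) S)) : Decides ops P (c + 1) D S
  | test {c : ℕ} {D : Set E} {S : Set (∀ e, k e)} {x : ∀ e, k e} (hx : x ∈ S)
      (h₀ : Decides ops P c (D ∩ {e | x e = 0}) S)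
      (h₁ : Decides ops P c (D ∩ {e | x e ≠ 0}) S) : Decides ops P (c + 1) D S

variable {ops : Set ((∀ e, k e) → (∀ e, k e) → ∀ e, k e)} {P : E → Prop} {c c' : ℕ} {D : Set E}
  {S : Set (∀ e, k e)}

theorem Decides.mono (h : Decides ops P c D S) (hc : c ≤ c') : Decides ops P c' D S := by
  induction h generalizing c' with
  | yes h => exact .yes h
  | no h => exact .no h
  | step ho hx hy _ ih =>
    obtain ⟨c', rfl⟩ := Nat.exists_eq_add_of_le' (Nat.one_le_of_lt hc)
    exact .step ho hx hy (ih (by omega))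
  | test hx _ _ ih₀ ih₁ =>
    obtain ⟨c', rfl⟩ := Nat.exists_eq_add_of_le' (Nat.one_le_of_lt hc)
    exact .test hx (ih₀ (by omega)) (ih₁ (by omega))

/-- A straight line computation followed by a decision. -/
theorem Comp.decides {T : Set (∀ e, k e)} (h : Comp ops T c S)
    (h' : ∀ S', S ⊆ S' → T ⊆ S' → Decides ops P c' D S') : Decides ops P (c + c') D S := by
  induction h with
  | done h => exact (h' _ subset_rfl h).mono (Nat.le_add_left _ _)
  | step ho hx hy _ ih =>
    rw [Nat.add_right_comm]
    exact .step ho hx hy (ih fun S' hS hT => h' S' ((Set.subset_insert _ _).trans hS) hT)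

end Branching

/-! ### Arithmetic of the first two digits. -/

section Digits

variable {A : Type u} [CommRing A] {p : A} {s : Residue p → A}

theorem residue_add (a b : A) : residue p (a + b) = residue p a + residue p b := rfl

theorem residue_sub (a b : A) : residue p (a - b) = residue p a - residue p b := rfl

theorem residue_mul (a b : A) : residue p (a * b) = residue p a * residue p b := rfl

theorem residue_neg (a : A) : residue p (-a) = -residue p a := rfl

theorem residue_zero : residue p 0 = 0 := rfl

theorem residue_one : residue p 1 = 1 := rfl

theorem exists_eq_add_mul (hs : IsRepresentatives p s) (a : A) :
    ∃ e, a = s (residue p a) + p * e := by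
  have h : residue p (a - s (residue p a)) = 0 := by
    rw [residue_sub, hs, sub_self]
  rw [Ideal.Quotient.eq_zero_iff_mem, Ideal.mem_span_singleton] at h
  obtain ⟨e, he⟩ := h
  exact ⟨e, by linear_combination he⟩

@[simp] theorem residue_self (p : A) : residue p p = 0 := by
  rw [Ideal.Quotient.eq_zero_iff_mem]
  exact Ideal.mem_span_singleton_self p

variable [IsDomain A]

theorem secondDigit_eq (hp : p ≠ 0) {a e : A} (h : a = s (residue p a) + p * e) :
    secondDigit p s a = residue p e := by
  have hex : ∃ e, a = s (residue p a) + p * e := ⟨e, h⟩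
  rw [secondDigit, dif_pos hex]
  congr 1
  exact mul_left_cancel₀ hp (by linear_combination h - hex.choose_spec)

theorem secondDigit_add (hp : p ≠ 0) (hs : IsRepresentatives p s) (a b : A) :
    secondDigit p s (a + b) = secondDigit p s a + secondDigit p s b +
      secondDigit p s (s (residue p a) + s (residue p b)) := by
  obtain ⟨e, he⟩ := exists_eq_add_mul hs a
  obtain ⟨e', he'⟩ := exists_eq_add_mul hs b
  obtain ⟨c, hc⟩ := exists_eq_add_mul hs (s (residue p a) + s (residue p b))
  rw [secondDigit_eq hp he, secondDigit_eq hp he', secondDigit_eq hp hc, ← residue_add, ← residue_add]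
  refine secondDigit_eq hp ?_
  rw [residue_add, hs, hs] at hc
  rw [residue_add]
  linear_combination he + he' + hc

theorem secondDigit_sub (hp : p ≠ 0) (hs : IsRepresentatives p s) (a b : A) :
    secondDigit p s (a - b) = secondDigit p s a - secondDigit p s b +
      secondDigit p s (s (residue p a) - s (residue p b)) := by
  obtain ⟨e, he⟩ := exists_eq_add_mul hs a
  obtain ⟨e', he'⟩ := exists_eq_add_mul hs b
  obtain ⟨c, hc⟩ := exists_eq_add_mul hs (s (residue p a) - s (residue p b))
  rw [secondDigit_eq hp he, secondDigit_eq hp he', secondDigit_eq hp hc, ← residue_sub, ← residue_add]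
  refine secondDigit_eq hp ?_
  rw [residue_sub, hs, hs] at hc
  rw [residue_sub]
  linear_combination he - he' + hc

theorem secondDigit_mul (hp : p ≠ 0) (hs : IsRepresentatives p s) (a b : A) :
    secondDigit p s (a * b) = secondDigit p s (s (residue p a) * s (residue p b)) +
      residue p a * secondDigit p s b + secondDigit p s a * residue p b := by
  obtain ⟨e, he⟩ := exists_eq_add_mul hs a
  obtain ⟨e', he'⟩ := exists_eq_add_mul hs b
  obtain ⟨c, hc⟩ := exists_eq_add_mul hs (s (residue p a) * s (residue p b))
  have h1 : residue p a * residue p e' + residue p e * residue p b =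
      residue p (s (residue p a) * e' + e * s (residue p b) + p * (e * e')) := by
    simp only [residue_add, residue_mul, hs _, residue_self, zero_mul, add_zero]
  rw [secondDigit_eq hp he, secondDigit_eq hp he', secondDigit_eq hp hc, add_assoc, h1, ← residue_add]
  refine secondDigit_eq hp ?_
  rw [residue_mul, hs, hs] at hc
  rw [residue_mul]
  generalize s (residue p a) = x at *
  generalize s (residue p b) = y at *
  generalize s (residue p a * residue p b) = w at *
  linear_combination hc + b * he + (x + p * e) * he'

/-- The representative of the class `0` may be any multiple of `p`, so the second digit of `0` has
to be computed, here as a carry. -/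
theorem secondDigit_zero : secondDigit p s (s 0 - s 0) = secondDigit p s 0 := by rw [sub_self]

/-- If `1 = s 1 + p * e`, then `s 1 * s 1 = s 1 - p * e * s 1`, so the carry of this square is `-e`
modulo `p`. -/
theorem secondDigit_one (hp : p ≠ 0) (hs : IsRepresentatives p s) :
    secondDigit p s 1 = 0 - secondDigit p s (s 1 * s 1) := by
  obtain ⟨e, he⟩ := exists_eq_add_mul hs (1 : A)
  obtain ⟨c, hc⟩ := exists_eq_add_mul hs (s 1 * s 1)
  have h1 := secondDigit_eq (s := s) hp hc
  rw [h1, secondDigit_eq hp he, zero_sub, ← residue_neg]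
  rw [residue_mul, hs, mul_one] at hc
  rw [residue_one] at he
  have h2 : c = -e + p * (e * e) := by
    refine mul_left_cancel₀ hp ?_
    have h3 : s 1 = 1 - p * e := by linear_combination -he
    linear_combination -hc + (s 1 - p * e) * h3
  rw [h2, residue_neg, residue_add, residue_neg, residue_mul p, residue_self]
  ring

theorem secondDigit_repr (hp : p ≠ 0) (hs : IsRepresentatives p s) (a : Residue p) :
    secondDigit p s (s a) = 0 := by
  rw [secondDigit_eq (e := 0) hp (by rw [hs, mul_zero, add_zero]), residue_zero]

end Digits

/-! ### From the abstract model to computation trees, and from `A` to pairs of digits. -/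

section Simulation

variable {E : Type*} {A : E → Type u} [∀ e, CommRing (A e)] (p : ∀ e, A e)
  (s : ∀ e, Residue (p e) → A e)

/-- The operations on values in the residue fields that are available to computation trees. -/
def instrOps (R : Set Instr) :
    Set ((∀ e, Residue (p e)) → (∀ e, Residue (p e)) → ∀ e, Residue (p e)) :=
  {F | ∃ o ∈ R, F = fun x y e => o.value (p e) (s e) (x e) (y e)}

/-- A decision in the abstract model gives a computation tree. -/
theorem Decides.exists_tree {R : Set Instr} {P : E → Prop} {c : ℕ} {D : Set E}
    {S : Set (∀ e, Residue (p e))} (h : Decides (instrOps p s R) P c D S)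
    (addr : (∀ e, Residue (p e)) → ℕ) (n : ℕ) (hn : ∀ x ∈ S, addr x < n) :
    ∃ t : CompTree, t.cost ≤ c ∧ (Instr.root ∉ R → t.RootFree) ∧
      ∀ e ∈ D, ∀ m : ℕ → Residue (p e), (∀ x ∈ S, m (addr x) = x e) →
        (t.run (p e) (s e) m = true ↔ P e) := by
  classical
  induction h generalizing addr n with
  | yes h => exact ⟨.leaf true, Nat.zero_le _, fun _ => trivial, fun e he m _ => by
      simp [CompTree.run, h e he]⟩
  | no h => exact ⟨.leaf false, Nat.zero_le _, fun _ => trivial, fun e he m _ => by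
      simp [CompTree.run, h e he]⟩
  | @step c D S F x y ho hx hy _ ih =>
    obtain ⟨o, hoR, rfl⟩ := ho
    set v : ∀ e, Residue (p e) := fun e => o.value (p e) (s e) (x e) (y e) with hv
    -- The result goes to the fresh cell `n`; if the value was already known, its address merely
    -- moves there.
    obtain ⟨t, ht, htR, hrun⟩ := ih (Function.update addr v n) (n + 1) (fun z hz => by
      by_cases hzv : z = v
      · rw [hzv, Function.update_self]; omega
      · rw [Function.update_of_ne hzv]
        have := hn z (Set.mem_of_mem_insert_of_ne hz hzv)
        omega)
    refine ⟨.step o n (addr x) (addr y) t, Nat.succ_le_succ ht,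
      fun hR => by rw [CompTree.RootFree]; exact ⟨fun h => hR (h ▸ hoR), htR hR⟩, fun e he m hm => ?_⟩
    rw [CompTree.run]
    refine hrun e he _ fun z hz => ?_
    by_cases hzv : z = v
    · rw [hzv, Function.update_self, Function.update_self, hm x hx, hm y hy]
    · have hzS := Set.mem_of_mem_insert_of_ne hz hzv
      rw [Function.update_of_ne hzv, Function.update_of_ne (hn z hzS).ne, hm z hzS]
  | @test c D S x hx _ _ ih₀ ih₁ =>
    obtain ⟨t₀, ht₀, htR₀, hrun₀⟩ := ih₀ addr n hn
    obtain ⟨t₁, ht₁, htR₁, hrun₁⟩ := ih₁ addr n hn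
    refine ⟨.test (addr x) t₀ t₁, Nat.succ_le_succ (max_le ht₀ ht₁),
      fun hR => by rw [CompTree.RootFree]; exact ⟨htR₀ hR, htR₁ hR⟩, fun e he m hm => ?_⟩
    rw [CompTree.run, hm x hx]
    split_ifs with h0
    · exact hrun₀ e ⟨he, h0⟩ m hm
    · exact hrun₁ e ⟨he, h0⟩ m hm

/-- The first digit of a family of elements. -/
def lo (w : ∀ e, A e) : ∀ e, Residue (p e) := fun e => residue (p e) (w e)

/-- The second digit of a family of elements. -/
noncomputable def hi (w : ∀ e, A e) : ∀ e, Residue (p e) := fun e => secondDigit (p e) (s e) (w e)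

variable {p s} {R : Set Instr}

theorem ringOps_subset_instrOps (hR : ∀ o, o ≠ Instr.root → o ∈ R) :
    ringOps (∀ e, Residue (p e)) ⊆ instrOps p s R := by
  rintro F (rfl | rfl | rfl | rfl | rfl)
  exacts [⟨.add, hR _ (by simp), rfl⟩, ⟨.sub, hR _ (by simp), rfl⟩, ⟨.mul, hR _ (by simp), rfl⟩,
    ⟨.zero, hR _ (by simp), rfl⟩, ⟨.one, hR _ (by simp), rfl⟩]

theorem Comp.instr {o : Instr} (ho : o ∈ R) {S : Set (∀ e, Residue (p e))}
    {x y : ∀ e, Residue (p e)} (hx : x ∈ S) (hy : y ∈ S) :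
    Comp (instrOps p s R) {fun e => o.value (p e) (s e) (x e) (y e)} 1 S :=
  Comp.op (ops := instrOps p s R) (o := fun x y e => o.value (p e) (s e) (x e) (y e))
    ⟨o, ho, rfl⟩ hx hy

variable [∀ e, IsDomain (A e)]

theorem Comp.digits_zero (hR : ∀ o, o ≠ Instr.root → o ∈ R)
    {S : Set (∀ e, Residue (p e))} {x : ∀ e, Residue (p e)} (hx : x ∈ S) :
    Comp (instrOps p s R) {lo p 0, hi p s 0} 2 S := by
  have hr := ringOps_subset_instrOps (p := p) (s := s) hR
  refine (Comp.zero hr hx).bind (c := 1) (c' := 1) fun S₁ _ hT₁ => ?_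
  rw [Set.singleton_subset_iff] at hT₁
  refine ((Comp.instr (hR .carrySub (by simp)) hT₁ hT₁).keep).mono subset_rfl le_rfl ?_
  rintro _ (rfl | rfl)
  · refine .inl ?_
    convert hT₁ using 1
    ext e; simp [lo]
  · refine .inr ?_
    ext e
    exact secondDigit_zero.symm

theorem Comp.digits_one (hp : ∀ e, p e ≠ 0) (hs : ∀ e, IsRepresentatives (p e) (s e))
    (hR : ∀ o, o ≠ Instr.root → o ∈ R)
    {S : Set (∀ e, Residue (p e))} {x : ∀ e, Residue (p e)} (hx : x ∈ S) :
    Comp (instrOps p s R) {lo p 1, hi p s 1} 4 S := by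
  have hr := ringOps_subset_instrOps (p := p) (s := s) hR
  refine ((Comp.zero hr hx).union (Comp.one hr hx)).bind (c := 1 + 1) (c' := 2) fun S₁ _ hT₁ => ?_
  have h0 := hT₁ (.inl rfl)
  have h1 := hT₁ (.inr rfl)
  refine (Comp.instr (hR .carryMul (by simp)) h1 h1).bind (c := 1) (c' := 1) fun S₂ hS₂ hT₂ => ?_
  rw [Set.singleton_subset_iff] at hT₂
  refine ((Comp.sub hr (hS₂ h0) hT₂).keep).mono subset_rfl le_rfl ?_
  rintro _ (rfl | rfl)
  · refine .inl ?_
    convert hS₂ h1 using 1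
    ext e; simp [lo]
  · refine .inr ?_
    ext e
    exact secondDigit_one (hp e) (hs e)

/-- Ring operations in `A` are simulated on the first two digits. -/
theorem Comp.simulate (hp : ∀ e, p e ≠ 0) (hs : ∀ e, IsRepresentatives (p e) (s e))
    (hR : ∀ o, o ≠ Instr.root → o ∈ R) {T S' : Set (∀ e, A e)} {c : ℕ}
    (h : Comp (ringOps (∀ e, A e)) T c S') {S : Set (∀ e, Residue (p e))}
    (hlo : ∀ w ∈ S', lo p w ∈ S) (hhi : ∀ w ∈ S', hi p s w ∈ S) :
    Comp (instrOps p s R) (lo p '' T ∪ hi p s '' T) (6 * c) S := by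
  have hr := ringOps_subset_instrOps (p := p) (s := s) hR
  induction h generalizing S with
  | done h =>
    refine .done ?_
    rintro _ (⟨w, hw, rfl⟩ | ⟨w, hw, rfl⟩)
    exacts [hlo w (h hw), hhi w (h hw)]
  | @step c S' F x y ho hx hy _ ih =>
    -- The bound is attained by multiplication: three products, one carry and two sums.
    have key : Comp (instrOps p s R) {lo p (F x y), hi p s (F x y)} 6 S := by
      rcases ho with rfl | rfl | rfl | rfl | rfl
      · refine ((Comp.add hr (hlo x hx) (hlo y hy)).union
          ((Comp.add hr (hhi x hx) (hhi y hy)).union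
          (Comp.instr (hR .carryAdd (by simp)) (hlo x hx) (hlo y hy)))).bind
            (c := 1 + (1 + 1)) (c' := 3) fun S₁ _ hT₁ => ?_
        refine ((Comp.add hr (hT₁ (.inr (.inl rfl))) (hT₁ (.inr (.inr rfl)))).keep).mono subset_rfl
          (by norm_num) ?_
        rintro _ (rfl | rfl)
        · exact .inl (hT₁ (.inl (by ext e; simp [lo])))
        · exact .inr (by ext e; exact secondDigit_add (hp e) (hs e) _ _)
      · refine ((Comp.sub hr (hlo x hx) (hlo y hy)).union
          ((Comp.sub hr (hhi x hx) (hhi y hy)).union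
          (Comp.instr (hR .carrySub (by simp)) (hlo x hx) (hlo y hy)))).bind
            (c := 1 + (1 + 1)) (c' := 3) fun S₁ _ hT₁ => ?_
        refine ((Comp.add hr (hT₁ (.inr (.inl rfl))) (hT₁ (.inr (.inr rfl)))).keep).mono subset_rfl
          (by norm_num) ?_
        rintro _ (rfl | rfl)
        · exact .inl (hT₁ (.inl (by ext e; simp [lo])))
        · exact .inr (by ext e; exact secondDigit_sub (hp e) (hs e) _ _)
      · refine (((Comp.mul hr (hlo x hx) (hlo y hy)).union
          (Comp.instr (hR .carryMul (by simp)) (hlo x hx) (hlo y hy))).union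
          ((Comp.mul hr (hlo x hx) (hhi y hy)).union (Comp.mul hr (hhi x hx) (hlo y hy)))).bind
            (c := (1 + 1) + (1 + 1)) (c' := 2) fun S₁ _ hT₁ => ?_
        refine (Comp.add hr (hT₁ (.inl (.inr rfl))) (hT₁ (.inr (.inl rfl)))).bind
          (c := 1) (c' := 1) fun S₂ hS₂ hT₂ => ?_
        refine ((Comp.add hr (hT₂ rfl) (hS₂ (hT₁ (.inr (.inr rfl))))).keep).mono subset_rfl
          le_rfl ?_
        rintro _ (rfl | rfl)
        · exact .inl (hS₂ (hT₁ (.inl (.inl (by ext e; simp [lo])))))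
        · exact .inr (by ext e; exact secondDigit_mul (hp e) (hs e) _ _)
      · exact (Comp.digits_zero hR (hlo x hx)).mono subset_rfl (by norm_num) subset_rfl
      · exact (Comp.digits_one hp hs hR (hlo x hx)).mono subset_rfl (by norm_num) subset_rfl
    rw [mul_add, mul_one, add_comm]
    refine key.bind fun S₁ hS₁ hT₁ => ih ?_ ?_
    · rintro w (rfl | hw)
      exacts [hT₁ (.inl rfl), hS₁ (hlo w hw)]
    · rintro w (rfl | hw)
      exacts [hT₁ (.inr rfl), hS₁ (hhi w hw)]

end Simulation

/-! ### Division steps: a Euclidean algorithm that works from the constant coefficient upwards. -/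

section DivisionSteps

variable {K : Type*} [Field K]

/-- The matrix `(a, b; c, d)` carries `(f, g)` to `X ^ n (f', g')`, and the bounds
`2 deg f ≤ N + δ`, `2 deg g ≤ N - δ` turn into those with `N - n` and `δ'` for `f'` and `g'`. -/
structure Jump (n : ℕ) (δ : ℤ) (f g : K[X]) (δ' : ℤ) (f' g' a b c d : K[X]) : Prop where
  fst : X ^ n * f' = a * f + b * g
  snd : X ^ n * g' = c * f + d * g
  det : ∃ γ : K, γ ≠ 0 ∧ a * d - b * c = C γ * X ^ n
  ne : f'.coeff 0 ≠ 0
  bound : ∀ N : ℤ, (∀ i, f.coeff i ≠ 0 → 2 * (i : ℤ) ≤ N + δ) →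
    (∀ i, g.coeff i ≠ 0 → 2 * (i : ℤ) ≤ N - δ) →
    (∀ i, f'.coeff i ≠ 0 → 2 * (i : ℤ) ≤ N - n + δ') ∧
      (∀ i, g'.coeff i ≠ 0 → 2 * (i : ℤ) ≤ N - n - δ')

theorem Jump.trans {n m : ℕ} {δ₀ δ₁ δ₂ : ℤ} {f₀ g₀ f₁ g₁ f₂ g₂ a b c d a' b' c' d' : K[X]}
    (h : Jump n δ₀ f₀ g₀ δ₁ f₁ g₁ a b c d) (h' : Jump m δ₁ f₁ g₁ δ₂ f₂ g₂ a' b' c' d') :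
    Jump (n + m) δ₀ f₀ g₀ δ₂ f₂ g₂ (a' * a + b' * c) (a' * b + b' * d) (c' * a + d' * c)
      (c' * b + d' * d) where
  fst := by rw [pow_add]; linear_combination X ^ n * h'.fst + a' * h.fst + b' * h.snd
  snd := by rw [pow_add]; linear_combination X ^ n * h'.snd + c' * h.fst + d' * h.snd
  det := by
    obtain ⟨γ, hγ, e⟩ := h.det
    obtain ⟨γ', hγ', e'⟩ := h'.det
    refine ⟨γ * γ', mul_ne_zero hγ hγ', ?_⟩
    rw [pow_add, C_mul]
    linear_combination (a' * d' - b' * c') * e + C γ * X ^ n * e'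
  ne := h'.ne
  bound N hf hg := by
    obtain ⟨h1, h2⟩ := h.bound N hf hg
    have := h'.bound (N - n) h1 h2
    push_cast
    simpa only [sub_sub] using this

/-- The constant coefficient of `g` is eliminated by means of `f`. For `δ ≤ 0` the bound for `f` is
no larger than that for `g`, so the degree bound for the new `g` drops; if `g.coeff 0 = 0`, no
multiple of `f` enters. -/
theorem Jump.keep {δ : ℤ} {f g : K[X]} (hf : f.coeff 0 ≠ 0) (h : δ ≤ 0 ∨ g.coeff 0 = 0) :
    Jump 1 δ f g (δ + 1) f (divX (C (f.coeff 0) * g - C (g.coeff 0) * f))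
      X 0 (-C (g.coeff 0)) (C (f.coeff 0)) where
  fst := by simp
  snd := by
    have := divX_mul_X_add (C (f.coeff 0) * g - C (g.coeff 0) * f)
    have h0 : (C (f.coeff 0) * g - C (g.coeff 0) * f).coeff 0 = 0 := by simp; ring
    rw [h0, C_0] at this
    linear_combination this
  det := ⟨f.coeff 0, hf, by ring⟩
  ne := hf
  bound N h1 h2 := by
    refine ⟨fun i hi => by have := h1 i hi; push_cast; linarith, fun i hi => ?_⟩
    rw [coeff_divX, coeff_sub, coeff_C_mul, coeff_C_mul] at hi
    push_cast
    by_cases hg : g.coeff (i + 1) = 0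
    · rw [hg, mul_zero, zero_sub, neg_ne_zero] at hi
      have h3 := h1 _ (right_ne_zero_of_mul hi)
      have h4 := h.resolve_right (left_ne_zero_of_mul hi)
      push_cast at h3
      linarith
    · have := h2 _ hg
      push_cast at this
      linarith

theorem Jump.swap {δ : ℤ} {f g : K[X]} (hδ : 0 < δ) (hg : g.coeff 0 ≠ 0) :
    Jump 1 δ f g (1 - δ) g (divX (C (g.coeff 0) * f - C (f.coeff 0) * g))
      0 X (C (g.coeff 0)) (-C (f.coeff 0)) where
  fst := by simp
  snd := by
    have := divX_mul_X_add (C (g.coeff 0) * f - C (f.coeff 0) * g)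
    have h0 : (C (g.coeff 0) * f - C (f.coeff 0) * g).coeff 0 = 0 := by simp; ring
    rw [h0, C_0] at this
    linear_combination this
  det := ⟨-g.coeff 0, neg_ne_zero.2 hg, by rw [C_neg]; ring⟩
  ne := hg
  bound N h1 h2 := by
    refine ⟨fun i hi => by have := h2 i hi; push_cast; linarith, fun i hi => ?_⟩
    rw [coeff_divX, coeff_sub, coeff_C_mul, coeff_C_mul] at hi
    push_cast
    by_cases hf : f.coeff (i + 1) = 0
    · rw [hf, mul_zero, zero_sub, neg_ne_zero] at hi
      have h3 := h2 _ (right_ne_zero_of_mul hi)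
      push_cast at h3
      linarith
    · have := h1 _ hf
      push_cast at this
      linarith

/-- Enough division steps give the greatest common divisor. -/
theorem Jump.gcd {n N : ℕ} {δ : ℤ} {f g f' g' a b c d : K[X]} (h : Jump n 1 f g δ f' g' a b c d)
    (hN : 2 * N ≤ n) (hf : f.natDegree < N) (hg : g.natDegree < N) (hf0 : f.coeff 0 ≠ 0) :
    f' ∣ g ∧ (∀ q, q ∣ f → q ∣ g → q ∣ f') ∧
      d.coeff 0 * f'.coeff 0 ≠ 0 ∧ C (f.coeff 0 / (d.coeff 0 * f'.coeff 0)) * d * f' = f := by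
  have hle : ∀ {q : K[X]}, q.natDegree < N → ∀ i, q.coeff i ≠ 0 → (i : ℤ) + 1 ≤ N := by
    intro q hq i hi
    have := le_natDegree_of_ne_zero hi
    omega
  -- After `n ≥ 2 * N` steps the total bound `2 * N - 1 - n` is negative. As `f' ≠ 0`, the bound for
  -- `f'` makes `δ` positive, and then the bound for `g'` leaves only `g' = 0`.
  obtain ⟨h1, h2⟩ := h.bound (2 * N - 1) (fun i hi => by have := hle hf i hi; linarith)
    (fun i hi => by have := hle hg i hi; linarith)
  have hδ := h1 0 h.ne
  have hg' : g' = 0 := by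
    ext i
    by_contra hi
    have := h2 i hi
    push_cast at hδ
    omega
  obtain ⟨γ, hγ, e⟩ := h.det
  have hX : (X : K[X]) ^ n ≠ 0 := pow_ne_zero _ X_ne_zero
  have h3 := h.fst
  have h4 := h.snd
  rw [hg', mul_zero] at h4
  -- The adjugate matrix inverts the transition. So `f'` divides both polynomials, and `d` is the
  -- cofactor of `f` up to a scalar, which the constant coefficients determine.
  have hd : d * f' = C γ * f := mul_left_cancel₀ hX (by linear_combination d * h3 - b * h4 + f * e)
  have hc : -c * f' = C γ * g := mul_left_cancel₀ hX (by linear_combination -c * h3 + a * h4 + g * e)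
  have hu : IsUnit (C γ) := isUnit_C.2 hγ.isUnit
  have h5 : d.coeff 0 * f'.coeff 0 = γ * f.coeff 0 := by
    rw [← mul_coeff_zero, hd, coeff_C_mul]
  refine ⟨?_, fun q hqf hqg => ?_, ?_, ?_⟩
  · rw [← hu.dvd_mul_left (a := f') (b := g), ← hc]
    exact dvd_mul_left _ _
  · have h6 : q ∣ X ^ n * f' := by
      rw [h3]
      exact dvd_add (hqf.mul_left _) (hqg.mul_left _)
    refine IsCoprime.dvd_of_dvd_mul_left (IsCoprime.pow_right (n := n) ?_) h6
    refine ((irreducible_X.coprime_iff_not_dvd).2 fun hx => hf0 ?_).symm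
    rw [X_dvd_iff] at hx
    obtain ⟨t, rfl⟩ := hqf
    rw [mul_coeff_zero, hx, zero_mul]
  · rw [h5]
    exact mul_ne_zero hγ hf0
  · rw [h5, mul_assoc, hd, ← mul_assoc, ← C_mul]
    have : f.coeff 0 / (γ * f.coeff 0) * γ = 1 := by field_simp
    rw [this, C_1, one_mul]

end DivisionSteps

/-! ### Fast gcds of families of polynomials. -/

section Families

variable {E : Type*} {k : E → Type*} [∀ e, CommRing (k e)]

/-- The member of a family of polynomials at `e`. -/
noncomputable def sp (e : E) (F : (∀ e, k e)[X]) : (k e)[X] := F.map (Pi.evalRingHom k e)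

@[simp] theorem coeff_sp (e : E) (F : (∀ e, k e)[X]) (i : ℕ) :
    (sp e F).coeff i = F.coeff i e := by
  simp [sp]

@[simp] theorem sp_mul (e : E) (F G : (∀ e, k e)[X]) : sp e (F * G) = sp e F * sp e G :=
  Polynomial.map_mul _

@[simp] theorem sp_add (e : E) (F G : (∀ e, k e)[X]) : sp e (F + G) = sp e F + sp e G :=
  Polynomial.map_add _

theorem sp_X (e : E) : sp e (X : (∀ e, k e)[X]) = X := map_X _

theorem sp_zero (e : E) : sp e (0 : (∀ e, k e)[X]) = 0 := Polynomial.map_zero _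

theorem sp_C (e : E) (x : ∀ e, k e) : sp e (C x) = C (x e) := map_C _

theorem natDegree_sp_le (e : E) (F : (∀ e, k e)[X]) : (sp e F).natDegree ≤ F.natDegree :=
  natDegree_map_le

/-- Softly linear bound for products of polynomials. -/
def FastMul (C : ℕ) : Prop := ∀ N, 1 ≤ N → MulCost.{u} 1 N 0 (soft C 7 N)

theorem known_iff {V : Type*} [CommRing V] {S : Set V} {f : V[X]} :
    Known S f ↔ Set.range f.coeff ⊆ S := Set.range_subset_iff.symm

theorem Comp.polyMul {V : Type u} [CommRing V] {ops : Set (V → V → V)} {S : Set V}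
    (ho : ringOps V ⊆ ops) {N c : ℕ} (hM : MulCost.{u} 1 N 0 c)
    {f g : V[X]} (hf : f.natDegree < N) (hg : g.natDegree < N) (kf : Known S f) (kg : Known S g) :
    Comp ops (Set.range (f * g).coeff) c S := by
  have := (hM V S f g hf hg kf kg).ops_mono ho
  simpa using this

theorem Comp.polyOp {V : Type*} {ops : Set (V → V → V)} {S : Set V} {N c : ℕ}
    {T : ℕ → V} (h : ∀ i < N, Comp ops {T i} c S) (hT : ∀ i, N ≤ i → T i = T N)
    (h0 : T N ∈ S) : Comp ops (Set.range T) (N * c) S := by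
  have h1 := Comp.forall_mem (ops := ops) (S := S) (c := c) (T := {x | ∃ i < N, x = T i})
    (Finset.range N) (v := T) (fun i hi => h i (by simpa using hi))
    (by rintro _ ⟨i, hi, rfl⟩; exact ⟨i, by simpa, rfl⟩)
  rw [Finset.card_range] at h1
  refine h1.keep.mono subset_rfl le_rfl ?_
  rintro _ ⟨i, rfl⟩
  rcases lt_or_ge i N with hi | hi
  · exact .inr ⟨i, hi, rfl⟩
  · rw [hT i hi]
    exact .inl h0

/-- `a f + b g` with the cost of two products and a sum. -/
theorem Comp.lincomb {V : Type u} [CommRing V] {ops : Set (V → V → V)} {S : Set V}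
    (ho : ringOps V ⊆ ops) {N c : ℕ} (hM : MulCost.{u} 1 N 0 c) (hN : 0 < N)
    {a b f g : V[X]} (ha : a.natDegree < N) (hb : b.natDegree < N)
    (hf : f.natDegree < N) (hg : g.natDegree < N) (ka : Known S a) (kb : Known S b)
    (kf : Known S f) (kg : Known S g) :
    Comp ops (Set.range (a * f + b * g).coeff) (2 * c + 2 * N) S := by
  refine (((Comp.polyMul ho hM ha hf ka kf).union (Comp.polyMul ho hM hb hg kb kg)).bind
    (c' := 2 * N * 1) fun S' hS hT => ?_).mono subset_rfl (by omega) subset_rfl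
  have h1 := natDegree_mul_lt ha hf
  have h2 := natDegree_mul_lt hb hg
  have h3 : ∀ i, 2 * N ≤ i → (a * f + b * g).coeff i = 0 := fun i hi => by
    rw [coeff_add, coeff_eq_zero_of_natDegree_lt (by omega),
      coeff_eq_zero_of_natDegree_lt (by omega), add_zero]
  refine Comp.polyOp (fun i _ => ?_) (fun i hi => by rw [h3 i hi, h3 _ le_rfl]) ?_
  · rw [coeff_add]
    exact .add ho (hT (.inl ⟨i, rfl⟩)) (hT (.inr ⟨i, rfl⟩))
  · rw [h3 _ le_rfl]
    exact hS ka.zero_mem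

theorem coeff_mul_congr {K : Type*} [CommRing K] {a f f' : K[X]} {N : ℕ}
    (h : ∀ i < N, f.coeff i = f'.coeff i) {i : ℕ} (hi : i < N) :
    (a * f).coeff i = (a * f').coeff i := by
  rw [coeff_mul, coeff_mul]
  refine Finset.sum_congr rfl fun x hx => ?_
  rw [Finset.HasAntidiagonal.mem_antidiagonal] at hx
  rw [h x.2 (by omega)]

/-- The cost of `2 ^ j` division steps. -/
def jumpCost (C j : ℕ) : ℕ := 2 ^ j * (4 + 24 * (C + 1) * j * (j + 3) ^ 7)

/-- Twice as many steps need two half jumps and six linear combinations: two to advance the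
polynomials, four for the matrix product. -/
theorem jumpCost_succ (C j : ℕ) :
    2 * jumpCost C j + 6 * (2 * soft C 7 (2 * 2 ^ j + 1) + 2 * (2 * 2 ^ j + 1)) ≤
      jumpCost C (j + 1) := by
  have h1 : 1 ≤ 2 ^ j := Nat.one_le_two_pow
  have hlog : Nat.log 2 (2 * 2 ^ j + 1) ≤ j + 2 := by
    calc Nat.log 2 (2 * 2 ^ j + 1) ≤ Nat.log 2 (2 ^ (j + 2)) :=
          Nat.log_mono_right (by rw [pow_add]; omega)
      _ = j + 2 := Nat.log_pow one_lt_two _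
  have h2 : soft C 7 (2 * 2 ^ j + 1) ≤ C * (4 * 2 ^ j) * (j + 3) ^ 7 := by
    exact Nat.mul_le_mul (Nat.mul_le_mul_left _ (by omega)) (Nat.pow_le_pow_left (by omega) _)
  have h3 : 2 * 2 ^ j + 1 ≤ 4 * 2 ^ j * (j + 3) ^ 7 := by
    have : 1 ≤ (j + 3) ^ 7 := Nat.one_le_pow _ _ (by omega)
    nlinarith
  have h4 : (j + 3) ^ 7 ≤ (j + 1 + 3) ^ 7 := Nat.pow_le_pow_left (by omega) _
  calc _ ≤ 2 * jumpCost C j + 6 * (2 * (C * (4 * 2 ^ j) * (j + 3) ^ 7) +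
        2 * (4 * 2 ^ j * (j + 3) ^ 7)) := by gcongr
    _ = 2 ^ (j + 1) * (4 + 24 * (C + 1) * (j + 1) * (j + 3) ^ 7) := by
        unfold jumpCost; ring
    _ ≤ jumpCost C (j + 1) := by unfold jumpCost; gcongr

/-- Low coefficients of products depend on low coefficients only, so the transition matrices can be
found from truncations. -/
theorem coeff_lincomb_sp {n : ℕ} (e : E) {a b F G : (∀ e, k e)[X]} {f g : (k e)[X]}
    (hf : ∀ i < n, f.coeff i = F.coeff i e) (hg : ∀ i < n, g.coeff i = G.coeff i e) {i : ℕ}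
    (hi : i < n) : (sp e a * f + sp e b * g).coeff i =
      (a * polyOf n F.coeff + b * polyOf n G.coeff).coeff i e := by
  rw [← coeff_sp, sp_add, sp_mul, sp_mul, coeff_add, coeff_add]
  congr 1
  · refine coeff_mul_congr (fun i hi => ?_) hi
    rw [hf i hi, coeff_sp, coeff_polyOf, if_pos hi]
  · refine coeff_mul_congr (fun i hi => ?_) hi
    rw [hg i hi, coeff_sp, coeff_polyOf, if_pos hi]

/-- The transition matrix of `2 ^ j` division steps. -/
theorem Decides.jump.{u₁, u₂} {E : Type u₁} {k : E → Type u₂} [∀ e, Field (k e)]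
    {ops : Set ((∀ e, k e) → (∀ e, k e) → ∀ e, k e)} (ho : ringOps (∀ e, k e) ⊆ ops) {P : E → Prop}
    {B : ℕ} (hB : FastMul.{max u₁ u₂} B) (j : ℕ) {c : ℕ} {D : Set E} {S : Set (∀ e, k e)} (δ : ℤ)
    {F G : (∀ e, k e)[X]} (kF : Known S F) (kG : Known S G) (hF : ∀ e ∈ D, F.coeff 0 e ≠ 0)
    (next : ∀ D' ⊆ D, ∀ S', S ⊆ S' → ∀ (δ' : ℤ) (m₁ m₂ m₃ m₄ : (∀ e, k e)[X]),
      m₁.natDegree < 2 ^ j + 1 → m₂.natDegree < 2 ^ j + 1 →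
      m₃.natDegree < 2 ^ j + 1 → m₄.natDegree < 2 ^ j + 1 →
      Known S' m₁ → Known S' m₂ → Known S' m₃ → Known S' m₄ →
      (∀ e ∈ D', ∀ f g : (k e)[X], (∀ i < 2 ^ j, f.coeff i = F.coeff i e) →
        (∀ i < 2 ^ j, g.coeff i = G.coeff i e) →
        ∃ f' g', Jump (2 ^ j) δ f g δ' f' g' (sp e m₁) (sp e m₂) (sp e m₃) (sp e m₄)) →
      Decides ops P c D' S') :
    Decides ops P (jumpCost B j + c) D S := by
  induction j generalizing c D S δ F G with
  | zero =>
    have h1 : Comp ops {1, 0 - G.coeff 0, 0 - F.coeff 0} 3 S := by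
      have := (Comp.one ho kF.zero_mem).union
        ((Comp.sub ho kF.zero_mem (kG 0)).union (Comp.sub ho kF.zero_mem (kF 0)))
      rwa [Set.singleton_union, Set.singleton_union] at this
    have hJ : jumpCost B 0 = 3 + 1 := by simp [jumpCost]
    rw [hJ, add_assoc]
    refine h1.decides fun S₁ hS₁ hT₁ => ?_
    have k0 : (0 : ∀ e, k e) ∈ S₁ := hS₁ kF.zero_mem
    have k1 : (1 : ∀ e, k e) ∈ S₁ := hT₁ (by simp)
    have kX : Known S₁ (X : (∀ e, k e)[X]) := fun i => by
      rw [coeff_X]; split_ifs; exacts [k1, k0]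
    have kC : ∀ x ∈ S₁, Known S₁ (C x : (∀ e, k e)[X]) := fun x hx i => by
      rw [coeff_C]; split_ifs; exacts [hx, k0]
    have dX : (X : (∀ e, k e)[X]).natDegree < 2 ^ 0 + 1 := by
      have := natDegree_X_le (R := ∀ e, k e); omega
    have dC : ∀ x : ∀ e, k e, (Polynomial.C x).natDegree < 2 ^ 0 + 1 := fun x => by simp
    have d0 : (0 : (∀ e, k e)[X]).natDegree < 2 ^ 0 + 1 := by simp
    have kn0 : Known S₁ (0 : (∀ e, k e)[X]) := fun i => by simpa using k0
    have kg : 0 - G.coeff 0 ∈ S₁ := hT₁ (by simp)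
    have kf : 0 - F.coeff 0 ∈ S₁ := hT₁ (by simp)
    have hsw : ∀ D' ⊆ D, 0 < δ → (∀ e ∈ D', G.coeff 0 e ≠ 0) → Decides ops P c D' S₁ := by
      intro D' hD' hδ hG
      refine next D' hD' S₁ hS₁ (1 - δ) 0 X (C (G.coeff 0)) (C (0 - F.coeff 0)) d0 dX (dC _) (dC _)
        kn0 kX (kC _ (hS₁ (kG 0))) (kC _ kf) fun e he f g hf hg => ?_
      have hf0 := hf 0 (by norm_num)
      have hg0 := hg 0 (by norm_num)
      have := Jump.swap (f := f) (g := g) hδ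
        (by rw [hg0]; exact hG e he)
      rw [hf0, hg0] at this
      simp only [sp_C, sp_X, sp_zero, Pi.sub_apply, Pi.zero_apply, pow_zero]
      simp only [zero_sub, C_neg]
      exact ⟨_, _, this⟩
    have hke : ∀ D' ⊆ D, (δ ≤ 0 ∨ ∀ e ∈ D', G.coeff 0 e = 0) → Decides ops P c D' S₁ := by
      intro D' hD' hG
      refine next D' hD' S₁ hS₁ (δ + 1) X 0 (C (0 - G.coeff 0)) (C (F.coeff 0)) dX d0 (dC _) (dC _)
        kX kn0 (kC _ kg) (kC _ (hS₁ (kF 0))) fun e he f g hf hg => ?_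
      have hf0 := hf 0 (by norm_num)
      have hg0 := hg 0 (by norm_num)
      have := Jump.keep (δ := δ) (f := f) (g := g) (by rw [hf0]; exact hF e (hD' he))
        (hG.imp_right fun h => by rw [hg0]; exact h e he)
      rw [hf0, hg0] at this
      simp only [sp_C, sp_X, sp_zero, Pi.sub_apply, Pi.zero_apply, pow_zero]
      simp only [zero_sub, C_neg]
      exact ⟨_, _, this⟩
    rw [add_comm 1 c]
    -- The integer `δ` is known at each node of the tree, so a step needs at most one zero test.
    by_cases hδ : δ ≤ 0
    · exact (hke D subset_rfl (.inl hδ)).mono (Nat.le_succ _)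
    · exact .test (hS₁ (kG 0)) (hke _ Set.inter_subset_left (.inr fun e he => he.2))
        (hsw _ Set.inter_subset_left (not_le.1 hδ) fun e he => he.2)
  | succ j ih =>
    set n := 2 ^ j with hn
    have hn1 : 1 ≤ n := Nat.one_le_two_pow
    have h2n : 2 ^ (j + 1) = n + n := by rw [pow_succ]; omega
    set N := 2 * n + 1 with hN
    have hM := hB N (by omega)
    set μ := 2 * soft B 7 N + 2 * N with hμ
    refine Decides.mono (c := jumpCost B j + (μ + (μ + (jumpCost B j + (μ + (μ + (μ + (μ + c))))))))
      ?_ (by have := jumpCost_succ B j; rw [← hn, ← hN] at this; omega)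
    refine ih δ kF kG hF fun D₁ hD₁ S₁ hS₁ δ₁ a b c' d ha hb hc hd ka kb kc kd hJ => ?_
    rw [h2n] at next
    -- The first half jump divides by `X ^ n`; the `n` coefficients needed for the second half are
    -- therefore those with indices `n, …, 2 * n - 1` of the combinations `U` and `W`.
    have hT := natDegree_polyOf_lt (V := ∀ e, k e) (show 0 < n + n by omega)
    have kF' : Known S₁ (polyOf (n + n) F.coeff) := .polyOf (hS₁ kF.zero_mem) fun i _ => hS₁ (kF i)
    have kG' : Known S₁ (polyOf (n + n) G.coeff) := .polyOf (hS₁ kF.zero_mem) fun i _ => hS₁ (kG i)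
    have hFd := hT F.coeff
    have hGd := hT G.coeff
    refine (Comp.lincomb ho hM (by omega) (ha.trans_le (by omega)) (hb.trans_le (by omega))
      (hFd.trans_le (by omega)) (hGd.trans_le (by omega)) ka kb kF' kG').decides
        fun S₂ hS₂ kU => ?_
    refine (Comp.lincomb ho hM (by omega) (hc.trans_le (by omega)) (hd.trans_le (by omega))
      (hFd.trans_le (by omega)) (hGd.trans_le (by omega)) (kc.mono hS₂) (kd.mono hS₂)
        (kF'.mono hS₂) (kG'.mono hS₂)).decides fun S₃ hS₃ kW => ?_
    rw [← known_iff] at kU kW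
    replace kU := kU.mono hS₃
    set U := a * polyOf (n + n) F.coeff + b * polyOf (n + n) G.coeff with hU
    set W := c' * polyOf (n + n) F.coeff + d * polyOf (n + n) G.coeff with hW
    -- the polynomials after the first half
    have hfirst : ∀ e ∈ D₁, ∀ f g : (k e)[X], (∀ i < n + n, f.coeff i = F.coeff i e) →
        (∀ i < n + n, g.coeff i = G.coeff i e) → ∃ f' g',
          Jump n δ f g δ₁ f' g' (sp e a) (sp e b) (sp e c') (sp e d) ∧
          (∀ i < n, f'.coeff i = (polyOf n fun i => U.coeff (n + i)).coeff i e) ∧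
          (∀ i < n, g'.coeff i = (polyOf n fun i => W.coeff (n + i)).coeff i e) := by
      intro e he f g hf hg
      obtain ⟨f', g', hJ'⟩ := hJ e he f g (fun i hi => hf i (by omega)) (fun i hi => hg i (by omega))
      refine ⟨f', g', hJ', fun i hi => ?_, fun i hi => ?_⟩
      · have h := congrArg (fun q => q.coeff (i + n)) hJ'.fst
        simp only [coeff_X_pow_mul] at h
        rw [h, coeff_lincomb_sp e hf hg (by omega), coeff_polyOf, if_pos hi, add_comm n i]
      · have h := congrArg (fun q => q.coeff (i + n)) hJ'.snd
        simp only [coeff_X_pow_mul] at h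
        rw [h, coeff_lincomb_sp e hf hg (by omega), coeff_polyOf, if_pos hi, add_comm n i]
    have k0 : (0 : ∀ e, k e) ∈ S₃ := kU.zero_mem
    refine ih δ₁ (F := polyOf n fun i => U.coeff (n + i)) (G := polyOf n fun i => W.coeff (n + i))
      (.polyOf k0 fun i _ => kU _) (.polyOf k0 fun i _ => kW _) (fun e he => ?_)
      fun D₂ hD₂ S₄ hS₄ δ₂ a' b' c'' d' ha' hb' hc' hd' ka' kb' kc' kd' hJ' => ?_
    · obtain ⟨f', g', h1, h2, -⟩ := hfirst e he (sp e F) (sp e G) (fun i _ => coeff_sp e F i)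
        (fun i _ => coeff_sp e G i)
      rw [← h2 0 (by omega)]
      exact h1.ne
    have hS₁₄ := (hS₂.trans hS₃).trans hS₄
    refine (Comp.lincomb ho hM (by omega) (ha'.trans_le (by omega)) (hb'.trans_le (by omega))
      (ha.trans_le (by omega)) (hc.trans_le (by omega)) ka' kb' (ka.mono hS₁₄)
      (kc.mono hS₁₄)).decides fun S₅ hS₅ kA => ?_
    refine (Comp.lincomb ho hM (by omega) (ha'.trans_le (by omega)) (hb'.trans_le (by omega))
      (hb.trans_le (by omega)) (hd.trans_le (by omega)) (ka'.mono hS₅) (kb'.mono hS₅)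
      (kb.mono (hS₁₄.trans hS₅)) (kd.mono (hS₁₄.trans hS₅))).decides fun S₆ hS₆ kB => ?_
    have hS₄₆ := hS₅.trans hS₆
    refine (Comp.lincomb ho hM (by omega) (hc'.trans_le (by omega)) (hd'.trans_le (by omega))
      (ha.trans_le (by omega)) (hc.trans_le (by omega)) (kc'.mono hS₄₆) (kd'.mono hS₄₆)
      (ka.mono (hS₁₄.trans hS₄₆)) (kc.mono (hS₁₄.trans hS₄₆))).decides fun S₇ hS₇ kC => ?_
    have hS₄₇ := hS₄₆.trans hS₇
    refine (Comp.lincomb ho hM (by omega) (hc'.trans_le (by omega)) (hd'.trans_le (by omega))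
      (hb.trans_le (by omega)) (hd.trans_le (by omega)) (kc'.mono hS₄₇) (kd'.mono hS₄₇)
      (kb.mono (hS₁₄.trans hS₄₇)) (kd.mono (hS₁₄.trans hS₄₇))).decides fun S₈ hS₈ kD => ?_
    rw [← known_iff] at kA kB kC kD
    have hdeg : ∀ {x y z w : (∀ e, k e)[X]}, x.natDegree < n + 1 → y.natDegree < n + 1 →
        z.natDegree < n + 1 → w.natDegree < n + 1 → (x * y + z * w).natDegree < n + n + 1 := by
      intro x y z w hx hy hz hw
      have h1 := natDegree_mul_lt hx hy
      have h2 := natDegree_mul_lt hz hw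
      have h3 := natDegree_add_le (x * y) (z * w)
      omega
    refine next D₂ (hD₂.trans hD₁) S₈ (((hS₁.trans hS₁₄).trans hS₄₇).trans hS₈) δ₂ _ _ _ _
      (hdeg ha' ha hb' hc) (hdeg ha' hb hb' hd) (hdeg hc' ha hd' hc) (hdeg hc' hb hd' hd)
      (kA.mono ((hS₆.trans hS₇).trans hS₈)) (kB.mono (hS₇.trans hS₈)) (kC.mono hS₈) kD
      fun e he f g hf hg => ?_
    obtain ⟨f', g', h1, h2, h3⟩ := hfirst e (hD₂ he) f g hf hg
    obtain ⟨f'', g'', h4⟩ := hJ' e he f' g' h2 h3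
    refine ⟨f'', g'', ?_⟩
    simp only [sp_add, sp_mul]
    exact h1.trans h4

/-- The cost of a greatest common divisor of polynomials of degree less than `N`. -/
def gcdCost (B N : ℕ) : ℕ :=
  jumpCost B (Nat.clog 2 (2 * N)) + ((2 * soft B 7 (2 ^ Nat.clog 2 (2 * N) + 1) +
    2 * (2 ^ Nat.clog 2 (2 * N) + 1)) + (3 + N))

/-- The greatest common divisor `H` of `F` and `G`, and the quotient `Q` of `F` by it. -/
theorem Decides.gcd.{u₁, u₂} {E : Type u₁} {k : E → Type u₂} [∀ e, Field (k e)]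
    {ops : Set ((∀ e, k e) → (∀ e, k e) → ∀ e, k e)} (ho : ringOps (∀ e, k e) ⊆ ops)
    (hi : (fun x _ e => (x e)⁻¹) ∈ ops) {P : E → Prop}
    {B : ℕ} (hB : FastMul.{max u₁ u₂} B) {N : ℕ} {c : ℕ} {D : Set E}
    {S : Set (∀ e, k e)} {F G : (∀ e, k e)[X]} (dF : F.natDegree < N) (dG : G.natDegree < N)
    (kF : Known S F) (kG : Known S G) (hF : ∀ e ∈ D, F.coeff 0 e ≠ 0)
    (next : ∀ D' ⊆ D, ∀ S', S ⊆ S' → ∀ (H Q : (∀ e, k e)[X]),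
      H.natDegree < N → Q.natDegree < N → Known S' H → Known S' Q →
      (∀ e ∈ D', sp e Q * sp e H = sp e F ∧ sp e H ∣ sp e G ∧
        ∀ q, q ∣ sp e F → q ∣ sp e G → q ∣ sp e H) →
      Decides ops P c D' S') :
    Decides ops P (gcdCost B N + c) D S := by
  have hN : 0 < N := by omega
  rw [gcdCost]
  set j := Nat.clog 2 (2 * N) with hj
  set n := 2 ^ j with hn
  have h2N : 2 * N ≤ n := Nat.le_pow_clog one_lt_two _
  rw [add_assoc, add_assoc]
  refine Decides.jump ho hB j 1 kF kG hF fun D₁ hD₁ S₁ hS₁ δ a b c' d ha hb _ hd ka kb _ kd hJ => ?_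
  rw [← hn] at ha hb hd hJ
  refine (Comp.lincomb ho (hB (n + 1) (by omega)) (by omega) ha hb (dF.trans_le (by omega))
    (dG.trans_le (by omega)) ka kb (kF.mono hS₁) (kG.mono hS₁)).decides fun S₂ hS₂ kU => ?_
  rw [← known_iff] at kU
  set U := a * F + b * G with hU
  have k0 := kU.zero_mem
  set H := polyOf N fun i => U.coeff (n + i) with hH
  have kH : Known S₂ H := .polyOf k0 fun i _ => kU _
  have hgcd : ∀ e ∈ D₁, sp e H ∣ sp e G ∧ (∀ q, q ∣ sp e F → q ∣ sp e G → q ∣ sp e H) ∧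
      d.coeff 0 e * H.coeff 0 e ≠ 0 ∧
      C (F.coeff 0 e / (d.coeff 0 e * H.coeff 0 e)) * sp e d * sp e H = sp e F := by
    intro e he
    obtain ⟨f', g', h⟩ := hJ e he (sp e F) (sp e G) (fun i _ => coeff_sp _ _ _)
      (fun i _ => coeff_sp _ _ _)
    have hF0 : (sp e F).coeff 0 ≠ 0 := by rw [coeff_sp]; exact hF e (hD₁ he)
    have h1 := h.gcd h2N ((natDegree_sp_le e F).trans_lt dF) ((natDegree_sp_le e G).trans_lt dG) hF0
    -- Truncation at `N` loses nothing, since `f'` divides `F`, which has degree below `N`.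
    have hfH : f' = sp e H := by
      ext i
      rw [coeff_sp, hH, coeff_polyOf]
      split_ifs with hi
      · have h2 := congrArg (fun q => q.coeff (i + n)) h.fst
        simp only [coeff_X_pow_mul] at h2
        rw [h2, hU, ← sp_mul, ← sp_mul, ← sp_add, coeff_sp, add_comm n i]
      · have h3 : f' ∣ sp e F := Dvd.intro_left _ h1.2.2.2
        have h4 := natDegree_le_of_dvd h3 (fun h => hF0 (by rw [h, coeff_zero]))
        have h5 := natDegree_sp_le e F
        exact coeff_eq_zero_of_natDegree_lt (by omega)
    rw [hfH] at h1
    simpa only [coeff_sp] using h1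
  rw [add_assoc]
  have h3 : Comp ops {fun e => F.coeff 0 e * (d.coeff 0 e * H.coeff 0 e)⁻¹} 3 S₂ := by
    refine (Comp.mul ho (hS₂ (kd 0)) (kH 0)).bind (c := 1) (c' := 2) fun S₃ hS₃ hT₃ => ?_
    refine (Comp.op hi (hT₃ rfl) (hT₃ rfl)).bind (c := 1) (c' := 1) fun S₄ hS₄ hT₄ => ?_
    exact Comp.mul ho (hS₄ (hS₃ (hS₂ (hS₁ (kF 0))))) (hT₄ rfl)
  refine h3.decides fun S₃ hS₃ hT₃ => ?_
  set w : ∀ e, k e := fun e => F.coeff 0 e * (d.coeff 0 e * H.coeff 0 e)⁻¹ with hw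
  have h4 := Comp.forall_mem (ops := ops) (S := S₃) (c := 1) (T := {x | ∃ i < N, x = w * d.coeff i})
    (Finset.range N) (v := fun i => w * d.coeff i)
    (fun i _ => .mul ho (hT₃ rfl) (hS₃ (hS₂ (kd i))))
    (by rintro _ ⟨i, hi, rfl⟩; exact ⟨i, by simpa, rfl⟩)
  rw [Finset.card_range, mul_one] at h4
  refine h4.decides fun S₄ hS₄ hT₄ => ?_
  refine next D₁ hD₁ S₄ (((hS₁.trans hS₂).trans hS₃).trans hS₄) H (polyOf N fun i => w * d.coeff i)
    (natDegree_polyOf_lt hN _) (natDegree_polyOf_lt hN _) (kH.mono (hS₃.trans hS₄))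
    (.polyOf (hS₄ (hS₃ k0)) fun i hi => hT₄ ⟨i, hi, rfl⟩) fun e he => ?_
  obtain ⟨g1, g2, g3, g4⟩ := hgcd e he
  refine ⟨?_, g1, g2⟩
  rw [← g4]
  congr 1
  have hF0 : sp e F ≠ 0 := fun h => hF e (hD₁ he) (by rw [← coeff_sp, h, coeff_zero])
  have h5 := natDegree_le_of_dvd (Dvd.intro _ g4) hF0
  have h6 := natDegree_sp_le e F
  ext i
  rw [coeff_sp, coeff_polyOf]
  split_ifs with hi
  · rw [coeff_C_mul, coeff_sp, Pi.mul_apply, hw, div_eq_mul_inv]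
  · exact (coeff_eq_zero_of_natDegree_lt (by omega)).symm

theorem exists_gcdCost_le (B : ℕ) : ∃ B', ∀ N, 1 ≤ N → gcdCost B N ≤ soft B' 8 N := by
  refine ⟨4 * (4 + 24 * (B + 1) * 5 ^ 8) + 2 * (B * 5 * 5 ^ 7) + 10 + 4, fun N hN => ?_⟩
  set l := Nat.log 2 N with hl
  have hj : Nat.clog 2 (2 * N) ≤ l + 2 := by
    refine (clog_le_log_add_one _).trans ?_
    rw [mul_comm, Nat.log_mul_base one_lt_two (by omega)]
  have hn : 2 ^ Nat.clog 2 (2 * N) ≤ 4 * N := by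
    have := pow_clog_le one_lt_two (show 1 ≤ 2 * N by omega)
    omega
  rw [gcdCost, jumpCost]
  set j := Nat.clog 2 (2 * N)
  have hlog : Nat.log 2 (2 ^ j + 1) ≤ l + 3 := by
    calc Nat.log 2 (2 ^ j + 1) ≤ Nat.log 2 (2 ^ (j + 1)) :=
          Nat.log_mono_right (by have := Nat.one_le_two_pow (n := j); rw [pow_succ]; omega)
      _ = j + 1 := Nat.log_pow one_lt_two _
      _ ≤ l + 3 := by omega
  set q := (l + 1) ^ 8 with hq
  have hq1 : 1 ≤ q := Nat.one_le_pow _ _ (by omega)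
  have e1 : j * (j + 3) ^ 7 ≤ 5 ^ 8 * q := by
    calc j * (j + 3) ^ 7 ≤ (5 * (l + 1)) * (5 * (l + 1)) ^ 7 :=
          Nat.mul_le_mul (by omega) (Nat.pow_le_pow_left (by omega) _)
      _ = 5 ^ 8 * q := by rw [hq]; ring
  have e2 : soft B 7 (2 ^ j + 1) ≤ B * (5 * N) * (5 ^ 7 * q) := by
    refine Nat.mul_le_mul (Nat.mul_le_mul_left _ (by omega)) ?_
    calc (Nat.log 2 (2 ^ j + 1) + 1) ^ 7 ≤ (5 * (l + 1)) ^ 7 := Nat.pow_le_pow_left (by omega) _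
      _ = 5 ^ 7 * (l + 1) ^ 7 := mul_pow _ _ _
      _ ≤ 5 ^ 7 * q := Nat.mul_le_mul_left _ (Nat.pow_le_pow_right (by omega) (by norm_num))
  have e3 : N ≤ N * q := Nat.le_mul_of_pos_right _ hq1
  calc _ ≤ 4 * N * (4 * q + 24 * (B + 1) * (5 ^ 8 * q)) + ((2 * (B * (5 * N) * (5 ^ 7 * q)) +
        2 * (5 * (N * q))) + (4 * (N * q))) := by
        refine Nat.add_le_add (Nat.mul_le_mul hn (Nat.add_le_add (by omega) ?_))
          (Nat.add_le_add (Nat.add_le_add (Nat.mul_le_mul_left _ e2) (by omega)) (by omega))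
        rw [mul_assoc]
        exact Nat.mul_le_mul_left _ e1
    _ = soft (4 * (4 + 24 * (B + 1) * 5 ^ 8) + 2 * (B * 5 * 5 ^ 7) + 10 + 4) 8 N := by
        rw [soft, ← hl, ← hq]; ring

end Families

/-! ### Locating repeated factors by derivatives and by `ℓ`-th roots. -/

section RepeatedFactors

variable {K : Type*} [Field K]

/-- A repeated factor of `F` whose multiplicity is not divisible by the characteristic divides the
gcd of `F` and its derivative, and also the quotient of `F` by this gcd. -/
theorem dvd_of_sq_dvd {F U v φ : K[X]} (hF : F ≠ 0) (hφ : Irreducible φ) (hφ' : derivative φ ≠ 0)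
    (h2 : φ ^ 2 ∣ F) (hvU : v * U = F) (hU : U ∣ derivative F)
    (hgcd : ∀ q, q ∣ F → q ∣ derivative F → q ∣ U)
    (hm : ∀ m : ℕ, 2 ≤ m → φ ^ m ∣ F → ¬ φ ^ (m + 1) ∣ F → (m : K) ≠ 0) : φ ∣ v ∧ φ ∣ U := by
  have hfin : FiniteMultiplicity φ F := FiniteMultiplicity.of_prime_left hφ.prime hF
  obtain ⟨m, ⟨q, hq⟩, hm1⟩ : ∃ m, φ ^ m ∣ F ∧ ¬ φ ^ (m + 1) ∣ F :=
    ⟨_, pow_multiplicity_dvd _ _, hfin.not_pow_dvd_of_multiplicity_lt (Nat.lt_succ_self _)⟩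
  have hm2 : 2 ≤ m := by
    by_contra h
    exact hm1 ((pow_dvd_pow φ (by omega)).trans h2)
  have hmK := hm m hm2 ⟨q, hq⟩ hm1
  have hqφ : ¬ φ ∣ q := fun h => hm1 (by
    rw [hq, pow_succ]; exact mul_dvd_mul_left _ h)
  obtain ⟨m, rfl⟩ : ∃ n, m = n + 2 := ⟨m - 2, by omega⟩
  have hder : derivative F = φ ^ (m + 1) * (C ((m + 2 : ℕ) : K) * derivative φ * q +
      φ * derivative q) := by
    rw [hq, derivative_mul, derivative_pow]
    simp only [show m + 2 - 1 = m + 1 by omega]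
    ring
  -- In the current indexing the multiplicity of `φ` in `F` is `m + 2`. In `F'`, hence in `U`, it is
  -- exactly `m + 1`, so one factor `φ` is left for `v`.
  have hpU : φ ^ (m + 1) ∣ U :=
    hgcd _ ⟨φ * q, by rw [hq]; ring⟩ ⟨_, hder⟩
  refine ⟨?_, (dvd_pow_self φ (by omega)).trans hpU⟩
  by_contra hv
  have hcop : IsCoprime (φ ^ (m + 2)) v := ((hφ.coprime_iff_not_dvd).2 hv).pow_left
  have h3 : φ ^ (m + 2) ∣ U := hcop.dvd_of_dvd_mul_left (by rw [hvU, hq]; exact dvd_mul_right _ _)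
  have h4 := h3.trans hU
  rw [hder, pow_succ φ (m + 1)] at h4
  have h5 := (mul_dvd_mul_iff_left (pow_ne_zero _ hφ.ne_zero)).1 h4
  rw [dvd_add_left (dvd_mul_right _ _)] at h5
  rcases hφ.prime.dvd_or_dvd h5 with h6 | h6
  · rcases hφ.prime.dvd_or_dvd h6 with h7 | h7
    · exact hφ.not_isUnit (isUnit_of_dvd_unit h7 (isUnit_C.2 hmK.isUnit))
    · exact hφ' (eq_zero_of_dvd_of_degree_lt h7 (degree_derivative_lt hφ.ne_zero))
  · exact hqφ h6

theorem derivative_ne_zero_of_natCast {φ : K[X]} (h : (φ.natDegree : K) ≠ 0) :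
    derivative φ ≠ 0 := by
  intro h0
  have hn : φ.natDegree ≠ 0 := fun h1 => h (by rw [h1, Nat.cast_zero])
  have h1 := congrArg (fun q => q.coeff (φ.natDegree - 1)) h0
  simp only [coeff_derivative, coeff_zero] at h1
  rw [← Nat.cast_succ, Nat.succ_eq_add_one, Nat.sub_add_cancel (by omega)] at h1
  rcases mul_eq_zero.1 h1 with h2 | h2
  · rw [coeff_natDegree, leadingCoeff_eq_zero] at h2
    rw [h2] at hn; simp at hn
  · exact h h2

variable {ℓ : ℕ} [CharP K ℓ]

theorem coeff_sum_pow_char (hℓ : ℓ.Prime) (G : ℕ → K[X]) {i : ℕ} (hi : i < ℓ) (j : ℕ) :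
    (∑ i ∈ Finset.range ℓ, X ^ i * G i ^ ℓ).coeff (ℓ * j + i) = (G i).coeff j ^ ℓ := by
  have : ExpChar K ℓ := ExpChar.prime hℓ
  have hpow : ∀ (g : K[X]) n, (g ^ ℓ).coeff n = if ℓ ∣ n then g.coeff (n / ℓ) ^ ℓ else 0 := by
    intro g n
    rw [← map_frobenius_expand ℓ g, coeff_map, coeff_expand hℓ.pos]
    split_ifs
    · rfl
    · exact map_zero _
  rw [finsetSum_coeff, Finset.sum_eq_single i]
  · rw [add_comm, coeff_X_pow_mul', if_pos (by omega), Nat.add_sub_cancel_left, hpow,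
      if_pos (dvd_mul_right _ _), Nat.mul_div_cancel_left _ hℓ.pos]
  · intro i' hi' hne
    rw [Finset.mem_range] at hi'
    rw [coeff_X_pow_mul']
    split_ifs with hle
    · rw [hpow, if_neg]
      intro hd
      apply hne
      have h1 : (ℓ * j + i) % ℓ = i' % ℓ := ((Nat.modEq_iff_dvd' hle).2 hd).symm
      rwa [Nat.mul_add_mod, Nat.mod_eq_of_lt hi, Nat.mod_eq_of_lt hi', eq_comm] at h1
    · rfl
  · simp [hi]

theorem eq_sum_pow_char (hℓ : ℓ.Prime) {F : K[X]} {G : ℕ → K[X]}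
    (h : ∀ i < ℓ, ∀ j, (G i).coeff j ^ ℓ = F.coeff (ℓ * j + i)) :
    F = ∑ i ∈ Finset.range ℓ, X ^ i * G i ^ ℓ := by
  ext n
  have hn := Nat.div_add_mod n ℓ
  rw [← hn, coeff_sum_pow_char hℓ _ (Nat.mod_lt _ hℓ.pos), h _ (Nat.mod_lt _ hℓ.pos)]

/-- Over a perfect field, `Y ^ ℓ` divides `F` iff `Y` divides all `ℓ`-th roots of its parts. -/
theorem pow_char_dvd (hℓ : ℓ.Prime) {F Y : K[X]} {G : ℕ → K[X]}
    (h : ∀ i < ℓ, ∀ j, (G i).coeff j ^ ℓ = F.coeff (ℓ * j + i)) (hY : ∀ i < ℓ, Y ∣ G i) :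
    Y ^ ℓ ∣ F := by
  rw [eq_sum_pow_char hℓ h]
  exact Finset.dvd_sum fun i hi => (pow_dvd_pow_of_dvd (hY i (Finset.mem_range.1 hi)) ℓ).mul_left _

/-- Writing the cofactor of `Y ^ ℓ` as `∑ X ^ i * Q i ^ ℓ` gives `F = ∑ X ^ i * (Y * Q i) ^ ℓ`. As
`ℓ`-th roots are unique, `G i = Y * Q i`. -/
theorem dvd_of_pow_char_dvd (hℓ : ℓ.Prime) (hsurj : Function.Surjective fun a : K => a ^ ℓ)
    {F Y : K[X]} {G : ℕ → K[X]} (h : ∀ i < ℓ, ∀ j, (G i).coeff j ^ ℓ = F.coeff (ℓ * j + i))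
    (hY : Y ^ ℓ ∣ F) {i : ℕ} (hi : i < ℓ) : Y ∣ G i := by
  have : ExpChar K ℓ := ExpChar.prime hℓ
  obtain ⟨q, hq⟩ := hY
  choose ρ hρ using hsurj
  let Q : ℕ → K[X] := fun i => polyOf (q.natDegree + 1) fun j => ρ (q.coeff (ℓ * j + i))
  have hQ : ∀ i < ℓ, ∀ j, (Q i).coeff j ^ ℓ = q.coeff (ℓ * j + i) := by
    intro i _ j
    simp only [Q]
    rw [coeff_polyOf]
    split_ifs with hj
    · exact hρ _
    · rw [zero_pow hℓ.ne_zero, coeff_eq_zero_of_natDegree_lt]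
      have : 1 * j ≤ ℓ * j := Nat.mul_le_mul_right _ hℓ.one_le
      omega
  have hF : F = ∑ i ∈ Finset.range ℓ, X ^ i * (Y * Q i) ^ ℓ := by
    conv_lhs => rw [hq, eq_sum_pow_char hℓ hQ, Finset.mul_sum]
    exact Finset.sum_congr rfl fun i _ => by rw [mul_pow]; ring
  refine ⟨Q i, ?_⟩
  ext j
  have h1 := h i hi j
  rw [hF, coeff_sum_pow_char hℓ _ hi] at h1
  exact frobenius_inj K ℓ h1

theorem derivative_ne_zero_of_perfect (hℓ : ℓ.Prime)
    (hsurj : Function.Surjective fun a : K => a ^ ℓ) {φ : K[X]} (hφ : Irreducible φ) :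
    derivative φ ≠ 0 := by
  have : ExpChar K ℓ := ExpChar.prime hℓ
  have : PerfectRing K ℓ := PerfectRing.ofSurjective K ℓ hsurj
  have : PerfectField K := PerfectRing.toPerfectField K ℓ
  intro h0
  have h1 := PerfectField.separable_of_irreducible hφ
  rw [Separable, h0, isCoprime_zero_right] at h1
  exact hφ.not_isUnit h1

/-- If `φ` did not divide `Q`, its full power in `F` would divide `H`, hence `Y`, and the `n`-th
power of that would still divide `F`. -/
theorem dvd_quotient {F H Q Y φ : K[X]} (hF : F ≠ 0) (hφ : Irreducible φ) (hφF : φ ∣ F)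
    {n : ℕ} (hn : 2 ≤ n) (hQH : Q * H = F) (hHY : H ∣ Y) (hYF : Y ^ n ∣ F) : φ ∣ Q := by
  by_contra hQ
  have hfin : FiniteMultiplicity φ F := FiniteMultiplicity.of_prime_left hφ.prime hF
  obtain ⟨m, h1, h2⟩ : ∃ m, φ ^ m ∣ F ∧ ¬ φ ^ (m + 1) ∣ F :=
    ⟨_, pow_multiplicity_dvd _ _, hfin.not_pow_dvd_of_multiplicity_lt (Nat.lt_succ_self _)⟩
  have hm : 1 ≤ m := by
    by_contra h
    obtain rfl : m = 0 := by omega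
    exact h2 (by simpa using hφF)
  have h3 : φ ^ m ∣ H :=
    (((hφ.coprime_iff_not_dvd).2 hQ).pow_left).dvd_of_dvd_mul_left (by rwa [hQH])
  have h4 := (pow_dvd_pow_of_dvd (h3.trans hHY) n).trans hYF
  rw [← pow_mul] at h4
  exact h2 ((pow_dvd_pow φ (by nlinarith)).trans h4)

end RepeatedFactors

/-! ### Singularity at a given factor. -/

section Singular

variable {A : Type u} [CommRing A]

/-- `f` lies in the square of the ideal generated by `p` and a lift of `φ`. -/
def SingularAt (p : A) (f : A[X]) (φ : (Residue p)[X]) : Prop :=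
  ∃ φ' a b c : A[X], φ'.map (Ideal.Quotient.mk (Ideal.span {p})) = φ ∧
    f = C p ^ 2 * a + C p * φ' * b + φ' ^ 2 * c

theorem isSingular_iff {p : A} {f : A[X]} :
    IsSingular p f ↔ ∃ φ, Irreducible φ ∧ SingularAt p f φ := by
  constructor
  · rintro ⟨φ, a, b, c, h, e⟩
    exact ⟨_, h, φ, a, b, c, rfl, e⟩
  · rintro ⟨_, h, φ, a, b, c, rfl, e⟩
    exact ⟨φ, a, b, c, h, e⟩

/-- The ideal `(p, φ')` depends only on `φ' mod p`, and it grows when `φ` is replaced by a divisor.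
-/
theorem SingularAt.of_dvd [IsDomain A] {p : A} {f : A[X]} {φ ψ : (Residue p)[X]} (h : SingularAt p f φ)
    {ψ' : A[X]} (hψ' : ψ'.map (Ideal.Quotient.mk (Ideal.span {p})) = ψ) (hψ : ψ ∣ φ) :
    ∃ a b c : A[X], f = C p ^ 2 * a + C p * ψ' * b + ψ' ^ 2 * c := by
  obtain ⟨φ', a, b, c, rfl, e⟩ := h
  obtain ⟨z, t, ht⟩ := eq_of_map_dvd (φ := ψ') (v := φ') (by rwa [hψ'])
  refine ⟨a + z * b + z ^ 2 * c, t * b + 2 * z * t * c, t ^ 2 * c, ?_⟩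
  rw [e, ht]
  ring

theorem map_C_self (p : A) : (C p).map (Ideal.Quotient.mk (Ideal.span {p})) = 0 :=
  map_mk_eq_zero_iff.2 dvd_rfl

theorem SingularAt.sq_dvd {p : A} {f : A[X]} {φ : (Residue p)[X]} (h : SingularAt p f φ) :
    φ ^ 2 ∣ f.map (Ideal.Quotient.mk (Ideal.span {p})) := by
  obtain ⟨φ', a, b, c, rfl, rfl⟩ := h
  simp only [Polynomial.map_add, Polynomial.map_mul, Polynomial.map_pow, map_C_self]
  simp

/-- Since `g * h` is in `(p, φ)²`, the question is when `p * r` is. If `p * r = p²α + pφβ + φ²γ`,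
reduction modulo `p` shows `p ∣ γ`, and cancelling `p` puts `r` into `(p, φ)`. -/
theorem singularAt_iff_dvd [IsDomain A] {p : A} (hp : p ≠ 0) [IsDomain (Residue p)]
    {f g h r : A[X]} (e : f = g * h + C p * r) {φ : (Residue p)[X]} (hφ : φ ≠ 0)
    (hg : φ ∣ g.map (Ideal.Quotient.mk (Ideal.span {p})))
    (hh : φ ∣ h.map (Ideal.Quotient.mk (Ideal.span {p}))) :
    SingularAt p f φ ↔ φ ∣ r.map (Ideal.Quotient.mk (Ideal.span {p})) := by
  obtain ⟨φ, rfl⟩ := map_mk_surjective p φ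
  simp only at *
  obtain ⟨a₁, b₁, rfl⟩ := eq_of_map_dvd hg
  obtain ⟨a₂, b₂, rfl⟩ := eq_of_map_dvd hh
  constructor
  · intro hs
    obtain ⟨a, b, c, e'⟩ := hs.of_dvd rfl dvd_rfl
    have h1 : C p * (r - (C p * (a - a₁ * a₂) + φ * (b - a₁ * b₂ - a₂ * b₁))) =
        φ ^ 2 * (c - b₁ * b₂) := by linear_combination e' - e
    have h2 : C p ∣ c - b₁ * b₂ := by
      rw [← map_mk_eq_zero_iff]
      have h3 := congrArg (Polynomial.map (Ideal.Quotient.mk (Ideal.span {p}))) h1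
      rw [Polynomial.map_mul, map_C_self, zero_mul, Polynomial.map_mul, Polynomial.map_pow] at h3
      exact (mul_eq_zero.1 h3.symm).resolve_left (pow_ne_zero _ hφ)
    obtain ⟨z, hz⟩ := h2
    have h3 : r = C p * (a - a₁ * a₂) + φ * (b - a₁ * b₂ - a₂ * b₁ + φ * z) := by
      refine mul_left_cancel₀ (C_ne_zero.2 hp) ?_
      rw [hz] at h1
      linear_combination h1
    rw [h3, Polynomial.map_add, Polynomial.map_mul, map_C_self, zero_mul, zero_add,
      Polynomial.map_mul]
    exact dvd_mul_right _ _
  · intro hr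
    obtain ⟨a₃, b₃, rfl⟩ := eq_of_map_dvd hr
    exact ⟨φ, a₁ * a₂ + a₃, a₁ * b₂ + a₂ * b₁ + b₃, b₁ * b₂, rfl, by rw [e]; ring⟩

/-- Here `f ∈ (p, X)²` means `p² ∣ f(0)`, that is, `f(0)` and `0` have the same two digits. -/
theorem singularAt_X_iff [IsDomain A] {p : A} (hp : p ≠ 0) {s : Residue p → A}
    (hs : IsRepresentatives p s) {f : A[X]} (h0 : residue p (f.coeff 0) = 0)
    (h1 : residue p (f.coeff 1) = 0) :
    SingularAt p f X ↔ secondDigit p s (f.coeff 0) = secondDigit p s 0 := by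
  obtain ⟨e, he⟩ := exists_eq_add_mul hs (f.coeff 0)
  obtain ⟨e', he'⟩ := exists_eq_add_mul hs (0 : A)
  rw [secondDigit_eq hp he, secondDigit_eq hp he', ← sub_eq_zero, ← residue_sub,
    Ideal.Quotient.eq_zero_iff_mem, Ideal.mem_span_singleton]
  rw [h0] at he
  rw [residue_zero] at he'
  have h2 : f.coeff 0 = p * (e - e') := by linear_combination he - he'
  constructor
  · intro h
    obtain ⟨a, b, c, h3⟩ := h.of_dvd (ψ' := X) (map_X _) dvd_rfl
    have h4 := congrArg (fun q => q.coeff 0) h3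
    simp only [coeff_add, pow_two, mul_coeff_zero, coeff_C_zero, coeff_X_zero] at h4
    refine ⟨a.coeff 0, mul_left_cancel₀ hp ?_⟩
    rw [← h2, h4]; ring
  · rintro ⟨t, ht⟩
    obtain ⟨t', ht'⟩ : p ∣ f.coeff 1 := by
      rwa [Ideal.Quotient.eq_zero_iff_mem, Ideal.mem_span_singleton] at h1
    refine ⟨X, C t, C t', divX (divX f), map_X _, ?_⟩
    have h3 := divX_mul_X_add f
    have h4 := divX_mul_X_add (divX f)
    rw [h2, ht, C_mul, C_mul] at h3
    rw [coeff_divX, zero_add, ht', C_mul] at h4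
    linear_combination -h3 - X * h4

end Singular

/-! ### Searches whose branches share one cost bound. -/

section Loops

variable {E : Type*} {k : E → Type*} [∀ e, Zero (k e)]
  {ops : Set ((∀ e, k e) → (∀ e, k e) → ∀ e, k e)} {P : E → Prop} {c : ℕ} {D : Set E}
  {S : Set (∀ e, k e)}

theorem Decides.firstNonzero (n : ℕ) (x : ℕ → ∀ e, k e) (hx : ∀ i < n, x i ∈ S)
    (h : ∀ i < n, Decides ops P c (D ∩ {e | (∀ j < i, x j e = 0) ∧ x i e ≠ 0}) S)
    (h' : Decides ops P c (D ∩ {e | ∀ j < n, x j e = 0}) S) : Decides ops P (n + c) D S := by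
  suffices H : ∀ m ≤ n, Decides ops P (m + c) (D ∩ {e | ∀ j < n - m, x j e = 0}) S by
    simpa using H n le_rfl
  intro m hm
  induction m with
  | zero => simpa using h'
  | succ m ih =>
    rw [Nat.add_right_comm]
    refine .test (hx (n - (m + 1)) (by omega)) ?_ ?_
    · have := ih (by omega)
      convert this using 1
      ext e
      simp only [Set.mem_inter_iff, Set.mem_ofPred_eq, and_assoc]
      refine and_congr_right fun _ => ⟨fun h j hj => ?_, fun h => ⟨fun j hj => h j (by omega),
        h _ (by omega)⟩⟩
      rcases Nat.lt_or_ge j (n - (m + 1)) with h1 | h1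
      · exact h.1 j h1
      · obtain rfl : j = n - (m + 1) := by omega
        exact h.2
    · refine (h (n - (m + 1)) (by omega)).mono (c' := m + c) (by omega) |> fun H => ?_
      convert H using 1
      ext e
      simp only [Set.mem_inter_iff, Set.mem_ofPred_eq, and_assoc]

theorem Decides.firstZero (n : ℕ) (x : ℕ → ∀ e, k e) (hx : ∀ i < n, x i ∈ S)
    (h : ∀ i < n, Decides ops P c (D ∩ {e | (∀ j < i, x j e ≠ 0) ∧ x i e = 0}) S)
    (h' : Decides ops P c (D ∩ {e | ∀ j < n, x j e ≠ 0}) S) : Decides ops P (n + c) D S := by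
  suffices H : ∀ m ≤ n, Decides ops P (m + c) (D ∩ {e | ∀ j < n - m, x j e ≠ 0}) S by
    simpa using H n le_rfl
  intro m hm
  induction m with
  | zero => simpa using h'
  | succ m ih =>
    rw [Nat.add_right_comm]
    refine .test (hx (n - (m + 1)) (by omega)) ?_ ?_
    · refine (h (n - (m + 1)) (by omega)).mono (c' := m + c) (by omega) |> fun H => ?_
      convert H using 1
      ext e
      simp only [Set.mem_inter_iff, Set.mem_ofPred_eq, and_assoc]
    · have := ih (by omega)
      convert this using 1
      ext e
      simp only [Set.mem_inter_iff, Set.mem_ofPred_eq, and_assoc]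
      refine and_congr_right fun _ => ⟨fun h j hj => ?_, fun h => ⟨fun j hj => h j (by omega),
        h _ (by omega)⟩⟩
      rcases Nat.lt_or_ge j (n - (m + 1)) with h1 | h1
      · exact h.1 j h1
      · obtain rfl : j = n - (m + 1) := by omega
        exact h.2

end Loops

/-! ### Iterated gcds. -/

section ManyGcds

/-- The greatest common divisor of several polynomials, the first one with a nonzero constant
coefficient. -/
theorem Decides.gcdMany.{u₁, u₂} {E : Type u₁} {k : E → Type u₂} [∀ e, Field (k e)]
    {ops : Set ((∀ e, k e) → (∀ e, k e) → ∀ e, k e)} (ho : ringOps (∀ e, k e) ⊆ ops)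
    (hi : (fun x _ e => (x e)⁻¹) ∈ ops) {P : E → Prop}
    {B : ℕ} (hB : FastMul.{max u₁ u₂} B) {N : ℕ} {c : ℕ} {D : Set E} (n : ℕ)
    {S : Set (∀ e, k e)} {G : ℕ → (∀ e, k e)[X]} (dG : ∀ i ≤ n, (G i).natDegree < N)
    (kG : ∀ i ≤ n, Known S (G i)) (hG : ∀ e ∈ D, (G 0).coeff 0 e ≠ 0)
    (next : ∀ D' ⊆ D, ∀ S', S ⊆ S' → ∀ (Y : (∀ e, k e)[X]), Y.natDegree < N → Known S' Y →
      (∀ e ∈ D', Y.coeff 0 e ≠ 0 ∧ (∀ i ≤ n, sp e Y ∣ sp e (G i)) ∧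
        ∀ q, (∀ i ≤ n, q ∣ sp e (G i)) → q ∣ sp e Y) →
      Decides ops P c D' S') :
    Decides ops P (n * gcdCost B N + c) D S := by
  induction n generalizing c with
  | zero =>
    rw [zero_mul, zero_add]
    refine next D subset_rfl S subset_rfl (G 0) (dG 0 le_rfl) (kG 0 le_rfl) fun e he =>
      ⟨hG e he, fun i hi => ?_, fun q hq => hq 0 le_rfl⟩
    obtain rfl : i = 0 := by omega
    exact dvd_rfl
  | succ n ih =>
    rw [add_mul, one_mul, add_assoc]
    refine ih (fun i hi => dG i (by omega)) (fun i hi => kG i (by omega))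
      fun D₁ hD₁ S₁ hS₁ Y dY kY hY => ?_
    refine Decides.gcd ho hi hB dY (dG (n + 1) le_rfl) kY ((kG (n + 1) le_rfl).mono hS₁)
      (fun e he => (hY e he).1) fun D₂ hD₂ S₂ hS₂ H Q dH _ kH _ hH => ?_
    refine next D₂ (hD₂.trans hD₁) S₂ (hS₁.trans hS₂) H dH kH fun e he => ?_
    obtain ⟨h1, h2, h3⟩ := hY e (hD₂ he)
    obtain ⟨h4, h5, h6⟩ := hH e he
    have h7 : sp e H ∣ sp e Y := Dvd.intro_left _ h4
    refine ⟨fun h0 => h1 ?_, fun i hi => ?_, fun q hq => h6 q (h3 q fun i hi => hq i (by omega))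
      (hq _ le_rfl)⟩
    · rw [← coeff_sp, ← h4, mul_coeff_zero, coeff_sp e H, h0, mul_zero]
    · rcases Nat.lt_or_ge n i with h8 | h8
      · obtain rfl : i = n + 1 := by omega
        exact h5
      · exact h7.trans (h2 i h8)

end ManyGcds
end IndexTest

universe v
namespace IndexTest

/-! ### Testing all common factors of one factorization. -/

section Algorithm

/-- The residue field. -/
noncomputable abbrev residueField {A : Type u} [CommRing A] (p : A)
    [(Ideal.span {p}).IsMaximal] : Field (Residue p) :=
  Ideal.Quotient.field _

attribute [local instance] residueField

/-- This performs the division by `p` that extracts `r` from `f - g * h`; the second digit of `0`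
corrects for an arbitrary representative of `0`. -/
theorem secondDigit_mul_self {A : Type u} [CommRing A] [IsDomain A] {p : A} (hp : p ≠ 0)
    {s : Residue p → A} (hs : IsRepresentatives p s) (x : A) :
    secondDigit p s (p * x) - secondDigit p s 0 = residue p x := by
  obtain ⟨e, he⟩ := exists_eq_add_mul hs (p * x)
  obtain ⟨e', he'⟩ := exists_eq_add_mul hs (0 : A)
  rw [secondDigit_eq hp he, secondDigit_eq hp he', ← residue_sub]
  rw [residue_mul, residue_self, zero_mul] at he
  rw [residue_zero] at he'
  congr 1
  exact mul_left_cancel₀ hp (by linear_combination he' - he)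

variable {E : Type v} {A : E → Type u} [∀ e, CommRing (A e)] {p : ∀ e, A e} {s : ∀ e, Residue (p e) → A e} {f : ∀ e, (A e)[X]} {d : ℕ}
  {R : Set Instr}

variable (p s f d R) in
/-- The standing assumptions. -/
structure Setting : Prop where
  ne_zero : ∀ e, p e ≠ 0
  repr : ∀ e, IsRepresentatives (p e) (s e)
  instr : ∀ o, o ≠ Instr.root → o ∈ R
  monic : ∀ e, (f e).Monic
  natDegree : ∀ e, (f e).natDegree = d

variable (p s f) in
/-- The constants and the digits of the coefficients of `f` are available. -/
structure Prepared (S : Set (∀ e, Residue (p e))) : Prop where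
  zero : 0 ∈ S
  one : 1 ∈ S
  hi_zero : hi p s 0 ∈ S
  lo_coeff : ∀ i, lo p (fun e => (f e).coeff i) ∈ S
  hi_coeff : ∀ i, hi p s (fun e => (f e).coeff i) ∈ S

theorem Prepared.mono {S S' : Set (∀ e, Residue (p e))} (h : Prepared p s f S) (hS : S ⊆ S') :
    Prepared p s f S' :=
  ⟨hS h.zero, hS h.one, hS h.hi_zero, fun i => hS (h.lo_coeff i), fun i => hS (h.hi_coeff i)⟩

variable [∀ e, (Ideal.span {p e}).IsMaximal]

theorem inv_mem_instrOps (hR : ∀ o, o ≠ Instr.root → o ∈ R) :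
    (fun x _ e => (x e)⁻¹) ∈ instrOps p s R :=
  ⟨.inv, hR _ (by simp), by
    ext x y e
    exact (Ring.inverse_eq_inv (x e)).symm⟩

variable [∀ e, IsDomain (A e)]

/-- The cost of testing one factorization. -/
def testCost (B d : ℕ) : ℕ :=
  6 * (soft B 7 (d + 1) + (2 * d + 2)) + ((2 * d + 2) + (gcdCost B (d + 1) +
    (gcdCost B (2 * d + 2) + (2 * d + 2))))

/-- Given a factorization of `f` modulo `p` into `g` and `h`, decide whether `f` is singular at a
common factor of `g` and `h`. -/
theorem Decides.singularTest (st : Setting p s f d R) {B : ℕ} (hB : FastMul.{max u v} B)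
    {D : Set E} {S : Set (∀ e, Residue (p e))} {c : ℕ} (pr : Prepared p s f S)
    {g h : (∀ e, Residue (p e))[X]} (dg : g.natDegree < d + 1) (dh : h.natDegree < d + 1)
    (kg : Known S g) (kh : Known S h) (hg : ∀ e ∈ D, g.coeff 0 e ≠ 0)
    (hgh : ∀ e ∈ D, sp e g * sp e h = (f e).map (Ideal.Quotient.mk (Ideal.span {p e})))
    (next : ∀ D' ⊆ D, ∀ S', S ⊆ S' → (∀ e ∈ D', ∀ φ, Irreducible φ → φ ∣ sp e g → φ ∣ sp e h →
      ¬ SingularAt (p e) (f e) φ) →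
      Decides (instrOps p s R) (fun e => IsSingular (p e) (f e)) c D' S') :
    Decides (instrOps p s R) (fun e => IsSingular (p e) (f e)) (testCost B d + c) D S := by
  have ho := ringOps_subset_instrOps (p := p) (s := s) st.instr
  have hi' := inv_mem_instrOps (p := p) (s := s) st.instr
  have hd1 : 0 < d + 1 := by omega
  -- Coefficients are lifted to their representatives, whose second digit is zero, so both digits of
  -- the lift are known for free.
  let lift : (∀ e, Residue (p e))[X] → (∀ e, A e)[X] := fun g =>
    polyOf (d + 1) fun i e => s e (g.coeff i e)
  let SW : Set (∀ e, A e) := {w | lo p w ∈ S ∧ hi p s w ∈ S}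
  have k0 : (0 : ∀ e, A e) ∈ SW := ⟨pr.zero, pr.hi_zero⟩
  have klift : ∀ g, Known S g → Known SW (lift g) := fun g kg => .polyOf k0 fun i _ => by
    constructor
    · convert kg i using 1
      ext e
      exact st.repr e _
    · convert pr.zero using 1
      ext e
      exact secondDigit_repr (st.ne_zero e) (st.repr e) _
  have dlift : ∀ g, (lift g).natDegree < d + 1 := fun g => natDegree_polyOf_lt hd1 _
  have mlift : ∀ e (g : (∀ e, Residue (p e))[X]), g.natDegree < d + 1 →
      (sp e (lift g)).map (Ideal.Quotient.mk (Ideal.span {p e})) = sp e g := by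
    intro e g dg
    ext i
    rw [coeff_map, coeff_sp, coeff_sp, coeff_polyOf]
    split_ifs with hi
    · exact st.repr e _
    · rw [coeff_eq_zero_of_natDegree_lt (show g.natDegree < i by omega)]
      exact map_zero _
  set fW : (∀ e, A e)[X] := polyOf (d + 1) fun i e => (f e).coeff i with hfW
  have dfW : fW.natDegree < d + 1 := natDegree_polyOf_lt hd1 _
  have kfW : Known SW fW := .polyOf k0 fun i _ => ⟨pr.lo_coeff i, pr.hi_coeff i⟩
  have mfW : ∀ e, sp e fW = f e := by
    intro e
    ext i
    rw [coeff_sp, coeff_polyOf]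
    split_ifs with hi
    · rfl
    · rw [coeff_eq_zero_of_natDegree_lt (by rw [st.natDegree]; omega)]
      rfl
  set r₀ := fW - lift g * lift h with hr₀
  have dr₀ : ∀ i, 2 * d + 2 ≤ i → r₀.coeff i = 0 := by
    intro i hi
    have h1 := natDegree_mul_lt (dlift g) (dlift h)
    rw [hr₀, coeff_sub, coeff_eq_zero_of_natDegree_lt (by omega),
      coeff_eq_zero_of_natDegree_lt (by omega), sub_zero]
  have h1 : Comp (ringOps (∀ e, A e)) (Set.range r₀.coeff) (soft B 7 (d + 1) + (2 * d + 2)) SW := by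
    refine (Comp.polyMul subset_rfl (hB (d + 1) (by omega)) (dlift g) (dlift h) (klift g kg)
      (klift h kh)).bind fun S₁ hS₁ hT₁ => ?_
    refine (Comp.polyOp (N := 2 * d + 2) (c := 1) (fun i _ => ?_) (fun i hi => ?_) ?_).mono
      subset_rfl (by omega) subset_rfl
    · rw [hr₀, coeff_sub]
      exact .sub subset_rfl (hS₁ (kfW i)) (hT₁ ⟨i, rfl⟩)
    · rw [dr₀ i hi, dr₀ _ le_rfl]
    · rw [dr₀ _ le_rfl]
      exact hS₁ k0
  have h2 := h1.simulate (p := p) (s := s) st.ne_zero st.repr st.instr (S := S)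
    (fun w hw => hw.1) (fun w hw => hw.2)
  rw [testCost, add_assoc]
  refine h2.decides fun S₁ hS₁ hT₁ => ?_
  have h3 := Comp.forall_mem (ops := instrOps p s R) (S := S₁) (c := 1)
    (T := {x | ∃ i < 2 * d + 2, x = hi p s (r₀.coeff i) - hi p s 0})
    (Finset.range (2 * d + 2)) (v := fun i => hi p s (r₀.coeff i) - hi p s 0)
    (fun i _ => .sub ho (hT₁ (.inr ⟨_, ⟨i, rfl⟩, rfl⟩)) (hS₁ pr.hi_zero))
    (by rintro _ ⟨i, hi, rfl⟩; exact ⟨i, by simpa, rfl⟩)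
  rw [Finset.card_range, mul_one] at h3
  rw [add_assoc]
  refine h3.decides fun S₂ hS₂ hT₂ => ?_
  set r := polyOf (2 * d + 2) fun i => hi p s (r₀.coeff i) - hi p s 0 with hr
  have dr : r.natDegree < 2 * d + 2 := natDegree_polyOf_lt (by omega) _
  have kr : Known S₂ r := .polyOf (hS₂ (hS₁ pr.zero)) fun i hi => hT₂ ⟨i, hi, rfl⟩
  have key : ∀ e ∈ D, ∀ φ, Irreducible φ → φ ∣ sp e g → φ ∣ sp e h →
      (SingularAt (p e) (f e) φ ↔ φ ∣ sp e r) := by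
    intro e he φ hφ hφg hφh
    obtain ⟨ρ, hρ⟩ : C (p e) ∣ f e - sp e (lift g) * sp e (lift h) := by
      rw [← map_mk_eq_iff, Polynomial.map_mul, mlift e g dg, mlift e h dh, hgh e he]
    have hρ' : ∀ i, r₀.coeff i e = p e * ρ.coeff i := by
      intro i
      have h4 : sp e r₀ = f e - sp e (lift g) * sp e (lift h) := by
        rw [hr₀, ← sp_mul, ← mfW e]
        exact Polynomial.map_sub _
      rw [← coeff_sp, h4, hρ, coeff_C_mul]
    have hρr : ρ.map (Ideal.Quotient.mk (Ideal.span {p e})) = sp e r := by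
      ext i
      rw [coeff_map, coeff_sp, hr, coeff_polyOf]
      split_ifs with hi
      · change residue (p e) _ = secondDigit _ _ (r₀.coeff i e) - secondDigit _ _ 0
        rw [hρ', secondDigit_mul_self (st.ne_zero e) (st.repr e)]
      · have h4 := hρ' i
        rw [dr₀ i (by omega), Pi.zero_apply, zero_eq_mul] at h4
        rw [h4.resolve_left (st.ne_zero e)]
        exact map_zero _
    rw [← hρr]
    refine singularAt_iff_dvd (st.ne_zero e) (g := sp e (lift g)) (h := sp e (lift h))
      (by rw [← hρ]; ring) hφ.ne_zero ?_ ?_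
    · rwa [mlift e g dg]
    · rwa [mlift e h dh]
  have hS₀₂ := hS₁.trans hS₂
  rw [add_assoc]
  refine Decides.gcd ho hi' hB dg dh (kg.mono hS₀₂) (kh.mono hS₀₂) hg
    fun D₃ hD₃ S₃ hS₃ H₁ Q₁ dH₁ _ kH₁ _ hH₁ => ?_
  have hH₁0 : ∀ e ∈ D₃, H₁.coeff 0 e ≠ 0 := by
    intro e he h0
    apply hg e (hD₃ he)
    rw [← coeff_sp, ← (hH₁ e he).1, mul_coeff_zero, coeff_sp e H₁, h0, mul_zero]
  rw [add_assoc]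
  refine Decides.gcd ho hi' hB (dH₁.trans_le (show d + 1 ≤ 2 * d + 2 by omega)) dr kH₁
    (kr.mono hS₃) hH₁0 fun D₄ hD₄ S₄ hS₄ H Q dH _ kH _ hH => ?_
  have hcommon : ∀ e ∈ D₄, ∀ φ, φ ∣ sp e H → φ ∣ sp e g ∧ φ ∣ sp e h ∧ φ ∣ sp e r := by
    intro e he φ hφ
    have h4 : φ ∣ sp e H₁ := hφ.trans (Dvd.intro_left _ (hH e he).1)
    exact ⟨h4.trans (Dvd.intro_left _ (hH₁ e (hD₄ he)).1), h4.trans (hH₁ e (hD₄ he)).2.1,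
      hφ.trans (hH e he).2.1⟩
  -- `H` is the gcd of `g`, `h` and `r`. A nonzero coefficient of positive index means an
  -- irreducible common factor, at which `f` is singular.
  refine Decides.firstNonzero (2 * d + 2) (fun i => H.coeff (i + 1)) (fun i _ => kH _)
    (fun i _ => .yes ?_) ?_
  · rintro e ⟨he, -, hne⟩
    have hpos : 0 < (sp e H).natDegree := by
      have : i + 1 ≤ (sp e H).natDegree := le_natDegree_of_ne_zero (by rwa [coeff_sp])
      omega
    obtain ⟨φ, hφ, hφH⟩ := exists_irreducible_of_natDegree_pos hpos
    obtain ⟨h4, h5, h6⟩ := hcommon e he φ hφH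
    exact isSingular_iff.2 ⟨φ, hφ, (key e (hD₃ (hD₄ he)) φ hφ h4 h5).2 h6⟩
  · refine next _ ((Set.inter_subset_left.trans hD₄).trans hD₃) S₄ ((hS₀₂.trans hS₃).trans hS₄) ?_
    rintro e ⟨he, hz⟩ φ hφ hφg hφh hsing
    have h4 := (key e (hD₃ (hD₄ he)) φ hφ hφg hφh).1 hsing
    have h5 : φ ∣ sp e H := (hH e he).2.2 φ ((hH₁ e (hD₄ he)).2.2 φ hφg hφh) h4
    have h6 : sp e H = C (H.coeff 0 e) := by
      ext i
      rw [coeff_sp, coeff_C]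
      split_ifs with hi
      · rw [hi]
      · obtain ⟨i, rfl⟩ := Nat.exists_eq_succ_of_ne_zero hi
        by_cases hlt : i < 2 * d + 2
        · exact hz i hlt
        · rw [coeff_eq_zero_of_natDegree_lt (by omega)]
          rfl
    have h7 : sp e H ≠ 0 := by
      intro h0
      apply hH₁0 e (hD₄ he)
      rw [← coeff_sp, ← (hH e he).1, h0, mul_zero, coeff_zero]
    rw [h6] at h5 h7
    exact hφ.not_isUnit (isUnit_of_dvd_unit h5 (isUnit_C.2 (C_ne_zero.1 h7).isUnit))

end Algorithm

/-! ### The complete decision procedure. -/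

section Index

attribute [local instance] residueField

theorem Comp.natCasts {V : Type*} [CommRing V] {ops : Set (V → V → V)} {S : Set V}
    (ho : ringOps V ⊆ ops) (h0 : 0 ∈ S) (h1 : 1 ∈ S) (n : ℕ) :
    Comp ops {x | ∃ i ≤ n, x = (i : V)} n S := by
  induction n with
  | zero =>
    refine .done ?_
    rintro _ ⟨i, hi, rfl⟩
    obtain rfl : i = 0 := by omega
    simpa
  | succ n ih =>
    refine ih.bind fun S' hS hT => ?_
    refine ((Comp.add ho (hT ⟨n, le_rfl, rfl⟩) (hS h1)).keep).mono subset_rfl le_rfl ?_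
    rintro _ ⟨i, hi, rfl⟩
    rcases Nat.lt_or_ge n i with h | h
    · obtain rfl : i = n + 1 := by omega
      exact .inr (by simp)
    · exact .inl (hT ⟨i, h, rfl⟩)

variable {E : Type v} {A : E → Type u} [∀ e, CommRing (A e)] {p : ∀ e, A e}
  [∀ e, (Ideal.span {p e}).IsMaximal] {s : ∀ e, Residue (p e) → A e} {f : ∀ e, (A e)[X]} {d : ℕ}
  {R : Set Instr}

theorem sp_polyOf_X_pow_mul {a : ℕ} {H : (∀ e, Residue (p e))[X]} {e : E} {g : (Residue (p e))[X]}
    (st : Setting p s f d R)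
    (h : g * (X ^ a * sp e H) = (f e).map (Ideal.Quotient.mk (Ideal.span {p e}))) :
    sp e (polyOf (d + 1) (X ^ a * H).coeff) = X ^ a * sp e H := by
  have hm : ((f e).map (Ideal.Quotient.mk (Ideal.span {p e}))).Monic := (st.monic e).map _
  have hd : (X ^ a * sp e H).natDegree ≤ d := by
    rw [← st.natDegree e, ← (st.monic e).natDegree_map (Ideal.Quotient.mk (Ideal.span {p e}))]
    exact natDegree_le_of_dvd (Dvd.intro_left _ h) hm.ne_zero
  ext i
  rw [coeff_sp, coeff_polyOf]
  split_ifs with hi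
  · rw [coeff_X_pow_mul', coeff_X_pow_mul']
    split_ifs
    · rw [coeff_sp]
    · rfl
  · rw [coeff_eq_zero_of_natDegree_lt (p := X ^ a * sp e H) (by omega)]
    rfl

theorem known_polyOf_X_pow_mul {V : Type*} [CommRing V] {S : Set V} {H : V[X]} (h : Known S H)
    (N a : ℕ) : Known S (polyOf N (X ^ a * H).coeff) := by
  refine .polyOf h.zero_mem fun i _ => ?_
  rw [coeff_X_pow_mul']
  split_ifs
  exacts [h _, h.zero_mem]

variable [∀ e, IsDomain (A e)]

/-- Deciding whether `f` is singular at `X`. -/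
theorem Decides.singularAtX (st : Setting p s f d R) {D : Set E} {S : Set (∀ e, Residue (p e))}
    {c a : ℕ} (pr : Prepared p s f S) {F : (∀ e, Residue (p e))[X]}
    (hF : ∀ e ∈ D, F.coeff 0 e ≠ 0)
    (hfac : ∀ e ∈ D, X ^ a * sp e F = (f e).map (Ideal.Quotient.mk (Ideal.span {p e})))
    (next : ∀ D' ⊆ D, ∀ S', S ⊆ S' → (∀ e ∈ D', ¬ SingularAt (p e) (f e) X) →
      Decides (instrOps p s R) (fun e => IsSingular (p e) (f e)) c D' S') :
    Decides (instrOps p s R) (fun e => IsSingular (p e) (f e)) (2 + c) D S := by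
  rcases Nat.lt_or_ge a 2 with ha | ha
  · refine (next D subset_rfl S subset_rfl fun e he h => hF e he ?_).mono (by omega)
    have h1 := (pow_dvd_pow X (show a + 1 ≤ 2 by omega)).trans h.sq_dvd
    rw [← hfac e he, pow_succ, mul_dvd_mul_iff_left (pow_ne_zero _ X_ne_zero), X_dvd_iff,
      coeff_sp] at h1
    exact h1
  · have h1 : ∀ e ∈ D, (SingularAt (p e) (f e) X ↔
        (hi p s (fun e => (f e).coeff 0) - hi p s 0) e = 0) := by
      intro e he
      have h2 : ∀ i < 2, residue (p e) ((f e).coeff i) = 0 := by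
        intro i hi
        have h3 := congrArg (fun q => q.coeff i) (hfac e he)
        simp only [coeff_map, coeff_X_pow_mul', if_neg (show ¬ a ≤ i by omega)] at h3
        exact h3.symm
      rw [singularAt_X_iff (st.ne_zero e) (st.repr e) (h2 0 (by omega)) (h2 1 (by omega)),
        Pi.sub_apply, sub_eq_zero]
      rfl
    rw [show 2 + c = 1 + (c + 1) by omega]
    refine (Comp.sub (ringOps_subset_instrOps st.instr) (pr.hi_coeff 0) pr.hi_zero).decides
      fun S₁ hS₁ hT₁ => .test (hT₁ rfl) (.yes ?_) ?_
    · rintro e ⟨he, h0⟩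
      exact isSingular_iff.2 ⟨X, irreducible_X, (h1 e he).2 h0⟩
    · exact next _ Set.inter_subset_left S₁ hS₁ fun e he h => he.2 ((h1 e he.1).1 h)

/-- Such a `φ` is not associated to `X`, so `φ ^ 2` is prime to `X ^ a`. -/
theorem SingularAt.sq_dvd_of_not_singularAt_X {B : Type u} [CommRing B] [IsDomain B] {p : B}
    [(Ideal.span {p}).IsMaximal] {f : B[X]} {φ F : (Residue p)[X]} {a : ℕ}
    (h : SingularAt p f φ) (hφ : Irreducible φ)
    (hX : ¬ SingularAt p f X) (hF : X ^ a * F = f.map (Ideal.Quotient.mk (Ideal.span {p}))) :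
    φ ^ 2 ∣ F := by
  have h1 : ¬ φ ∣ X := fun h1 => by
    obtain ⟨x, y, z, e⟩ := h.of_dvd (ψ' := X) (map_X _)
      ((hφ.associated_of_dvd irreducible_X h1).symm.dvd)
    exact hX ⟨X, x, y, z, map_X _, e⟩
  have h2 := h.sq_dvd
  rw [← hF] at h2
  exact (((hφ.coprime_iff_not_dvd).2 h1).pow).dvd_of_dvd_mul_left h2

/-- Deciding whether `f` is singular at a factor whose multiplicity is divisible by the
characteristic `ℓ`, by means of `ℓ`-th roots. -/
theorem Decides.singularTest_of_char (st : Setting p s f d R) {B : ℕ}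
    (hB : FastMul.{max u v} B) {D : Set E} {S : Set (∀ e, Residue (p e))} {a ℓ : ℕ}
    (pr : Prepared p s f S) {F : (∀ e, Residue (p e))[X]} (dF : F.natDegree < d + 1)
    (kF : Known S F) (hF : ∀ e ∈ D, F.coeff 0 e ≠ 0)
    (hfac : ∀ e ∈ D, X ^ a * sp e F = (f e).map (Ideal.Quotient.mk (Ideal.span {p e})))
    (hℓ : ℓ.Prime) (hchar : ∀ e ∈ D, CharP (Residue (p e)) ℓ)
    {ρ : (∀ e, Residue (p e)) → ∀ e, Residue (p e)}
    (hρ : ∀ x ∈ S, Comp (instrOps p s R) {ρ x} 1 S) (hρ' : ∀ e ∈ D, ∀ x, ρ x e ^ ℓ = x e)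
    (hbad : ∀ e ∈ D, ∀ φ, Irreducible φ → SingularAt (p e) (f e) φ → φ ^ 2 ∣ sp e F ∧
      ¬ (derivative φ ≠ 0 ∧ ∀ m : ℕ, 2 ≤ m → φ ^ m ∣ sp e F → ¬ φ ^ (m + 1) ∣ sp e F →
        (m : Residue (p e)) ≠ 0)) :
    Decides (instrOps p s R) (fun e => IsSingular (p e) (f e))
      (ℓ * (d / ℓ + 1) + (ℓ * gcdCost B (d / ℓ + 1) + (gcdCost B (d + 1) + testCost B d))) D S := by
  classical
  have ho := ringOps_subset_instrOps (p := p) (s := s) st.instr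
  have hi' := inv_mem_instrOps (p := p) (s := s) st.instr
  -- The `ℓ` parts of `F` have length at most `d / ℓ + 1` each. Their gcd takes fewer than `ℓ` gcds
  -- of this length, which is softly linear in `d` whatever `ℓ` is.
  set N := d / ℓ + 1 with hN
  have hNd : N ≤ d + 1 := Nat.succ_le_succ (Nat.div_le_self _ _)
  have h1 := Comp.forall_mem (ops := instrOps p s R) (S := S) (c := 1)
    (T := {x | ∃ i < ℓ, ∃ j < N, x = ρ (F.coeff (ℓ * j + i))})
    (Finset.range ℓ ×ˢ Finset.range N) (v := fun ij => ρ (F.coeff (ℓ * ij.2 + ij.1)))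
    (fun i _ => hρ _ (kF _))
    (by rintro _ ⟨i, hi, j, hj, rfl⟩; exact ⟨(i, j), by simp [hi, hj], rfl⟩)
  rw [Finset.card_product, Finset.card_range, Finset.card_range, mul_one] at h1
  refine h1.decides fun S₁ hS₁ hT₁ => ?_
  set G : ℕ → (∀ e, Residue (p e))[X] := fun i => polyOf N fun j => ρ (F.coeff (ℓ * j + i)) with hG
  have hGF : ∀ e ∈ D, ∀ i < ℓ, ∀ j, (sp e (G i)).coeff j ^ ℓ = (sp e F).coeff (ℓ * j + i) := by
    intro e he i _ j
    rw [coeff_sp, coeff_sp, hG, coeff_polyOf]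
    split_ifs with hj
    · exact hρ' e he _
    · rw [coeff_eq_zero_of_natDegree_lt]
      · exact zero_pow hℓ.ne_zero
      · have h2 : d < ℓ * N := Nat.lt_mul_div_succ d hℓ.pos
        have h3 : ℓ * N ≤ ℓ * j := Nat.mul_le_mul_left _ (not_lt.1 hj)
        omega
  have hn : ℓ - 1 + 1 = ℓ := Nat.sub_add_cancel hℓ.one_le
  refine (Decides.gcdMany ho hi' hB (ℓ - 1) (G := G) (N := N) (S := S₁)
    (fun i _ => natDegree_polyOf_lt (Nat.succ_pos _) _)
    (fun i hi => .polyOf (hS₁ pr.zero) fun j hj => hT₁ ⟨i, by omega, j, hj, rfl⟩)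
    (c := gcdCost B (d + 1) + testCost B d) (fun e he h0 => ?_)
    fun D₂ hD₂ S₂ hS₂ Y dY kY hY => ?_).mono
    (Nat.add_le_add_right (Nat.mul_le_mul_right _ (Nat.sub_le _ _)) _)
  · have h2 := hGF e he 0 hℓ.pos 0
    rw [coeff_sp, h0, zero_pow hℓ.ne_zero, coeff_sp] at h2
    exact hF e he h2.symm
  have hS₀₂ := hS₁.trans hS₂
  refine Decides.gcd ho hi' hB dF (dY.trans_le hNd) (kF.mono hS₀₂) kY (fun e he => hF e (hD₂ he))
    fun D₃ hD₃ S₃ hS₃ H Q dH dQ kH kQ hH => ?_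
  have hfac' : ∀ e ∈ D₃, sp e Q * (X ^ a * sp e H) =
      (f e).map (Ideal.Quotient.mk (Ideal.span {p e})) := by
    intro e he
    rw [← hfac e (hD₂ (hD₃ he)), ← (hH e he).1]
    ring
  refine (Decides.singularTest (c := 0) st hB (pr.mono (hS₀₂.trans hS₃)) dQ
    (natDegree_polyOf_lt (by omega) _) kQ (known_polyOf_X_pow_mul kH (d + 1) a) (fun e he h0 => ?_)
    (fun e he => ?_) fun D₄ hD₄ S₄ hS₄ hno => .no fun e he hs => ?_)
  · apply hF e (hD₂ (hD₃ he))
    rw [← coeff_sp, ← (hH e he).1, mul_coeff_zero, coeff_sp, h0, zero_mul]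
  · rw [sp_polyOf_X_pow_mul st (hfac' e he), hfac' e he]
  · have he₃ := hD₄ he
    have he₂ := hD₃ he₃
    have he₁ := hD₂ he₂
    have := hchar e he₁
    have hsurj : Function.Surjective fun a : Residue (p e) => a ^ ℓ := fun b =>
      ⟨ρ (Pi.single e b) e, by simpa using hρ' e he₁ (Pi.single e b)⟩
    obtain ⟨φ, hφ, hsing⟩ := isSingular_iff.1 hs
    obtain ⟨h2, h3⟩ := hbad e he₁ φ hφ hsing
    have hF0 : sp e F ≠ 0 := by
      intro h0
      apply hF e he₁
      rw [← coeff_sp, h0, coeff_zero]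
    -- Over a perfect field `φ' ≠ 0`, so `φ` can escape the derivative test only through a
    -- multiplicity divisible by `ℓ`.
    have h4 : φ ^ ℓ ∣ sp e F := by
      by_contra h4
      refine h3 ⟨derivative_ne_zero_of_perfect hℓ hsurj hφ, fun m hm hmF _ h0 => h4 ?_⟩
      have h5 := (CharP.cast_eq_zero_iff (Residue (p e)) ℓ m).1 h0
      exact (pow_dvd_pow φ (Nat.le_of_dvd (by omega) h5)).trans hmF
    have hle : ∀ {i}, i < ℓ → i ≤ ℓ - 1 := by omega
    have h5 : φ ∣ sp e Y := (hY e he₂).2.2 φ fun i hi =>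
      dvd_of_pow_char_dvd (G := fun i => sp e (G i)) hℓ hsurj (hGF e he₁) h4 (by omega)
    have h6 : sp e Y ^ ℓ ∣ sp e F := pow_char_dvd (G := fun i => sp e (G i)) hℓ (hGF e he₁)
      fun i hi => (hY e he₂).2.1 i (hle hi)
    have hφF : φ ∣ sp e F := (dvd_pow_self φ two_ne_zero).trans h2
    refine hno e he φ hφ (dvd_quotient hF0 hφ hφF hℓ.two_le (hH e he₃).1 (hH e he₃).2.1 h6) ?_ hsing
    rw [sp_polyOf_X_pow_mul st (hfac' e he₃)]
    exact ((hH e he₃).2.2 φ hφF h5).mul_left _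

/-- The cost of the whole decision, if `K` bounds the cost of the `ℓ`-th roots and their gcd. -/
def indexCost (B d K : ℕ) : ℕ :=
  d + 1 + (2 + (d + (d + (gcdCost B (d + 1) + (testCost B d + (d +
    (K + (gcdCost B (d + 1) + testCost B d))))))))

/-- Deciding whether `f` is singular. -/
theorem Decides.isSingular (st : Setting p s f d R) (hd : 1 ≤ d) {B K : ℕ}
    (hB : FastMul.{max u v} B)
    (hK : ∀ ℓ, 1 ≤ ℓ → ℓ ≤ d → ℓ * (d / ℓ + 1) + ℓ * gcdCost B (d / ℓ + 1) ≤ K)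
    {ρ : (∀ e, Residue (p e)) → ∀ e, Residue (p e)}
    (hρ : ∀ S, ∀ x ∈ S, Comp (instrOps p s R) {ρ x} 1 S)
    (hρ' : ∀ e, ringChar (Residue (p e)) ≠ 0 → ringChar (Residue (p e)) ≤ d →
      ∀ x, ρ x e ^ ringChar (Residue (p e)) = x e)
    {S : Set (∀ e, Residue (p e))} (pr : Prepared p s f S) :
    Decides (instrOps p s R) (fun e => IsSingular (p e) (f e)) (indexCost B d K) Set.univ S := by
  have ho := ringOps_subset_instrOps (p := p) (s := s) st.instr
  have hi' := inv_mem_instrOps (p := p) (s := s) st.instr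
  set F₀ : ℕ → ∀ e, Residue (p e) := fun i => lo p fun e => (f e).coeff i with hF₀
  have hlt : ∀ e i, d < i → F₀ i e = 0 := by
    intro e i hi
    change residue _ ((f e).coeff i) = 0
    rw [coeff_eq_zero_of_natDegree_lt (by rw [st.natDegree]; exact hi), residue_zero]
  -- The search finds the exact power `X ^ a` in `f mod p`; the cofactor `F` then has the nonzero
  -- constant coefficient that the gcd algorithm needs. It succeeds because `f` is monic.
  refine Decides.firstNonzero (d + 1) F₀ (fun i _ => pr.lo_coeff i) (fun a ha => ?_) ?_
  swap
  · refine .no fun e he => ?_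
    have h1 : residue (p e) ((f e).coeff d) = 0 := he.2 d (by omega)
    have h2 : (f e).coeff d = 1 := by rw [← st.natDegree e]; exact st.monic e
    rw [h2, residue_one] at h1
    exact absurd h1 one_ne_zero
  generalize hD : Set.univ ∩ {e | (∀ j < a, F₀ j e = 0) ∧ F₀ a e ≠ 0} = D
  set F : (∀ e, Residue (p e))[X] := polyOf (d + 1) fun i => F₀ (a + i) with hFdef
  have dF : F.natDegree < d + 1 := natDegree_polyOf_lt (by omega) _
  have kF : Known S F := .polyOf pr.zero fun i _ => pr.lo_coeff _
  have hF : ∀ e ∈ D, F.coeff 0 e ≠ 0 := by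
    subst hD
    intro e he
    rw [hFdef, coeff_polyOf, if_pos (by omega)]
    exact he.2.2
  have hfac : ∀ e ∈ D, X ^ a * sp e F = (f e).map (Ideal.Quotient.mk (Ideal.span {p e})) := by
    subst hD
    intro e he
    ext i
    rw [coeff_X_pow_mul', coeff_map]
    split_ifs with hi
    · rw [coeff_sp, hFdef, coeff_polyOf]
      split_ifs with h1
      · rw [Nat.add_sub_cancel' hi]
        rfl
      · exact (hlt e i (by omega)).symm
    · exact (he.2.1 i (by omega)).symm
  clear hD
  refine Decides.singularAtX st pr hF hfac fun D₁ hD₁ S₁ hS₁ hX => ?_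
  have pr₁ := pr.mono hS₁
  refine (Comp.natCasts ho pr₁.zero pr₁.one d).decides fun S₂ hS₂ hT₂ => ?_
  have pr₂ := pr₁.mono hS₂
  have h1 := Comp.forall_mem (ops := instrOps p s R) (S := S₂) (c := 1)
    (T := {x | ∃ i < d, x = F.coeff (i + 1) * ((i + 1 : ℕ) : ∀ e, Residue (p e))})
    (Finset.range d) (v := fun i => F.coeff (i + 1) * ((i + 1 : ℕ) : ∀ e, Residue (p e)))
    (fun i hi => .mul ho (hS₂ (hS₁ (kF _))) (hT₂ ⟨_, by simpa using hi, rfl⟩))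
    (by rintro _ ⟨i, hi, rfl⟩; exact ⟨i, by simpa, rfl⟩)
  rw [Finset.card_range, mul_one] at h1
  refine h1.decides fun S₃ hS₃ hT₃ => ?_
  have hS₀₃ := (hS₁.trans hS₂).trans hS₃
  set F' : (∀ e, Residue (p e))[X] :=
    polyOf d fun i => F.coeff (i + 1) * ((i + 1 : ℕ) : ∀ e, Residue (p e)) with hF'
  have dF' : F'.natDegree < d + 1 := (natDegree_polyOf_lt (by omega) _).trans (by omega)
  have kF' : Known S₃ F' := .polyOf (hS₀₃ pr.zero) fun i hi => hT₃ ⟨i, hi, rfl⟩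
  have sF' : ∀ e, sp e F' = derivative (sp e F) := by
    intro e
    ext i
    rw [coeff_sp, hF', coeff_polyOf, coeff_derivative, coeff_sp]
    split_ifs with hi
    · simp
    · rw [coeff_eq_zero_of_natDegree_lt (n := i + 1) (by omega)]
      simp
  refine Decides.gcd ho hi' hB dF dF' (kF.mono hS₀₃) kF' (fun e he => hF e (hD₁ he))
    fun D₄ hD₄ S₄ hS₄ U V dU dV kU kV hU => ?_
  have hS₀₄ := hS₀₃.trans hS₄
  have hD₁₄ := hD₄.trans hD₁
  have hfac' : ∀ e ∈ D₄, sp e V * (X ^ a * sp e U) =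
      (f e).map (Ideal.Quotient.mk (Ideal.span {p e})) := by
    intro e he
    rw [← hfac e (hD₁₄ he), ← (hU e he).1]
    ring
  refine Decides.singularTest st hB (pr.mono hS₀₄) dV (natDegree_polyOf_lt (by omega) _) kV
    (known_polyOf_X_pow_mul kU (d + 1) a) (fun e he h0 => ?_) (fun e he => ?_)
    fun D₅ hD₅ S₅ hS₅ hno => ?_
  · apply hF e (hD₁₄ he)
    rw [← coeff_sp, ← (hU e he).1, mul_coeff_zero, coeff_sp, h0, zero_mul]
  · rw [sp_polyOf_X_pow_mul st (hfac' e he), hfac' e he]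
  have hF0 : ∀ e ∈ D, sp e F ≠ 0 := by
    intro e he h0
    apply hF e he
    rw [← coeff_sp, h0, coeff_zero]
  have hbad : ∀ e ∈ D₅, ∀ φ, Irreducible φ → SingularAt (p e) (f e) φ → φ ^ 2 ∣ sp e F ∧
      ¬ (derivative φ ≠ 0 ∧ ∀ m : ℕ, 2 ≤ m → φ ^ m ∣ sp e F → ¬ φ ^ (m + 1) ∣ sp e F →
        (m : Residue (p e)) ≠ 0) := by
    intro e he φ hφ hsing
    have he₄ := hD₅ he
    have h2 := hsing.sq_dvd_of_not_singularAt_X hφ (hX e (hD₄ he₄)) (hfac e (hD₁₄ he₄))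
    refine ⟨h2, fun h3 => ?_⟩
    obtain ⟨h4, h5, h6⟩ := hU e he₄
    rw [sF'] at h5
    obtain ⟨h7, h8⟩ := dvd_of_sq_dvd (hF0 e (hD₁₄ he₄)) hφ h3.1 h2 h4 h5
      (fun q hq hq' => h6 q hq (by rwa [sF'])) h3.2
    refine hno e he φ hφ h7 ?_ hsing
    rw [sp_polyOf_X_pow_mul st (hfac' e he₄)]
    exact h8.mul_left _
  have hS₂₅ := (hS₃.trans hS₄).trans hS₅
  have hD₁₅ := hD₅.trans hD₁₄
  -- The first of the integers `2, …, d` that vanishes in `k_p` is the characteristic, if this is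
  -- positive and at most `d`.
  refine (Decides.firstZero (d - 1) (fun j => ((j + 2 : ℕ) : ∀ e, Residue (p e)))
    (c := K + (gcdCost B (d + 1) + testCost B d))
    (fun i hi => hS₂₅ (hT₂ ⟨_, by omega, rfl⟩)) (fun i hi => ?_) ?_).mono (by omega)
  · by_cases hℓ : (i + 2).Prime ∧ ∀ e ∈ D₅ ∩ {e | (∀ j < i,
        ((j + 2 : ℕ) : ∀ e, Residue (p e)) e ≠ 0) ∧ ((i + 2 : ℕ) : ∀ e, Residue (p e)) e = 0},
        CharP (Residue (p e)) (i + 2)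
    · refine (Decides.singularTest_of_char st hB (pr.mono (hS₀₄.trans hS₅)) dF
        (kF.mono (hS₀₄.trans hS₅)) (fun e he => hF e (hD₁₅ he.1)) (fun e he => hfac e (hD₁₅ he.1))
        hℓ.1 hℓ.2 (hρ _) (fun e he x => ?_) fun e he => hbad e he.1).mono ?_
      · have := hℓ.2 e he
        have h2 := ringChar.eq (Residue (p e)) (i + 2)
        have h3 := hρ' e (by omega) (by omega) x
        rwa [h2] at h3
      · rw [← add_assoc]
        exact Nat.add_le_add_right (hK _ (by omega) (by omega)) _
    -- Here no instance reaches the branch: any instance in it would make `i + 2` the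
    -- characteristic, hence prime.
    · refine .no fun e he => absurd ?_ hℓ
      have hchar : ∀ e ∈ D₅ ∩ {e | (∀ j < i, ((j + 2 : ℕ) : ∀ e, Residue (p e)) e ≠ 0) ∧
          ((i + 2 : ℕ) : ∀ e, Residue (p e)) e = 0}, ringChar (Residue (p e)) = i + 2 := by
        intro e he
        have h2 : ((i + 2 : ℕ) : Residue (p e)) = 0 := he.2.2
        have h3 := Nat.le_of_dvd (by omega) ((ringChar.spec (Residue (p e)) _).1 h2)
        have h4 : ringChar (Residue (p e)) ≠ 0 := fun h0 => by
          have := (ringChar.spec (Residue (p e)) _).1 h2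
          rw [h0, zero_dvd_iff] at this
          omega
        have h5 := CharP.ringChar_ne_one (R := Residue (p e))
        by_contra h6
        refine he.2.1 (ringChar (Residue (p e)) - 2) (by omega) ?_
        rw [Nat.sub_add_cancel (by omega)]
        exact ringChar.Nat.cast_ringChar
      refine ⟨?_, fun e he => hchar e he ▸ ringChar.charP _⟩
      rw [← hchar e he]
      exact (CharP.char_is_prime_or_zero (Residue (p e)) _).resolve_right
        (by rw [hchar e he]; omega)
  -- The characteristic is `0` or exceeds `d`. All degrees and multiplicities of factors of `F` are
  -- then nonzero in `k_p`, and the derivative test has missed nothing.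
  · refine .no fun e he hs => ?_
    obtain ⟨φ, hφ, hsing⟩ := isSingular_iff.1 hs
    obtain ⟨h2, h3⟩ := hbad e he.1 φ hφ hsing
    have hcast : ∀ m : ℕ, 1 ≤ m → m ≤ d → (m : Residue (p e)) ≠ 0 := by
      intro m hm hmd
      rcases Nat.lt_or_ge 1 m with h | h
      · have := he.2 (m - 2) (by omega)
        rwa [Nat.sub_add_cancel h] at this
      · obtain rfl : m = 1 := by omega
        simp
    have hdeg : ∀ m, φ ^ m ∣ sp e F → m * φ.natDegree ≤ d := by
      intro m hm
      rw [← natDegree_pow]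
      have h4 := natDegree_le_of_dvd hm (hF0 e (hD₁₅ he.1))
      have h5 := natDegree_sp_le e F
      omega
    have hpos := hφ.natDegree_pos
    have h4 := hdeg 2 h2
    refine h3 ⟨derivative_ne_zero_of_natCast (hcast _ hpos (by omega)), fun m hm hmF _ =>
      hcast m (by omega) ?_⟩
    exact (Nat.le_mul_of_pos_right m hpos).trans (hdeg m hmF)

end Index

/-! ### The total cost is softly linear. -/

section Cost

theorem soft_le {n d : ℕ} (hd : 1 ≤ d) (hn : n ≤ 4 * d) (c κ : ℕ) (hκ : κ ≤ 8) :
    soft c κ n ≤ c * 4 * 3 ^ 8 * (d * (Nat.log 2 d + 1) ^ 8) := by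
  have hlog : Nat.log 2 n ≤ Nat.log 2 d + 2 := by
    calc Nat.log 2 n ≤ Nat.log 2 (d * 2 * 2) := Nat.log_mono_right (by omega)
      _ = Nat.log 2 d + 2 := by
        rw [Nat.log_mul_base one_lt_two (by omega), Nat.log_mul_base one_lt_two (by omega)]
  calc soft c κ n ≤ c * (4 * d) * (3 * (Nat.log 2 d + 1)) ^ 8 := by
        rw [soft]
        refine Nat.mul_le_mul (Nat.mul_le_mul_left _ hn) ?_
        exact (Nat.pow_le_pow_left (by omega) κ).trans (Nat.pow_le_pow_right (by omega) hκ)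
    _ = _ := by rw [mul_pow]; ring

theorem exists_indexCost_le (B : ℕ) : ∃ C, ∀ d, 1 ≤ d → ∃ K,
    (∀ ℓ, 1 ≤ ℓ → ℓ ≤ d → ℓ * (d / ℓ + 1) + ℓ * gcdCost B (d / ℓ + 1) ≤ K) ∧
      8 + indexCost B d K ≤ C * d * (Nat.log 2 d + 1) ^ 8 := by
  obtain ⟨B', hB'⟩ := exists_gcdCost_le B
  refine ⟨18 * (B * 4 * 3 ^ 8) + 12 * (B' * 4 * 3 ^ 8) + 200, fun d hd => ?_⟩
  have h1 := soft_le hd (n := d + 1) (by omega) B 7 (by omega)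
  have h2 := (hB' (d + 1) (by omega)).trans (soft_le hd (by omega) B' 8 le_rfl)
  have h3 := (hB' (2 * d + 2) (by omega)).trans (soft_le hd (by omega) B' 8 le_rfl)
  have h4 : d ≤ d * (Nat.log 2 d + 1) ^ 8 := Nat.le_mul_of_pos_right _ (by positivity)
  refine ⟨2 * d + 2 * (B' * 4 * 3 ^ 8 * (d * (Nat.log 2 d + 1) ^ 8)), fun ℓ hℓ hℓd => ?_, ?_⟩
  · have h5 : ℓ * (d / ℓ + 1) ≤ 2 * d := by
      have := Nat.mul_div_le d ℓ
      rw [mul_add]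
      omega
    refine Nat.add_le_add h5 ?_
    have h6 : d / ℓ + 1 ≤ 2 * d := (Nat.le_mul_of_pos_left _ hℓ).trans h5
    have hlog : Nat.log 2 (d / ℓ + 1) ≤ Nat.log 2 d + 1 := by
      calc Nat.log 2 (d / ℓ + 1) ≤ Nat.log 2 (d * 2) := Nat.log_mono_right (by rwa [mul_comm])
        _ = Nat.log 2 d + 1 := Nat.log_mul_base one_lt_two (by omega)
    calc ℓ * gcdCost B (d / ℓ + 1) ≤ ℓ * soft B' 8 (d / ℓ + 1) :=
          Nat.mul_le_mul_left _ (hB' _ (Nat.succ_pos _))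
      _ = B' * (ℓ * (d / ℓ + 1)) * (Nat.log 2 (d / ℓ + 1) + 1) ^ 8 := by rw [soft]; ring
      _ ≤ B' * (2 * d) * (3 * (Nat.log 2 d + 1)) ^ 8 := by
          refine Nat.mul_le_mul (Nat.mul_le_mul_left _ h5) (Nat.pow_le_pow_left (by omega) _)
      _ ≤ _ := by rw [mul_pow]; nlinarith [Nat.zero_le (B' * d * (Nat.log 2 d + 1) ^ 8)]
  · rw [indexCost, testCost, mul_assoc _ d]
    generalize d * (Nat.log 2 d + 1) ^ 8 = x at *
    nlinarith

end Cost

/-! ### All problems of degree `d` as one family, and the resulting trees. -/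

section Main

attribute [local instance] residueField

section Input

variable {E : Type v} {A : E → Type u} [∀ e, CommRing (A e)] [∀ e, IsDomain (A e)] {p : ∀ e, A e}
  {s : ∀ e, Residue (p e) → A e} {f : ∀ e, (A e)[X]} {d : ℕ}
  {R : Set Instr}

theorem Decides.of_input (st : Setting p s f d R) (hd : 1 ≤ d) {P : E → Prop} {c : ℕ} {D : Set E}
    (h : ∀ S, Prepared p s f S → Decides (instrOps p s R) P c D S) :
    Decides (instrOps p s R) P (8 + c) D
      {x | ∃ i < 2 * d, x = fun e => input (p e) (s e) (f e) i} := by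
  have ho := ringOps_subset_instrOps (p := p) (s := s) st.instr
  set S : Set (∀ e, Residue (p e)) := {x | ∃ i < 2 * d, x = fun e => input (p e) (s e) (f e) i}
  have hx : (fun e => input (p e) (s e) (f e) 0) ∈ S := ⟨0, by omega, rfl⟩
  refine (((Comp.zero ho hx).union (Comp.one ho hx)).union ((Comp.digits_zero st.instr hx).union
    (Comp.digits_one st.ne_zero st.repr st.instr hx))).decides (c := 1 + 1 + (2 + 4))
    fun S' hS hT => h S' ?_
  -- The leading coefficient `1` is not part of the input; its digits, like those of `0`, are among
  -- the eight operations spent beforehand.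
  have hcoeff : ∀ i, d ≤ i → (fun e => (f e).coeff i) = if i = d then 1 else 0 := by
    intro i hi
    split_ifs with h
    · ext e
      rw [h, ← st.natDegree e]
      exact st.monic e
    · ext e
      exact coeff_eq_zero_of_natDegree_lt (by rw [st.natDegree]; omega)
  refine ⟨hT (.inl (.inl rfl)), hT (.inl (.inr rfl)), hT (.inr (.inl (.inr rfl))), fun i => ?_,
    fun i => ?_⟩
  · rcases Nat.lt_or_ge i d with hi | hi
    · refine hS ⟨i, by omega, ?_⟩
      ext e
      rw [input, st.natDegree, if_pos hi]
      rfl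
    · rw [hcoeff i hi]
      split_ifs
      exacts [hT (.inr (.inr (.inl rfl))), hT (.inr (.inl (.inl rfl)))]
  · rcases Nat.lt_or_ge i d with hi | hi
    · refine hS ⟨d + i, by omega, ?_⟩
      ext e
      rw [input, st.natDegree, if_neg (by omega), if_pos (by omega), Nat.add_sub_cancel_left]
      rfl
    · rw [hcoeff i hi]
      split_ifs
      exacts [hT (.inr (.inr (.inr rfl))), hT (.inr (.inl (.inr rfl)))]

end Input

/-- An instance of the problem: a defining polynomial of degree `d` over a principal ideal domain,
and a prime of the latter. -/
structure Problem (d : ℕ) : Type (u + 1) where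
  A : Type u
  [commRing : CommRing A]
  [isDomain : IsDomain A]
  [isPrincipalIdealRing : IsPrincipalIdealRing A]
  p : A
  prime : Prime p
  s : Residue p → A
  repr : IsRepresentatives p s
  f : A[X]
  isDefining : IsDefining f
  natDegree : f.natDegree = d

attribute [instance] Problem.commRing Problem.isDomain Problem.isPrincipalIdealRing

instance {d : ℕ} (e : Problem.{u} d) : (Ideal.span {e.p}).IsMaximal :=
  PrincipalIdealRing.isMaximal_of_irreducible e.prime.irreducible

/-- A set `Q` of problems is decided by trees of softly linear cost with the operations in `R`, if
these operations include the extraction of `ℓ`-th roots where these are needed. -/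
theorem exists_tree : ∃ C, ∀ (d : ℕ) (Q : Problem.{u} d → Prop) (R : Set Instr)
    (_ : ∀ o, o ≠ Instr.root → o ∈ R)
    (ρ : (∀ e : {e // Q e}, Residue e.1.p) → ∀ e : {e // Q e}, Residue e.1.p)
    (_ : ∀ S, ∀ x ∈ S, Comp (instrOps (fun e : {e // Q e} => e.1.p) (fun e => e.1.s) R) {ρ x} 1 S)
    (_ : ∀ e : {e // Q e}, ringChar (Residue e.1.p) ≠ 0 → ringChar (Residue e.1.p) ≤ d →
      ∀ x, ρ x e ^ ringChar (Residue e.1.p) = x e),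
    ∃ t : CompTree, (1 ≤ d → t.cost ≤ C * d * (Nat.log 2 d + 1) ^ 8) ∧
      (Instr.root ∉ R → t.RootFree) ∧
      ∀ e, Q e → ∀ D, IsIndex e.f D → (t.run e.p e.s (input e.p e.s e.f) = true ↔ e.p ∣ D) := by
  classical
  -- The ring in which one computes is a product over all problems, hence lives one universe higher.
  obtain ⟨B, hB⟩ := exists_mulCost.{u + 1}
  obtain ⟨C, hC⟩ := exists_indexCost_le B
  refine ⟨C, fun d Q R hR ρ hρ hρ' => ?_⟩
  rcases Nat.eq_zero_or_pos d with rfl | hd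
  -- A monic polynomial of degree zero is `1` and not irreducible, so there are no instances.
  · refine ⟨.leaf true, by simp, fun _ => trivial, fun e _ => ?_⟩
    have h1 := e.isDefining.irreducible
    rw [e.isDefining.monic.natDegree_eq_zero.1 e.natDegree] at h1
    exact absurd h1 not_irreducible_one
  obtain ⟨K, hK, hcost⟩ := hC d hd
  have st : Setting (fun e : {e // Q e} => e.1.p) (fun e => e.1.s) (fun e => e.1.f) d R :=
    ⟨fun e => e.1.prime.ne_zero, fun e => e.1.repr, hR, fun e => e.1.isDefining.monic,
      fun e => e.1.natDegree⟩
  obtain ⟨t, ht, htR, hrun⟩ := (Decides.of_input st hd fun S pr =>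
    Decides.isSingular st hd hB hK hρ hρ' pr).exists_tree _ _
      (fun x => if h : ∃ i < 2 * d, x = fun e : {e // Q e} => input e.1.p e.1.s e.1.f i
        then h.choose else 0)
      (2 * d) (fun x hx => by
        rw [Set.mem_ofPred_eq] at hx
        rw [dif_pos hx]
        exact hx.choose_spec.1)
  refine ⟨t, fun _ => ht.trans hcost, htR, fun e he D hD => ?_⟩
  rw [isSingular_iff_dvd_index e.isDefining e.prime hD]
  refine hrun ⟨e, he⟩ trivial _ fun x hx => ?_
  rw [Set.mem_ofPred_eq] at hx
  rw [dif_pos hx]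
  exact (congrFun hx.choose_spec.2 ⟨e, he⟩).symm

end Main

end IndexTest

theorem mainTheorem11 :
    (∀ (A : Type u) [CommRing A] [IsDomain A] [IsPrincipalIdealRing A] (p : A), Prime p →
      ∀ f g : A[X], IndexTest.IsDefining f → IndexTest.IsDefining g →
        f.map (Ideal.Quotient.mk (Ideal.span {p ^ 2})) =
          g.map (Ideal.Quotient.mk (Ideal.span {p ^ 2})) →
        ∀ D E : A, IndexTest.IsIndex f D → IndexTest.IsIndex g E → (p ∣ D ↔ p ∣ E)) ∧
    (∃ T : ℕ → IndexTest.CompTree,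
      IndexTest.SoftlyLinear (fun d => (T d).cost) ∧ (∀ d, (T d).RootFree) ∧
      ∀ (A : Type u) [CommRing A] [IsDomain A] [IsPrincipalIdealRing A] (p : A), Prime p →
        ∀ s : IndexTest.Residue p → A, IndexTest.IsRepresentatives p s →
        ∀ d : ℕ, (ringChar (IndexTest.Residue p) = 0 ∨ d < ringChar (IndexTest.Residue p) ∨
            Nat.card (IndexTest.Residue p) = ringChar (IndexTest.Residue p)) →
          (T d).DecidesIndex p s d) ∧
    (∃ T : ℕ → IndexTest.CompTree,
      IndexTest.SoftlyLinear (fun d => (T d).cost) ∧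
      ∀ (A : Type u) [CommRing A] [IsDomain A] [IsPrincipalIdealRing A] (p : A), Prime p →
        ∀ s : IndexTest.Residue p → A, IndexTest.IsRepresentatives p s →
        (Function.Surjective fun a : IndexTest.Residue p =>
            a ^ ringExpChar (IndexTest.Residue p)) →
        ∀ d : ℕ, (T d).DecidesIndex p s d) := by
  open IndexTest in
  obtain ⟨C, hC⟩ := exists_tree.{u}
  refine ⟨fun A _ _ _ p hp f g hf hg hfg D E hD hE => ?_, ?_, ?_⟩
  · rw [isSingular_iff_dvd_index hf hp hD, isSingular_iff_dvd_index hg hp hE]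
    exact ⟨fun h => h.congr hfg, fun h => h.congr hfg.symm⟩
  -- The root map is the identity. It has to be correct only if the characteristic is positive and
  -- at most `d`; then `k_p` is a prime field and `x ^ ℓ = x`.
  · have h := fun d => hC d (fun e => ringChar (Residue e.p) = 0 ∨ d < ringChar (Residue e.p) ∨
      Nat.card (Residue e.p) = ringChar (Residue e.p)) {o | o ≠ .root} (fun _ h => h) id
      (fun S x hx => .done (by simpa)) (fun e h0 hle x => ?_)
    · choose T h1 h2 h3 using h
      exact ⟨T, ⟨C, 8, h1⟩, fun d => h2 d (by simp), fun A _ _ _ p hp s hs d hd f hf hfd =>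
        h3 d ⟨A, p, hp, s, hs, f, hf, hfd⟩ hd⟩
    · have hcard : Nat.card (Residue e.1.p) = ringChar (Residue e.1.p) := by
        rcases e.2 with h | h | h
        · exact absurd h h0
        · omega
        · exact h
      let := residueField e.1.p
      have := Nat.finite_of_card_ne_zero (hcard ▸ h0)
      have := Fintype.ofFinite (Residue e.1.p)
      have h1 := FiniteField.pow_card (x e)
      rwa [← Nat.card_eq_fintype_card, hcard] at h1
  · have h := fun d => hC d (fun e => Function.Surjective fun a : Residue e.p =>
      a ^ ringExpChar (Residue e.p)) Set.univ (fun _ _ => trivial)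
      (fun x e => charRoot e.1.p (x e))
      (fun S x hx => Comp.instr (o := .root) (Set.mem_univ _) hx hx) (fun e h0 hle x => ?_)
    · choose T h1 _ h3 using h
      exact ⟨T, ⟨C, 8, h1⟩, fun A _ _ _ p hp s hs hperf d f hf hfd =>
        h3 d ⟨A, p, hp, s, hs, f, hf, hfd⟩ hperf⟩
    · have hex : ∃ b, b ^ ringExpChar (Residue e.1.p) = x e := e.2 (x e)
      have h1 : ringExpChar (Residue e.1.p) = ringChar (Residue e.1.p) :=
        max_eq_left (Nat.one_le_iff_ne_zero.2 h0)
      change charRoot _ _ ^ _ = _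
      rw [charRoot, dif_pos hex]
      conv_lhs => rw [← h1]
      exact hex.choose_spec
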